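/- Use coordinates $(x_1,x_2,y_1,y_2,z_1,z_2)$ on $\mathbb{R}^6$. **Definitions.** Let $D$ be a smooth corank-2 distribution on a 6-manifold $M$. - $D$ is *fat* if at every point the quadratic form $\psi\mapsto (d\psi|_D)\wedge(d\psi|_D)\in\Lambda^4D^*$ on the annihilator $D^\perp\subset T^*M$ is definite. - Vector fields $Z_1,Z_2$ near $p$ are *Reeb directions* of $D$ if near $p$ one can write $D=\ker\lambda_1\cap\ker\lambda_2$ with smooth 1-forms such that $TM=D\oplus\langle Z_1,Z_2\rangle$, $\lambda_i(Z_j)=\delta_{ij}$, $\iota_{Z_i}d\lambda_j|_D=0$ for all $i,j$, and $[Z_1,Z_2]=0$. - The germ of $D$ at $p$ *supports a complex contact structure* (is a *complex-contact germ*) if there are smooth complex coordinates $\Phi$ from a neighbourhood of $p$ to an open subset of $\mathbb{C}^3$ and a holomorphic 1-form $\alpha$ near $\Phi(p)$ with $\alpha\wedge d\alpha\neq0$ such that $D=\{v:\alpha(d\Phi(v))=0\}$ near $p$. - Let $X$ be a set of germs of distributions at $p$ and $A\subseteq X$. A *smooth family in $X$ through $a$* is a family $(D_s)$ of germs in $X$,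 with $s$ near $0\in\mathbb{R}^m$ and $D_0=a$, defined near $p$ (uniformly in $s$) by two pointwise independent 1-forms depending jointly smoothly on $s$ and the point. $A$ has *codimension at least $n$ in $X$* if for every $a\in A$ there is a function $G$ from germs to $\mathbb{R}^n$ that vanishes on $A$, such that $s\mapsto G(D_s)$ is smooth near $0$ for every smooth family in $X$ through $a$, and has surjective differential at $s=0$ for some $n$-parameter smooth family in $X$ through $a$. $A$ has *infinite codimension in $X$* if this holds for every $n\in\mathbb{N}$. **Theorem.** For smooth $\kappa:\mathbb{R}\to\mathbb{R}$ let $\mathcal{H}_\kappa=\ker\alpha^1_\kappa\cap\ker\alpha^2$ on $\mathbb{R}^6$, where $$\alpha^1_\kappa=dz_1-y_1dx_1-y_2dx_2-\Big(\tfrac{x_2^3}{3}+x_2+2x_1+\kappa(y_1)\Big)dy_1,\qquad \alpha^2=dz_2-y_2dx_1-y_1dx_2 .$$ 1. For every smooth $\kappa$, the germ of $\mathcal{H}_\kappa$ at $0$ (i) is a fat corank-2 distribution germ, (ii) has Reeb directions $\partial_{z_1},\partial_{z_2}$, and (iii) no germ diffeomorphic to it supports a complex contact structure. The family of germs is infinite-dimensional: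 if $\mathcal{H}_\kappa$ and $\mathcal{H}_{\kappa'}$ have the same germ at $0$, then $\kappa$ and $\kappa'$ have the same germ at $0$. 2. Let $M$ be a smooth manifold of dimension $6$ and $p\in M$. For every smooth chart $e$ around $p$ with $e(p)=0$ and every smooth $\kappa$, the germ at $p$ that corresponds to $\mathcal{H}_\kappa$ under $e$ is a fat $(4,6)$-germ with Reeb directions and is not a complex-contact germ. The set of complex-contact germs at $p$ is a nonempty subset of the set of fat $(4,6)$-germs at $p$ with Reeb directions, and it has infinite codimension in it. -/

import Mathlib

open Set Filter Topology
open scoped ContDiff Manifold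

namespace FatReeb

/-- Real six-space, with coordinates `(x₁, x₂, y₁, y₂, z₁, z₂)` at the indices `0, …, 5`. -/
abbrev E6 : Type := EuclideanSpace ℝ (Fin 6)

/-- Complex three-space. -/
abbrev C3 : Type := EuclideanSpace ℂ (Fin 3)

/-! ### Forms, smooth germs and local diffeomorphisms in vector spaces -/

/-- `f` is smooth on a whole neighbourhood of `p`, i.e. it defines a smooth germ at `p`. -/
def SmoothNear {V W : Type*} [NormedAddCommGroup V] [NormedSpace ℝ V] [NormedAddCommGroup W]
    [NormedSpace ℝ W] (f : V → W) (p : V) : Prop :=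
  ∀ᶠ x in 𝓝 p, ContDiffAt ℝ ∞ f x

/-- `Φ` is a diffeomorphism from a neighbourhood of `p` onto a neighbourhood of `Φ p`
(formulated by the inverse function theorem). -/
def IsLocalDiffeoNear {V W : Type*} [NormedAddCommGroup V] [NormedSpace ℝ V]
    [NormedAddCommGroup W] [NormedSpace ℝ W] (Φ : V → W) (p : V) : Prop :=
  SmoothNear Φ p ∧ Function.Bijective (fderiv ℝ Φ p)

/-- The exterior derivative `dθ(u, v)` at `x` of a one-form `θ` on a vector space. -/
noncomputable def extD {𝕜 V : Type*} [NontriviallyNormedField 𝕜] [NormedAddCommGroup V]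
    [NormedSpace 𝕜 V] (θ : V → V →L[𝕜] 𝕜) (x u v : V) : 𝕜 :=
  fderiv 𝕜 θ x u v - fderiv 𝕜 θ x v u

/-- The value `(η ∧ η)(v₀, v₁, v₂, v₃)` for a two-form `η`. -/
def wedgeSq {V : Type*} (η : V → V → ℝ) (v : Fin 4 → V) : ℝ :=
  2 * (η (v 0) (v 1) * η (v 2) (v 3) - η (v 0) (v 2) * η (v 1) (v 3)
    + η (v 0) (v 3) * η (v 1) (v 2))

/-! ### Germs of corank-two distributions on six-space -/

/-- Near `p`, the field of subspaces `D` is the smooth corank-two distribution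
`ker θ₀ ∩ ker θ₁` for smooth one-forms `θ₀, θ₁` that are independent at `p` (hence near `p`). -/
def IsDefinedBy (D : E6 → Submodule ℝ E6) (θ : Fin 2 → E6 → E6 →L[ℝ] ℝ) (p : E6) : Prop :=
  (∀ i, SmoothNear (θ i) p) ∧ LinearIndependent ℝ (fun i => θ i p) ∧
    ∀ᶠ x in 𝓝 p, ∀ v, v ∈ D x ↔ ∀ i, θ i x v = 0

/-- The germ of `D` at `p` is a fat (elliptic) corank-two distribution germ: near `p` the quadratic
form `(a, b) ↦ (d(a θ₀ + b θ₁)|_D)²` on the annihilator of `D`, with values in the line `Λ⁴D*`, is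
definite. An identification of `Λ⁴D*` with `ℝ` is given by evaluation on a frame of `D`. The
coefficients `a, b` may be taken constant, since the restriction to `D` of the exterior derivative
of a section of the annihilator is tensorial. -/
def IsFat (D : E6 → Submodule ℝ E6) (p : E6) : Prop :=
  ∃ θ : Fin 2 → E6 → E6 →L[ℝ] ℝ, IsDefinedBy D θ p ∧
    ∀ᶠ x in 𝓝 p, ∃ v : Fin 4 → E6, (∀ i, v i ∈ D x) ∧
      ∀ a b : ℝ, (a, b) ≠ (0, 0) →
        0 < wedgeSq (fun u w => a * extD (θ 0) x u w + b * extD (θ 1) x u w) v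

/-- Near `p`, the vector fields `Z 0, Z 1` are Reeb directions of the corank-two distribution
`D`. -/
def AreReebDirections (D : E6 → Submodule ℝ E6) (Z : Fin 2 → E6 → E6) (p : E6) : Prop :=
  (∀ i, SmoothNear (Z i) p) ∧
  ∃ θ : Fin 2 → E6 → E6 →L[ℝ] ℝ, IsDefinedBy D θ p ∧
    ∀ᶠ x in 𝓝 p,
      IsCompl (D x) (Submodule.span ℝ (range fun i => Z i x)) ∧
      (∀ i j, θ i x (Z j x) = if i = j then 1 else 0) ∧
      (∀ i j, ∀ v ∈ D x, extD (θ j) x (Z i x) v = 0) ∧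
      VectorField.lieBracket ℝ (Z 0) (Z 1) x = 0

/-- `α` is a holomorphic one-form near `q ∈ ℂ³` with `α ∧ dα ≠ 0` at `q` (hence near `q`). -/
def IsHolomorphicContactForm (α : C3 → C3 →L[ℂ] ℂ) (q : C3) : Prop :=
  AnalyticAt ℂ α q ∧ ∃ u v w : C3,
    α q u * extD α q v w + α q v * extD α q w u + α q w * extD α q u v ≠ 0

/-- The germ of `D` at `p` supports a complex contact structure: some smooth complex coordinate
chart `Φ` near `p` carries `D` to the kernel of a holomorphic contact form. -/
def SupportsComplexContact (D : E6 → Submodule ℝ E6) (p : E6) : Prop :=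
  ∃ Φ : E6 → C3, IsLocalDiffeoNear Φ p ∧
    ∃ α : C3 → C3 →L[ℂ] ℂ, IsHolomorphicContactForm α (Φ p) ∧
      ∀ᶠ x in 𝓝 p, ∀ v, v ∈ D x ↔ α (Φ x) (fderiv ℝ Φ x v) = 0

/-- The germ of `D` at `p` and the germ of `D'` at `q` are diffeomorphic. -/
def DiffeomorphicGerms (D : E6 → Submodule ℝ E6) (p : E6) (D' : E6 → Submodule ℝ E6) (q : E6) :
    Prop :=
  ∃ Φ : E6 → E6, IsLocalDiffeoNear Φ p ∧ Φ p = q ∧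
    ∀ᶠ x in 𝓝 p, D' (Φ x) = (D x).map (fderiv ℝ Φ x : E6 →ₗ[ℝ] E6)

/-! ### The family `H_κ` -/

/-- The differential of the `i`-th coordinate. -/
noncomputable def dcoord (i : Fin 6) : E6 →L[ℝ] ℝ := EuclideanSpace.proj i

/-- `α¹_κ = dz₁ - y₁ dx₁ - y₂ dx₂ - (x₂³/3 + x₂ + 2 x₁ + κ(y₁)) dy₁`. -/
noncomputable def alpha1 (κ : ℝ → ℝ) (p : E6) : E6 →L[ℝ] ℝ :=
  dcoord 4 - p 2 • dcoord 0 - p 3 • dcoord 1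
    - ((p 1) ^ 3 / 3 + p 1 + 2 * p 0 + κ (p 2)) • dcoord 2

/-- `α² = dz₂ - y₂ dx₁ - y₁ dx₂`. -/
noncomputable def alpha2 (p : E6) : E6 →L[ℝ] ℝ :=
  dcoord 5 - p 3 • dcoord 0 - p 2 • dcoord 1

/-- `H_κ = ker α¹_κ ∩ ker α²`. -/
noncomputable def H (κ : ℝ → ℝ) (p : E6) : Submodule ℝ E6 :=
  (alpha1 κ p : E6 →ₗ[ℝ] ℝ).ker ⊓ (alpha2 p : E6 →ₗ[ℝ] ℝ).ker

/-- The constant vector fields `∂_{z₁}, ∂_{z₂}`. -/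
noncomputable def dz : Fin 2 → E6 → E6 :=
  ![fun _ => EuclideanSpace.single 4 1, fun _ => EuclideanSpace.single 5 1]

/-! ### Germs of distributions on six-manifolds -/

section Manifold

variable (M : Type*) [TopologicalSpace M] [ChartedSpace E6 M]

/-- Fields of tangent subspaces on `M` (smoothness is imposed separately, near a point). -/
abbrev Distribution : Type _ := ∀ x : M, Submodule ℝ (TangentSpace 𝓘(ℝ, E6) x)

variable {M}

/-- The distribution `D` read in the chart `e`, i.e. its image under the differential of `e`. -/
noncomputable def inChart (e : OpenPartialHomeomorph M E6) (D : Distribution M) (y : E6) :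
    Submodule ℝ E6 :=
  (D (e.symm y)).map (mfderiv 𝓘(ℝ, E6) 𝓘(ℝ, E6) e (e.symm y)).toLinearMap

/-- `e` is a smooth chart of `M` around `p`. -/
def IsChartAt (e : OpenPartialHomeomorph M E6) (p : M) : Prop :=
  e ∈ IsManifold.maximalAtlas 𝓘(ℝ, E6) ∞ M ∧ p ∈ e.source

/-- The distributions whose germ at `p` is a fat `(4,6)`-germ admitting Reeb directions. -/
def fatReebGerms (p : M) : Set (Distribution M) :=
  {D | ∃ e : OpenPartialHomeomorph M E6, IsChartAt e p ∧ IsFat (inChart e D) (e p) ∧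
    ∃ Z : Fin 2 → E6 → E6, AreReebDirections (inChart e D) Z (e p)}

/-- The distributions whose germ at `p` underlies a complex contact structure. -/
def complexContactGerms (p : M) : Set (Distribution M) :=
  {D | ∃ e : OpenPartialHomeomorph M E6, IsChartAt e p ∧
    SupportsComplexContact (inChart e D) (e p)}

/-- `D` is a smooth family of corank-two distribution germs at `p` with parameter `s ∈ ℝᵐ`
near `0`: in a chart, `D s = ker θ₀(s, ·) ∩ ker θ₁(s, ·)` near `p` for all small `s`, with one-forms
that are jointly smooth in the parameter and the point, and independent. -/
def IsSmoothFamily {m : ℕ} (D : EuclideanSpace ℝ (Fin m) → Distribution M) (p : M) : Prop :=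
  ∃ e : OpenPartialHomeomorph M E6, IsChartAt e p ∧
    ∃ θ : Fin 2 → EuclideanSpace ℝ (Fin m) × E6 → E6 →L[ℝ] ℝ,
      (∀ i, SmoothNear (θ i) (0, e p)) ∧ LinearIndependent ℝ (fun i => θ i (0, e p)) ∧
      ∀ᶠ z in 𝓝 ((0 : EuclideanSpace ℝ (Fin m)), e p),
        ∀ v, v ∈ inChart e (D z.1) z.2 ↔ ∀ i, θ i z v = 0

/-- `D` is a smooth `m`-parameter family of germs at `p` that passes through the germ of `a` at
parameter `0` and stays in `X`. -/
def IsFamilyThrough (X : Set (Distribution M)) (p : M) (a : Distribution M) {m : ℕ}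
    (D : EuclideanSpace ℝ (Fin m) → Distribution M) : Prop :=
  IsSmoothFamily D p ∧ (∀ᶠ x in 𝓝 p, D 0 x = a x) ∧ ∀ᶠ s in 𝓝 0, D s ∈ X

/-- For classes `A, X` of germs at `p`: `A` has codimension at least `n` in `X`. Around each of its
members, `A` lies in the common zero set of `n` functions `G = (G₁, …, Gₙ)` on the space of germs,
which are smooth along smooth families in `X` and whose differentials are independent: `G` restricts
to a submersion onto `ℝⁿ` along some `n`-parameter family in `X`. -/
def HasCodimGE (A X : Set (Distribution M)) (p : M) (n : ℕ) : Prop :=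
  ∀ a ∈ A ∩ X, ∃ G : Distribution M → EuclideanSpace ℝ (Fin n),
    (∀ D D' : Distribution M, (∀ᶠ x in 𝓝 p, D x = D' x) → G D = G D') ∧
    (∀ D ∈ A ∩ X, G D = 0) ∧
    (∀ (m : ℕ) (D : EuclideanSpace ℝ (Fin m) → Distribution M),
      IsFamilyThrough X p a D → SmoothNear (fun s => G (D s)) 0) ∧
    ∃ D : EuclideanSpace ℝ (Fin n) → Distribution M, IsFamilyThrough X p a D ∧
      Function.Surjective (fderiv ℝ (fun s => G (D s)) 0)

/-- `A` has infinite codimension in `X`. -/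
def HasInfiniteCodim (A X : Set (Distribution M)) (p : M) : Prop :=
  ∀ n : ℕ, HasCodimGE A X p n

end Manifold

end FatReeb

/-! Near a point write a corank-two distribution as a graph `dz = ∑ f_i dx_i` with complex `z` and
put `θ = dz - ∑ f_i dx_i`. Fatness says that the curvature `dθ`, restricted to the distribution,
spans with its conjugate an elliptic pencil. Hence there is a unique `μ` with `|μ| < 1` for
which the Pfaffian of the restriction of `d(θ + μ θ̄)` vanishes, and its kernel is the space of
`(0, 1)`-vectors of the only almost complex structure that a complex contact structure could
induce. A holomorphic contact form is locally `dw - v du`, by straightening a field in its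
kernel with a holomorphic flow, so it is a multiple of `θ + μ θ̄` or of its conjugate, and then
`d(θ + μ θ̄)` also vanishes between these `(0, 1)`-vectors and the kernel of `θ + μ θ̄`. The
failure of this identity, the torsion, is a smooth function of the two-jet of the graph.

The torsion of `H κ` vanishes only on the hyperplane `x₂ = 0`. For the graphs
`dw = v du - Φ(ū) dv̄` it is `Φ''(ū)`, so the components of its jets at the origin are independent
functions near the standard complex contact structure. This gives the infinite codimension. -/

namespace FatReeb

/-! ### Flows of analytic vector fields -/

section Composition

variable {K 𝕜 E F : Type*} [TopologicalSpace K] [CompactSpace K] [NontriviallyNormedField 𝕜]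
  [NormedAddCommGroup E] [NormedSpace 𝕜 E] [NormedAddCommGroup F] [NormedSpace 𝕜 F]

/-- The action of a continuous multilinear map on tuples of continuous functions, pointwise.
Applied to the coefficients of a power series it yields the power series of a composition
operator. -/
noncomputable def pointwiseMultilinear {n : ℕ}
    (p : ContinuousMultilinearMap 𝕜 (fun _ : Fin n => E) F) :
    ContinuousMultilinearMap 𝕜 (fun _ : Fin n => C(K, E)) C(K, F) :=
  MultilinearMap.mkContinuous
    { toFun := fun γ => ⟨fun k => p fun i => γ i k, by fun_prop⟩
      map_update_add' := fun {_} m i x y => by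
        ext k
        have hupdate (z : C(K, E)) : (fun j => Function.update m i z j k)
            = Function.update (fun j => m j k) i (z k) := by
          ext j; by_cases h : j = i
          · subst h; simp
          · simp [h]
        simp [hupdate]
      map_update_smul' := fun {_} m i c x => by
        ext k
        have hupdate (z : C(K, E)) : (fun j => Function.update m i z j k)
            = Function.update (fun j => m j k) i (z k) := by
          ext j; by_cases h : j = i
          · subst h; simp
          · simp [h]
        simp [hupdate] }
    ‖p‖ fun γ => by
      refine (ContinuousMap.norm_le _ (by positivity)).2 fun k => (p.le_opNorm _).trans ?_
      gcongr with i
      exact (γ i).norm_coe_le_norm k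

lemma norm_pointwiseMultilinear_le {n : ℕ}
    (p : ContinuousMultilinearMap 𝕜 (fun _ : Fin n => E) F) :
    ‖(pointwiseMultilinear p : ContinuousMultilinearMap 𝕜 (fun _ : Fin n => C(K, E)) C(K, F))‖
      ≤ ‖p‖ :=
  MultilinearMap.mkContinuous_norm_le _ (norm_nonneg _) _

lemma exists_analyticAt_postcomp [CompleteSpace F] {f : E → F} {x : E} (hf : AnalyticAt 𝕜 f x) :
    ∃ Ω : C(K, E) → C(K, F), AnalyticAt 𝕜 Ω (.const K x) ∧
      ∀ᶠ γ in 𝓝 (ContinuousMap.const K x), ∀ k, Ω γ k = f (γ k) := by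
  obtain ⟨p, r, hp⟩ := hf
  let P : FormalMultilinearSeries 𝕜 C(K, E) C(K, F) := fun n => pointwiseMultilinear (p n)
  have hradius : p.radius ≤ P.radius :=
    FormalMultilinearSeries.radius_le_of_le fun n => norm_pointwiseMultilinear_le (p n)
  have hP : HasFPowerSeriesOnBall (fun γ => P.sum (γ - .const K x)) P (.const K x) P.radius := by
    simpa using (P.hasFPowerSeriesOnBall
      ((hp.r_pos.trans_le hp.r_le).trans_le hradius)).comp_sub (.const K x)
  refine ⟨_, hP.analyticAt, ?_⟩
  filter_upwards [Metric.eball_mem_nhds (ContinuousMap.const K x) hp.r_pos] with γ hγ k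
  have hγk : γ k ∈ Metric.eball x r := by
    refine lt_of_le_of_lt ?_ (Metric.mem_eball.1 hγ)
    rw [edist_dist, edist_dist]
    exact ENNReal.ofReal_le_ofReal (γ.dist_apply_le_dist (g := .const K x) k)
  have hsum := (hP.hasSum_sub (Metric.eball_subset_eball (hp.r_le.trans hradius) hγ)).mapL
    (ContinuousMap.evalCLM 𝕜 k)
  exact hsum.unique (hp.hasSum_sub hγk)

end Composition

section Flow

variable {E : Type*} [NormedAddCommGroup E] [NormedSpace ℂ E]

/-- The primitive vanishing at `0` of a continuous function on the unit interval. -/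
noncomputable def primitive : C(unitInterval, E) →L[ℂ] C(unitInterval, E) :=
  LinearMap.mkContinuous
    { toFun := fun f => ⟨fun s => ∫ r in (0 : ℝ)..s, IccExtend zero_le_one f r,
        (intervalIntegral.continuous_primitive
          (fun a b => (f.continuous.Icc_extend' (h := zero_le_one)).intervalIntegrable a b)
          0).comp continuous_subtype_val⟩
      map_add' := fun f g => by
        ext s
        exact intervalIntegral.integral_add
          ((f.continuous.Icc_extend' (h := zero_le_one)).intervalIntegrable _ _)
          ((g.continuous.Icc_extend' (h := zero_le_one)).intervalIntegrable _ _)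
      map_smul' := fun c f => by
        ext s
        exact intervalIntegral.integral_smul c _ }
    1 fun f => by
      refine (ContinuousMap.norm_le _ (by positivity)).2 fun s => ?_
      have hbound := intervalIntegral.norm_integral_le_of_norm_le_const (a := 0) (b := (s : ℝ))
        (f := IccExtend zero_le_one f) (C := ‖f‖) fun x _ => f.norm_coe_le_norm _
      rw [sub_zero, abs_of_nonneg s.2.1] at hbound
      exact hbound.trans (by rw [mul_comm]; gcongr; exact s.2.2)

lemma primitive_apply (f : C(unitInterval, E)) (s : unitInterval) :
    primitive f s = ∫ r in (0 : ℝ)..s, IccExtend zero_le_one f r := rfl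

lemma smul_primitive_comp_mulLeft (f : C(unitInterval, E)) (s t : unitInterval) :
    (s : ℝ) • primitive (f.comp (.mulLeft s)) t = primitive f (s * t) := by
  have hsubst := intervalIntegral.smul_integral_comp_mul_left (a := 0) (b := (t : ℝ))
    (IccExtend zero_le_one f) (s : ℝ)
  rw [mul_zero] at hsubst
  rw [primitive_apply, primitive_apply, Icc.coe_mul, ← hsubst]
  congr 1
  refine intervalIntegral.integral_congr fun r hr => ?_
  rw [uIcc_of_le t.2.1] at hr
  have hr' : r ∈ unitInterval := ⟨hr.1, hr.2.trans t.2.2⟩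
  have hsr : (s : ℝ) * r ∈ unitInterval := (s * ⟨r, hr'⟩ : unitInterval).2
  simp only [IccExtend_of_mem _ _ hr', IccExtend_of_mem _ _ hsr]
  rfl

lemma hasDerivAt_primitive [CompleteSpace E] (f : C(unitInterval, E)) (s : unitInterval) :
    HasDerivAt (fun s : ℝ => ∫ r in (0 : ℝ)..s, IccExtend zero_le_one f r) (f s) s := by
  have hf : Continuous (IccExtend zero_le_one f : ℝ → E) := f.continuous.Icc_extend'
  simpa using (hf.integral_hasStrictDerivAt 0 (s : ℝ)).hasDerivAt

lemma exists_analyticAt_integral_solution [CompleteSpace E]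
    {Ω : C(unitInterval, E) → C(unitInterval, E)} {x : E}
    (hΩ : AnalyticAt ℂ Ω (.const unitInterval x)) :
    ∃ ψ : ℂ × E → C(unitInterval, E), AnalyticAt ℂ ψ (0, x) ∧ ψ (0, x) = .const unitInterval x ∧
      ∀ᶠ q in 𝓝 (((0 : ℂ), x), ContinuousMap.const unitInterval x),
        q.2 = .const unitInterval q.1.2 + q.1.1 • primitive (Ω q.2) ↔ ψ q.1 = q.2 := by
  let cst : E →L[ℂ] C(unitInterval, E) := ContinuousLinearMap.const ℂ unitInterval
  let F : (ℂ × E) × C(unitInterval, E) → C(unitInterval, E) := fun q =>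
    q.2 - (cst q.1.2 + q.1.1 • primitive (Ω q.2))
  let u : (ℂ × E) × C(unitInterval, E) := ((0, x), .const unitInterval x)
  have hF : ContDiffAt ℂ ω F u := by
    have hΩu : ContDiffAt ℂ ω (fun q : (ℂ × E) × C(unitInterval, E) => primitive (Ω q.2)) u :=
      primitive.contDiff.contDiffAt.comp u (hΩ.contDiffAt.comp u contDiffAt_snd)
    exact contDiffAt_snd.sub ((cst.contDiff.contDiffAt.comp u (by fun_prop)).add
      (ContDiffAt.smul (contDiffAt_fst.comp u contDiffAt_fst) hΩu))
  have hFu : F u = 0 := by ext; simp [F, u, cst]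
  have hinr : fderiv ℂ F u ∘L .inr ℂ (ℂ × E) C(unitInterval, E) = .id ℂ _ := by
    have hpartial : HasFDerivAt (fun η => F ((0, x), η))
        (fderiv ℂ F u ∘L .inr ℂ (ℂ × E) C(unitInterval, E)) (.const unitInterval x) :=
      (hF.differentiableAt (by simp)).hasFDerivAt.comp _ (hasFDerivAt_prodMk_right (0, x) _)
    have hF_slice : (fun η => F ((0, x), η)) = fun η => η - cst x := by simp [F]
    rw [hF_slice] at hpartial
    exact hpartial.unique ((hasFDerivAt_id _).sub_const _)
  have hinv : (fderiv ℂ F u ∘L .inr ℂ (ℂ × E) C(unitInterval, E)).IsInvertible := by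
    rw [hinr]; exact ⟨.refl ℂ _, rfl⟩
  refine ⟨hF.implicitFunction (by simp) hinv,
    (hF.contDiffAt_implicitFunction (by simp) hinv).analyticAt,
    hF.implicitFunction_apply_self (by simp) hinv, ?_⟩
  filter_upwards [hF.eventually_apply_eq_iff_implicitFunction (by simp) hinv] with q hq
  rw [← hq, hFu]
  exact sub_eq_zero.symm

omit [NormedSpace ℂ E] in
lemma eventually_forall_comp_mulLeft {x : E} {ψ : ℂ × E → C(unitInterval, E)}
    (hψ : ContinuousAt ψ (0, x)) (hψ₀ : ψ (0, x) = .const unitInterval x)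
    {P : (ℂ × E) × C(unitInterval, E) → Prop}
    (hP : ∀ᶠ q in 𝓝 (((0 : ℂ), x), ContinuousMap.const unitInterval x), P q) :
    ∀ᶠ p in 𝓝 ((0 : ℂ), x), ∀ s : unitInterval,
      P (((s : ℝ) • p.1, p.2), (ψ p).comp (.mulLeft s)) := by
  have hcont (s : unitInterval) : ContinuousAt (fun q : (ℂ × E) × unitInterval =>
      (((q.2 : ℝ) • q.1.1, q.1.2), (ψ q.1).comp (.mulLeft q.2))) ((0, x), s) := by
    have hmul : Continuous fun s : unitInterval => ContinuousMap.mulLeft s :=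
      ContinuousMap.continuous_of_continuous_uncurry _ continuous_mul
    exact ContinuousAt.prodMk (by fun_prop) (Filter.Tendsto.compCM
      (hψ.tendsto.comp continuousAt_fst) (hmul.continuousAt.comp continuousAt_snd))
  have h := isCompact_univ.eventually_forall_of_forall_eventually (x₀ := ((0 : ℂ), x))
    (P := fun p (s : unitInterval) => P (((s : ℝ) • p.1, p.2), (ψ p).comp (.mulLeft s)))
    fun s _ => (hcont s).eventually (by simpa [hψ₀, ContinuousMap.const_comp] using hP)
  simpa using h

lemma eventually_integral_solution_comp_mulLeft {Ω : C(unitInterval, E) → C(unitInterval, E)}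
    {v : E → E} {x : E}
    (hΩv : ∀ᶠ γ in 𝓝 (ContinuousMap.const unitInterval x), ∀ k, Ω γ k = v (γ k))
    {ψ : ℂ × E → C(unitInterval, E)}
    (hψ : ContinuousAt ψ (0, x)) (hψ₀ : ψ (0, x) = .const unitInterval x)
    (hsol : ∀ᶠ q in 𝓝 (((0 : ℂ), x), ContinuousMap.const unitInterval x),
        q.2 = .const unitInterval q.1.2 + q.1.1 • primitive (Ω q.2) ↔ ψ q.1 = q.2) :
    ∀ᶠ p in 𝓝 ((0 : ℂ), x), ψ p = .const unitInterval p.2 + p.1 • primitive (Ω (ψ p)) ∧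
      ∀ s : unitInterval, Ω (ψ p) s = v (ψ p s) ∧
        ψ ((s : ℝ) • p.1, p.2) = (ψ p).comp (.mulLeft s) := by
  filter_upwards [eventually_forall_comp_mulLeft hψ hψ₀
    (hsol.and (continuousAt_snd.eventually hΩv))] with p hp
  have hone : (ψ p).comp (.mulLeft 1) = ψ p := by ext; simp
  obtain ⟨hfix, hv⟩ := hp 1
  rw [Icc.coe_one, one_smul, hone, Prod.mk.eta, eq_self_iff_true, iff_true] at hfix
  rw [hone] at hv
  refine ⟨hfix, fun s => ⟨hv s, ?_⟩⟩
  obtain ⟨hfix_s, hv_s⟩ := hp s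
  have hΩs : Ω ((ψ p).comp (.mulLeft s)) = (Ω (ψ p)).comp (.mulLeft s) := by
    ext t
    rw [hv_s, ContinuousMap.comp_apply, ContinuousMap.comp_apply, hv]
  refine hfix_s.1 ?_
  ext t
  simp only [hΩs, ContinuousMap.comp_apply, ContinuousMap.add_apply, ContinuousMap.smul_apply,
    ContinuousMap.const_apply]
  rw [smul_assoc, smul_comm, smul_primitive_comp_mulLeft]
  exact DFunLike.congr_fun hfix (s * t)

lemma smul_fderiv_eq_of_eq_primitive [CompleteSpace E] {φ : ℂ × E → E} {f : C(unitInterval, E)}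
    {t : ℂ} {y : E} (hφ : ∀ s : unitInterval, φ ((s : ℝ) • t, y) = y + t • primitive f s)
    (s : unitInterval) (hd : DifferentiableAt ℂ φ ((s : ℝ) • t, y)) :
    t • fderiv ℂ φ ((s : ℝ) • t, y) (1, 0) = t • f s := by
  have hcurve : HasDerivAt (fun r : ℝ => (r • t, y)) (t, 0) (s : ℝ) := by
    simpa using ((hasDerivAt_id (s : ℝ)).smul_const t).prodMk (hasDerivAt_const _ y)
  have hleft := (hd.hasFDerivAt.restrictScalars ℝ).comp_hasDerivAt (s : ℝ) hcurve
  have hright := (((hasDerivAt_primitive f s).const_smul t).const_add y).hasDerivWithinAt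
    (s := unitInterval)
  have heq := (uniqueDiffOn_Icc_zero_one (s : ℝ) s.2).eq_deriv _ hleft.hasDerivWithinAt
    (hright.congr (fun r hr => hφ ⟨r, hr⟩) (hφ s))
  rw [← heq, ContinuousLinearMap.coe_restrictScalars', ← map_smul, Prod.smul_mk, smul_zero,
    smul_eq_mul, mul_one]

lemma exists_analyticAt_flow [CompleteSpace E] {v : E → E} {x : E} (hv : AnalyticAt ℂ v x) :
    ∃ φ : ℂ × E → E, AnalyticAt ℂ φ (0, x) ∧ (∀ᶠ y in 𝓝 x, φ (0, y) = y) ∧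
      ∀ᶠ p in 𝓝 (0, x), fderiv ℂ φ p (1, 0) = v (φ p) := by
  obtain ⟨Ω, hΩ, hΩv⟩ := exists_analyticAt_postcomp (K := unitInterval) hv
  obtain ⟨ψ, hψ, hψ₀, hsol⟩ := exists_analyticAt_integral_solution hΩ
  have hscale := eventually_integral_solution_comp_mulLeft hΩv hψ.continuousAt hψ₀ hsol
  have hφ : AnalyticAt ℂ (fun p => ψ p 1) (0, x) :=
    ((ContinuousMap.evalCLM (M := E) ℂ (1 : unitInterval)).analyticAt (ψ (0, x))).comp hψ
  refine ⟨fun p => ψ p 1, hφ, ?_, ?_⟩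
  · filter_upwards [(Continuous.prodMk_right (0 : ℂ)).continuousAt.eventually hscale] with y hy
    rw [hy.1]
    simp
  · have hode : ∀ᶠ p in 𝓝 ((0 : ℂ), x), ∀ s : unitInterval,
        p.1 • fderiv ℂ (fun p => ψ p 1) ((s : ℝ) • p.1, p.2) (1, 0) =
          p.1 • v (ψ ((s : ℝ) • p.1, p.2) 1) := by
      filter_upwards [hscale, eventually_forall_comp_mulLeft hψ.continuousAt
        hψ₀ (continuousAt_fst.eventually hφ.eventually_analyticAt)]
        with p ⟨hfix, hp⟩ hd s
      have hval (r : unitInterval) : ψ ((r : ℝ) • p.1, p.2) 1 = ψ p r := by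
        simp only [(hp r).2, ContinuousMap.comp_apply, ContinuousMap.coe_mulLeft, mul_one]
      rw [hval, ← (hp s).1]
      refine smul_fderiv_eq_of_eq_primitive (fun r => ?_) s (hd s).differentiableAt
      rw [hval]
      exact DFunLike.congr_fun hfix r
    rw [nhds_prod_eq] at hode ⊢
    obtain ⟨T, hT, W, hW, h⟩ := eventually_prod_iff.1 hode
    obtain ⟨t₀, ht₀, ht₀_ne⟩ :=
      ((hT.filter_mono nhdsWithin_le_nhds).and (self_mem_nhdsWithin (s := {0}ᶜ))).exists
    filter_upwards [hT.prod_mk hW] with p hp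
    obtain ⟨t, y⟩ := p
    -- At time `0` the equation is read off at the start of a solution with nonzero time span.
    by_cases ht : t = 0
    · simpa [ht] using smul_right_injective E ht₀_ne (h ht₀ hp.2 0)
    · simpa using smul_right_injective E ht (h hp.1 hp.2 1)

end Flow

section Calculus

variable {𝕜 V W F : Type*} [RCLike 𝕜] [NormedAddCommGroup V] [NormedSpace 𝕜 V]
  [NormedAddCommGroup W] [NormedSpace 𝕜 W] [NormedAddCommGroup F] [NormedSpace 𝕜 F]

lemma fderiv_pullback_sub {Φ : V → W} {α : W → W →L[𝕜] F} {x : V}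
    (hΦ : ContDiffAt 𝕜 2 Φ x) (hα : DifferentiableAt 𝕜 α (Φ x)) (u v : V) :
    fderiv 𝕜 (fun x => (α (Φ x)).comp (fderiv 𝕜 Φ x)) x u v
      - fderiv 𝕜 (fun x => (α (Φ x)).comp (fderiv 𝕜 Φ x)) x v u
      = fderiv 𝕜 α (Φ x) (fderiv 𝕜 Φ x u) (fderiv 𝕜 Φ x v)
        - fderiv 𝕜 α (Φ x) (fderiv 𝕜 Φ x v) (fderiv 𝕜 Φ x u) := by
  have hd : DifferentiableAt 𝕜 Φ x := hΦ.differentiableAt (by simp)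
  have hd2 : DifferentiableAt 𝕜 (fderiv 𝕜 Φ) x :=
    (hΦ.fderiv_right (m := 1) (by norm_num)).differentiableAt (by simp)
  have hsymm : fderiv 𝕜 (fderiv 𝕜 Φ) x u v = fderiv 𝕜 (fderiv 𝕜 Φ) x v u :=
    (hΦ.isSymmSndFDerivAt (by simp)) u v
  have hprod := ((hα.hasFDerivAt.comp x hd.hasFDerivAt).clm_comp hd2.hasFDerivAt).fderiv
  simp only [Function.comp_def] at hprod
  rw [hprod]
  simp [hsymm]

lemma exists_openPartialHomeomorph_of_bijective_fderiv [CompleteSpace V] [CompleteSpace W]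
    {n : WithTop ℕ∞} (hn : n ≠ 0) {f : V → W} {a : V}
    (hf : ContDiffAt 𝕜 n f a) (hb : Function.Bijective (fderiv 𝕜 f a)) :
    ∃ g : OpenPartialHomeomorph V W, (g : V → W) = f ∧ a ∈ g.source ∧
      ContDiffAt 𝕜 n g.symm (f a) := by
  let f' : V ≃L[𝕜] W := ContinuousLinearEquiv.ofBijective (fderiv 𝕜 f a)
    (LinearMap.ker_eq_bot.2 hb.1) (LinearMap.range_eq_top.2 hb.2)
  have hf' : HasFDerivAt f (f' : V →L[𝕜] W) a := (hf.differentiableAt hn).hasFDerivAt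
  exact ⟨hf.toOpenPartialHomeomorph f hf' hn, rfl,
    hf.mem_toOpenPartialHomeomorph_source hf' hn, hf.to_localInverse hf' hn⟩

lemma exists_analyticAt_rightInverse [CompleteSpace V] [CompleteSpace W] {f : V → W} {a : V}
    (hf : AnalyticAt 𝕜 f a) (hb : Function.Bijective (fderiv 𝕜 f a)) :
    ∃ g : W → V, AnalyticAt 𝕜 g (f a) ∧ g (f a) = a ∧ (∀ᶠ y in 𝓝 (f a), f (g y) = y) ∧
      (∀ᶠ y in 𝓝 (f a), (fderiv 𝕜 f (g y)).comp (fderiv 𝕜 g y) = .id 𝕜 W) ∧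
      Function.Bijective (fderiv 𝕜 g (f a)) := by
  obtain ⟨e, rfl, ha, hsymm⟩ :=
    exists_openPartialHomeomorph_of_bijective_fderiv (n := ω) (by simp) hf.contDiffAt hb
  have hg : AnalyticAt 𝕜 e.symm (e a) := hsymm.analyticAt
  have hga : e.symm (e a) = a := e.left_inv ha
  have hinv := e.eventually_right_inverse' ha
  have hcomp : ∀ᶠ y in 𝓝 (e a), (fderiv 𝕜 e (e.symm y)).comp (fderiv 𝕜 e.symm y) = .id 𝕜 W := by
    have hf' : ∀ᶠ y in 𝓝 (e a), AnalyticAt 𝕜 e (e.symm y) :=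
      hg.continuousAt.eventually (by rw [hga]; exact hf.eventually_analyticAt)
    filter_upwards [hinv.eventually_nhds, hg.eventually_analyticAt, hf'] with y hy hgy hfy
    have hid : e ∘ e.symm =ᶠ[𝓝 y] id := hy
    rw [← fderiv_comp y hfy.differentiableAt hgy.differentiableAt, hid.fderiv_eq, fderiv_id]
  refine ⟨e.symm, hg, hga, hinv, hcomp, ?_⟩
  have hid (w : W) : fderiv 𝕜 e a (fderiv 𝕜 e.symm (e a) w) = w := by
    have := DFunLike.congr_fun hcomp.self_of_nhds w
    rwa [ContinuousLinearMap.comp_apply, hga] at this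
  exact ⟨(Function.LeftInverse.injective hid), fun v => ⟨fderiv 𝕜 e a v, hb.1 (hid _)⟩⟩

end Calculus

section Contact

variable {V W : Type*} [NormedAddCommGroup V] [NormedSpace ℂ V] [NormedAddCommGroup W]
  [NormedSpace ℂ W]

/-- The value `(α ∧ dα)(u, v, w)` at `q` of a holomorphic one-form `α`. -/
noncomputable def contactVolume (α : V → V →L[ℂ] ℂ) (q u v w : V) : ℂ :=
  α q u * extD α q v w + α q v * extD α q w u + α q w * extD α q u v

lemma contactVolume_rotate (α : V → V →L[ℂ] ℂ) (q u v w : V) :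
    contactVolume α q u v w = contactVolume α q v w u := by
  simp only [contactVolume]
  ring

lemma contactVolume_combination (α : V → V →L[ℂ] ℂ) (q u v w : V) (a b c : ℂ) :
    contactVolume α q (a • u + b • v + c • w) v w = a * contactVolume α q u v w := by
  simp only [contactVolume, extD, map_add, map_smul, _root_.add_apply, _root_.smul_apply,
    smul_eq_mul]
  ring

lemma linearIndependent_of_contactVolume_ne_zero {α : V → V →L[ℂ] ℂ} {q u v w : V}
    (h : contactVolume α q u v w ≠ 0) : LinearIndependent ℂ ![u, v, w] := by
  have coeff_eq_zero {a b c : ℂ} {u v w : V} (hz : a • u + b • v + c • w = 0)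
      (h : contactVolume α q u v w ≠ 0) : a = 0 := by
    refine (mul_eq_zero.1 ?_).resolve_right h
    rw [← contactVolume_combination α q u v w a b c, hz]
    simp [contactVolume, extD]
  rw [Fintype.linearIndependent_iff]
  intro g hg
  simp only [Fin.sum_univ_three, Matrix.cons_val] at hg
  have h₁ : contactVolume α q v w u ≠ 0 := by rwa [← contactVolume_rotate]
  have h₂ : contactVolume α q w u v ≠ 0 := by rwa [← contactVolume_rotate]
  have hg₁ : g 1 • v + g 2 • w + g 0 • u = 0 := by rw [← hg]; abel
  have hg₂ : g 2 • w + g 0 • u + g 1 • v = 0 := by rw [← hg]; abel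
  exact Fin.forall_fin_succ.2 ⟨coeff_eq_zero hg h, Fin.forall_fin_two.2
    ⟨coeff_eq_zero hg₁ h₁, coeff_eq_zero hg₂ h₂⟩⟩

lemma exists_mem_ker_of_contactVolume_ne_zero {α : V → V →L[ℂ] ℂ} {q u v w : V}
    (h : contactVolume α q u v w ≠ 0) :
    ∃ u v w, α q u = 0 ∧ α q w ≠ 0 ∧ contactVolume α q u v w ≠ 0 := by
  have of_ne_zero {u v w : V} (hw : α q w ≠ 0) (h : contactVolume α q u v w ≠ 0) :
      ∃ u v w, α q u = 0 ∧ α q w ≠ 0 ∧ contactVolume α q u v w ≠ 0 := by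
    refine ⟨u - (α q u / α q w) • w, v, w, by simp [hw], hw, ?_⟩
    simpa [sub_eq_add_neg] using
      (contactVolume_combination α q u v w 1 0 (-(α q u / α q w))).trans_ne (by simpa using h)
  by_cases hw : α q w = 0
  · by_cases hv : α q v = 0
    · have hu : α q u ≠ 0 := fun hu => h (by simp [contactVolume, hu, hv, hw])
      exact of_ne_zero hu (contactVolume_rotate α q u v w ▸ h)
    · exact of_ne_zero hv ((contactVolume_rotate α q w u v).trans_ne h)
  · exact of_ne_zero hw h

lemma contactVolume_pullback {α : W → W →L[ℂ] ℂ} {Ψ : V → W} {p : V}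
    (hΨ : ContDiffAt ℂ 2 Ψ p) (hα : DifferentiableAt ℂ α (Ψ p)) (u v w : V) :
    contactVolume (fun x => (α (Ψ x)).comp (fderiv ℂ Ψ x)) p u v w
      = contactVolume α (Ψ p) (fderiv ℂ Ψ p u) (fderiv ℂ Ψ p v) (fderiv ℂ Ψ p w) := by
  simp only [contactVolume, extD, fderiv_pullback_sub hΨ hα]
  rfl

lemma analyticAt_pullback [CompleteSpace V] [CompleteSpace W] {α : W → W →L[ℂ] ℂ} {Ψ : V → W}
    {p : V} (hΨ : AnalyticAt ℂ Ψ p) (hα : AnalyticAt ℂ α (Ψ p)) :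
    AnalyticAt ℂ (fun x => (α (Ψ x)).comp (fderiv ℂ Ψ x)) p :=
  ((hα.comp hΨ).contDiffAt.clm_comp hΨ.fderiv.contDiffAt).analyticAt

lemma exists_flowBox [CompleteSpace W] {X : W → W} {q : W} (hX : AnalyticAt ℂ X q)
    (L : V →L[ℂ] W) :
    ∃ Ψ : ℂ × V → W, AnalyticAt ℂ Ψ 0 ∧ Ψ 0 = q ∧
      fderiv ℂ Ψ 0 = (ContinuousLinearMap.toSpanSingleton ℂ (X q)).coprod L ∧
      ∀ᶠ p in 𝓝 0, fderiv ℂ Ψ p (1, 0) = X (Ψ p) := by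
  obtain ⟨φ, hφ, hφ₀, hode⟩ := exists_analyticAt_flow hX
  let A : ℂ × V →L[ℂ] ℂ × W := (ContinuousLinearMap.id ℂ ℂ).prodMap L
  let j : ℂ × V → ℂ × W := fun p => (0, q) + A p
  have hj (p) : HasFDerivAt j A p := A.hasFDerivAt.const_add _
  have hj₀ : j 0 = (0, q) := by simp [j]
  have hja : AnalyticAt ℂ j 0 := analyticAt_const.add (A.analyticAt 0)
  have hjt : Tendsto j (𝓝 0) (𝓝 (0, q)) := hj₀ ▸ hja.continuousAt
  have hder : ∀ᶠ p in 𝓝 0, fderiv ℂ (φ ∘ j) p = (fderiv ℂ φ (j p)).comp A := by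
    filter_upwards [hjt.eventually hφ.eventually_analyticAt] with p hp
    rw [fderiv_comp p hp.differentiableAt (hj p).differentiableAt, (hj p).fderiv]
  have hflow : ∀ᶠ p in 𝓝 0, fderiv ℂ (φ ∘ j) p (1, 0) = X (φ (j p)) := by
    filter_upwards [hder, hjt.eventually hode] with p hp hX
    rw [hp, ← hX]
    simp [A]
  have hΨ₀ : φ (j 0) = q := by rw [hj₀]; exact hφ₀.self_of_nhds
  refine ⟨φ ∘ j, (hj₀ ▸ hφ : AnalyticAt ℂ φ (j 0)).comp hja, hΨ₀, ?_, hflow⟩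
  have hinr : HasFDerivAt (fun y => φ (0, y)) (.id ℂ W) q :=
    (hasFDerivAt_id q).congr_of_eventuallyEq hφ₀
  have hslice : (fderiv ℂ φ (0, q)).comp (.inr ℂ ℂ W) = .id ℂ W :=
    (hφ.differentiableAt.hasFDerivAt.comp q (hasFDerivAt_prodMk_right 0 q)).unique hinr
  refine ContinuousLinearMap.prod_ext ?_ ?_
  · ext
    simpa [hΨ₀] using hflow.self_of_nhds
  · ext x
    simpa [hder.self_of_nhds, hj₀, A] using DFunLike.congr_fun hslice (L x)

end Contact

section Darboux

/-- For a one-form `γ` on `ℂ³` with coordinates `(t, x, w)`, where `γ(∂_t) = 0`: the function `v`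
such that `γ` is a multiple of `dw - v dx`. It is meaningful where `γ(∂_w) ≠ 0`. -/
noncomputable def slope (γ : ℂ × ℂ × ℂ → ℂ × ℂ × ℂ →L[ℂ] ℂ) (p : ℂ × ℂ × ℂ) : ℂ :=
  -γ p (0, 1, 0) / γ p (0, 0, 1)

/-- The coordinates `(x, v, w)` in which `γ` is a multiple of `dw - v dx`, with `v` the slope of
`γ`, normalized to vanish at the origin. -/
noncomputable def darbouxMap (γ : ℂ × ℂ × ℂ → ℂ × ℂ × ℂ →L[ℂ] ℂ) (p : ℂ × ℂ × ℂ) :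
    ℂ × ℂ × ℂ :=
  (p.2.1, slope γ p - slope γ 0, p.2.2 - slope γ 0 * p.2.1)

variable {γ : ℂ × ℂ × ℂ → ℂ × ℂ × ℂ →L[ℂ] ℂ}

lemma analyticAt_clm_apply_const {V F : Type*} [NormedAddCommGroup V] [NormedSpace ℂ V]
    [CompleteSpace V] [NormedAddCommGroup F] [NormedSpace ℂ F] [CompleteSpace F]
    {α : V → V →L[ℂ] F} {p : V} (hα : AnalyticAt ℂ α p) (ζ : V) :
    AnalyticAt ℂ (fun p => α p ζ) p :=
  (hα.contDiffAt.clm_apply (n := ω) contDiffAt_const).analyticAt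

lemma analyticAt_slope (hγ : AnalyticAt ℂ γ 0) (hw : γ 0 (0, 0, 1) ≠ 0) :
    AnalyticAt ℂ (slope γ) 0 :=
  (analyticAt_clm_apply_const hγ _).neg.div (analyticAt_clm_apply_const hγ _) hw

lemma apply_eq_slope_mul {p : ℂ × ℂ × ℂ} (hw : γ p (0, 0, 1) ≠ 0) :
    γ p (0, 1, 0) = -(slope γ p * γ p (0, 0, 1)) := by
  rw [slope, div_mul_cancel₀ _ hw, neg_neg]

lemma contactVolume_eq_fderiv_slope (hγ : AnalyticAt ℂ γ 0) (hw : γ 0 (0, 0, 1) ≠ 0)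
    (ht : ∀ᶠ p in 𝓝 0, γ p (1, 0, 0) = 0) :
    contactVolume γ 0 (1, 0, 0) (0, 1, 0) (0, 0, 1) =
      -(γ 0 (0, 0, 1) ^ 2 * fderiv ℂ (slope γ) 0 (1, 0, 0)) := by
  have hcoeff (ζ ξ) : fderiv ℂ γ 0 ζ ξ = fderiv ℂ (fun p => γ p ξ) 0 ζ := by
    rw [fderiv_clm_apply hγ.differentiableAt (differentiableAt_const _)]
    simp
  have hvert (ζ) : fderiv ℂ γ 0 ζ (1, 0, 0) = 0 := by
    have hzero : (fun p => γ p (1, 0, 0)) =ᶠ[𝓝 0] fun _ => 0 := ht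
    rw [hcoeff, hzero.fderiv_eq]
    simp
  have hx : fderiv ℂ γ 0 (1, 0, 0) (0, 1, 0) =
      -(fderiv ℂ (slope γ) 0 (1, 0, 0) * γ 0 (0, 0, 1)
        + slope γ 0 * fderiv ℂ γ 0 (1, 0, 0) (0, 0, 1)) := by
    have hev : (fun p => γ p (0, 1, 0)) =ᶠ[𝓝 0] fun p => -(slope γ p * γ p (0, 0, 1)) := by
      filter_upwards [(analyticAt_clm_apply_const hγ _).continuousAt.eventually_ne hw] with p hp
      exact apply_eq_slope_mul hp
    rw [hcoeff, hcoeff, hev.fderiv_eq, fderiv_fun_neg,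
      fderiv_fun_mul (analyticAt_slope hγ hw).differentiableAt
        (analyticAt_clm_apply_const hγ _).differentiableAt]
    simp only [_root_.neg_apply, _root_.add_apply, _root_.smul_apply, smul_eq_mul]
    ring
  simp only [contactVolume, extD, hvert, hx, ht.self_of_nhds, apply_eq_slope_mul hw]
  ring

lemma fderiv_darbouxMap {p : ℂ × ℂ × ℂ} (hp : DifferentiableAt ℂ (slope γ) p) (ζ : ℂ × ℂ × ℂ) :
    fderiv ℂ (darbouxMap γ) p ζ = (ζ.2.1, fderiv ℂ (slope γ) p ζ, ζ.2.2 - slope γ 0 * ζ.2.1) := by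
  have hx : HasFDerivAt (fun p : ℂ × ℂ × ℂ => p.2.1)
      ((ContinuousLinearMap.fst ℂ ℂ ℂ).comp (.snd ℂ ℂ (ℂ × ℂ))) p :=
    ((ContinuousLinearMap.fst ℂ ℂ ℂ).comp (.snd ℂ ℂ (ℂ × ℂ))).hasFDerivAt
  have hw : HasFDerivAt (fun p : ℂ × ℂ × ℂ => p.2.2)
      ((ContinuousLinearMap.snd ℂ ℂ ℂ).comp (.snd ℂ ℂ (ℂ × ℂ))) p :=
    ((ContinuousLinearMap.snd ℂ ℂ ℂ).comp (.snd ℂ ℂ (ℂ × ℂ))).hasFDerivAt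
  have hmap : HasFDerivAt (darbouxMap γ) _ p :=
    hx.prodMk ((hp.hasFDerivAt.sub_const (slope γ 0)).prodMk (hw.sub (hx.const_mul (slope γ 0))))
  rw [hmap.fderiv]
  simp

lemma analyticAt_darbouxMap {p : ℂ × ℂ × ℂ} (hγ : AnalyticAt ℂ (slope γ) p) :
    AnalyticAt ℂ (darbouxMap γ) p := by
  have hx : AnalyticAt ℂ (fun p : ℂ × ℂ × ℂ => p.2.1) p := analyticAt_fst.comp analyticAt_snd
  have hw : AnalyticAt ℂ (fun p : ℂ × ℂ × ℂ => p.2.2) p := analyticAt_snd.comp analyticAt_snd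
  exact hx.prod ((hγ.sub analyticAt_const).prod (hw.sub (analyticAt_const.mul hx)))

lemma bijective_fderiv_darbouxMap (hγ : DifferentiableAt ℂ (slope γ) 0)
    (hslope : fderiv ℂ (slope γ) 0 (1, 0, 0) ≠ 0) :
    Function.Bijective (fderiv ℂ (darbouxMap γ) 0) := by
  have hinj : Function.Injective (fderiv ℂ (darbouxMap γ) 0).toLinearMap := by
    refine (injective_iff_map_eq_zero _).2 ?_
    rintro ⟨t, x, w⟩ hζ
    rw [ContinuousLinearMap.coe_coe, fderiv_darbouxMap hγ] at hζ
    obtain ⟨rfl, hv, hw⟩ :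
        x = 0 ∧ fderiv ℂ (slope γ) 0 (t, x, w) = 0 ∧ w - slope γ 0 * x = 0 := by simpa using hζ
    obtain rfl : w = 0 := by simpa using hw
    have ht : t • fderiv ℂ (slope γ) 0 (1, 0, 0) = 0 := by
      rw [← map_smul]
      simpa using hv
    simp [(smul_eq_zero.1 ht).resolve_right hslope]
  exact ⟨hinj, LinearMap.surjective_of_injective hinj⟩

lemma apply_eq_zero_iff_darbouxMap {p : ℂ × ℂ × ℂ} (ht : γ p (1, 0, 0) = 0)
    (hw : γ p (0, 0, 1) ≠ 0) (hp : DifferentiableAt ℂ (slope γ) p) (ζ : ℂ × ℂ × ℂ) :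
    γ p ζ = 0 ↔ (fderiv ℂ (darbouxMap γ) p ζ).2.2
      - (darbouxMap γ p).2.1 * (fderiv ℂ (darbouxMap γ) p ζ).1 = 0 := by
  have hζ : ζ = ζ.1 • (1, 0, 0) + ζ.2.1 • (0, 1, 0) + ζ.2.2 • (0, 0, 1) := by ext <;> simp
  have hγ : γ p ζ = (ζ.2.2 - slope γ p * ζ.2.1) * γ p (0, 0, 1) := by
    conv_lhs => rw [hζ]
    simp only [map_add, map_smul, ht, smul_eq_mul, apply_eq_slope_mul hw]
    ring
  rw [hγ, mul_eq_zero, or_iff_left hw, fderiv_darbouxMap hp, darbouxMap]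
  ring_nf

variable {V : Type*} [NormedAddCommGroup V] [NormedSpace ℂ V]

/-- Straightening a field `X` in the kernel of `α` to `∂_t` leaves only the coefficients of `dx`
and `dw`. -/
lemma exists_analyticAt_straighten [CompleteSpace V] {α : V → V →L[ℂ] ℂ} {q u v w : V}
    (hα : AnalyticAt ℂ α q) (hu : α q u = 0) (hw : α q w ≠ 0) :
    ∃ Ψ : ℂ × ℂ × ℂ → V, AnalyticAt ℂ Ψ 0 ∧ Ψ 0 = q ∧
      (∀ ζ, fderiv ℂ Ψ 0 ζ = ζ.1 • u + ζ.2.1 • v + ζ.2.2 • w) ∧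
      ∀ᶠ p in 𝓝 0, α (Ψ p) (fderiv ℂ Ψ p (1, 0, 0)) = 0 := by
  let X : V → V := fun p => u - (α p u / α p w) • w
  have hX : AnalyticAt ℂ X q := analyticAt_const.sub
    (((analyticAt_clm_apply_const hα u).div (analyticAt_clm_apply_const hα w) hw).smul
      analyticAt_const)
  have hXq : X q = u := by simp [X, hu]
  have hker : ∀ᶠ p in 𝓝 q, α p (X p) = 0 := by
    filter_upwards [(analyticAt_clm_apply_const hα w).continuousAt.eventually_ne hw] with p hp
    simp [X, hp]
  obtain ⟨Ψ, hΨ, rfl, hΨ', hflow⟩ := exists_flowBox hX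
    ((ContinuousLinearMap.toSpanSingleton ℂ v).coprod (.toSpanSingleton ℂ w))
  refine ⟨Ψ, hΨ, rfl, fun ζ => by simp [hΨ', hXq, add_assoc], ?_⟩
  filter_upwards [hΨ.continuousAt.eventually hker, hflow] with p hp hXp
  exact hXp ▸ hp

lemma exists_darboux_of_apply_eq_zero (hγ : AnalyticAt ℂ γ 0) (hw : γ 0 (0, 0, 1) ≠ 0)
    (ht : ∀ᶠ p in 𝓝 0, γ p (1, 0, 0) = 0)
    (hvol : contactVolume γ 0 (1, 0, 0) (0, 1, 0) (0, 0, 1) ≠ 0) :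
    ∃ K : ℂ × ℂ × ℂ → ℂ × ℂ × ℂ, AnalyticAt ℂ K 0 ∧ K 0 = 0 ∧
      Function.Bijective (fderiv ℂ K 0) ∧
      ∀ᶠ p in 𝓝 0, ∀ ζ, γ p ζ = 0 ↔ (fderiv ℂ K p ζ).2.2 - (K p).2.1 * (fderiv ℂ K p ζ).1 = 0 := by
  have hslope := analyticAt_slope hγ hw
  refine ⟨darbouxMap γ, analyticAt_darbouxMap hslope, by simp [darbouxMap],
    bijective_fderiv_darbouxMap hslope.differentiableAt fun h => hvol ?_, ?_⟩
  · simp [contactVolume_eq_fderiv_slope hγ hw ht, h]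
  · filter_upwards [ht, hslope.eventually_analyticAt,
      (analyticAt_clm_apply_const hγ (0, 0, 1)).continuousAt.eventually_ne hw] with p htp hp hwp
    exact apply_eq_zero_iff_darbouxMap htp hwp hp.differentiableAt

lemma bijective_of_linearIndependent (hV : Module.finrank ℂ V = 3) {u v w : V}
    (h : LinearIndependent ℂ ![u, v, w]) {f : ℂ × ℂ × ℂ →L[ℂ] V}
    (hf : ∀ ζ, f ζ = ζ.1 • u + ζ.2.1 • v + ζ.2.2 • w) : Function.Bijective f := by
  have := Module.finite_of_finrank_pos (hV ▸ three_pos)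
  have hinj : Function.Injective f.toLinearMap := by
    refine (injective_iff_map_eq_zero _).2 fun ζ hζ => ?_
    have hcoeff := Fintype.linearIndependent_iff.1 h ![ζ.1, ζ.2.1, ζ.2.2]
      (by simpa [Fin.sum_univ_three, hf] using hζ)
    exact Prod.ext (hcoeff 0) (Prod.ext (hcoeff 1) (hcoeff 2))
  exact ⟨hinj, (LinearMap.injective_iff_surjective_of_finrank_eq_finrank (by simp [hV])).1 hinj⟩

lemma exists_darboux [CompleteSpace V] (hV : Module.finrank ℂ V = 3) {α : V → V →L[ℂ] ℂ}
    {q : V} (hα : AnalyticAt ℂ α q) (hvol : ∃ u v w, contactVolume α q u v w ≠ 0) :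
    ∃ Θ : V → ℂ × ℂ × ℂ, AnalyticAt ℂ Θ q ∧ Θ q = 0 ∧ Function.Bijective (fderiv ℂ Θ q) ∧
      ∀ᶠ p in 𝓝 q, ∀ ζ, α p ζ = 0 ↔
        (fderiv ℂ Θ p ζ).2.2 - (Θ p).2.1 * (fderiv ℂ Θ p ζ).1 = 0 := by
  obtain ⟨_, _, _, hvol⟩ := hvol
  obtain ⟨u, v, w, hu, hw, hvol⟩ := exists_mem_ker_of_contactVolume_ne_zero hvol
  obtain ⟨Ψ, hΨ, rfl, hΨ', ht⟩ := exists_analyticAt_straighten (v := v) hα hu hw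
  have hγvol : contactVolume (fun p => (α (Ψ p)).comp (fderiv ℂ Ψ p)) 0
      (1, 0, 0) (0, 1, 0) (0, 0, 1) ≠ 0 := by
    rw [contactVolume_pullback hΨ.contDiffAt hα.differentiableAt]
    simpa [hΨ'] using hvol
  obtain ⟨K, hK, hK₀, hKb, hKα⟩ := exists_darboux_of_apply_eq_zero
    (analyticAt_pullback hΨ hα) (by simpa [hΨ'] using hw) ht hγvol
  obtain ⟨g, hg, hg₀, hΨg, hΨg', hgb⟩ := exists_analyticAt_rightInverse hΨ
    (bijective_of_linearIndependent hV (linearIndependent_of_contactVolume_ne_zero hvol) hΨ')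
  have hgt : Tendsto g (𝓝 (Ψ 0)) (𝓝 0) := by simpa only [hg₀] using hg.continuousAt.tendsto
  have hderiv : ∀ᶠ p in 𝓝 (Ψ 0),
      fderiv ℂ (K ∘ g) p = (fderiv ℂ K (g p)).comp (fderiv ℂ g p) := by
    filter_upwards [hgt.eventually hK.eventually_analyticAt, hg.eventually_analyticAt] with p hKp hp
    exact fderiv_comp p hKp.differentiableAt hp.differentiableAt
  refine ⟨K ∘ g, (hg₀.symm ▸ hK : AnalyticAt ℂ K (g (Ψ 0))).comp hg, by simp [hg₀, hK₀], ?_, ?_⟩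
  · rw [hderiv.self_of_nhds, hg₀]
    exact hKb.comp hgb
  · filter_upwards [hgt.eventually hKα, hΨg, hΨg', hderiv] with p hp hpΨ hpΨ' hpK ζ
    have hζ : fderiv ℂ Ψ (g p) (fderiv ℂ g p ζ) = ζ := DFunLike.congr_fun hpΨ' ζ
    rw [hpK, ContinuousLinearMap.comp_apply, Function.comp_apply, ← hp,
      ContinuousLinearMap.comp_apply, hζ, hpΨ]

end Darboux

section LocalDiffeo

variable {U V W : Type*} [NormedAddCommGroup U] [NormedSpace ℝ U] [NormedAddCommGroup V]
  [NormedSpace ℝ V] [NormedAddCommGroup W] [NormedSpace ℝ W]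

lemma SmoothNear.contDiffAt {f : V → W} {p : V} (h : SmoothNear f p) : ContDiffAt ℝ ∞ f p :=
  h.self_of_nhds

lemma SmoothNear.continuousAt {f : V → W} {p : V} (h : SmoothNear f p) : ContinuousAt f p :=
  h.contDiffAt.continuousAt

lemma SmoothNear.differentiableAt {f : V → W} {p : V} (h : SmoothNear f p) :
    DifferentiableAt ℝ f p :=
  h.contDiffAt.differentiableAt (by simp)

lemma SmoothNear.comp {g : V → W} {f : U → V} {p : U} (hg : SmoothNear g (f p))
    (hf : SmoothNear f p) : SmoothNear (g ∘ f) p := by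
  filter_upwards [hf, hf.continuousAt.eventually hg] with x hx hgx
  exact hgx.comp x hx

lemma SmoothNear.congr {f g : V → W} {p : V} (hf : SmoothNear f p) (h : g =ᶠ[𝓝 p] f) :
    SmoothNear g p := by
  filter_upwards [hf, h.eventually_nhds] with x hx hgx
  exact hx.congr_of_eventuallyEq hgx

lemma SmoothNear.eventually_smoothNear {f : V → W} {p : V} (h : SmoothNear f p) :
    ∀ᶠ x in 𝓝 p, SmoothNear f x :=
  h.eventually_nhds

lemma SmoothNear.fderiv {f : V → W} {p : V} (h : SmoothNear f p) :
    SmoothNear (fderiv ℝ f) p :=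
  h.mono fun _ hx => hx.fderiv_right (m := ∞) (by simp)

lemma SmoothNear.of_contDiff {f : V → W} (h : ContDiff ℝ ∞ f) (p : V) : SmoothNear f p :=
  .of_forall fun _ => h.contDiffAt

lemma SmoothNear.eventually_fderiv_comp {Ψ : V → W} {Φ : U → V} {p : U}
    (hΨ : SmoothNear Ψ (Φ p)) (hΦ : SmoothNear Φ p) :
    ∀ᶠ x in 𝓝 p, _root_.fderiv ℝ (Ψ ∘ Φ) x =
      (_root_.fderiv ℝ Ψ (Φ x)).comp (_root_.fderiv ℝ Φ x) := by
  filter_upwards [hΦ, hΦ.continuousAt.eventually hΨ] with x hx hΨx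
  exact fderiv_comp _ (hΨx.differentiableAt (by simp)) (hx.differentiableAt (by simp))

lemma IsLocalDiffeoNear.comp {Ψ : V → W} {Φ : U → V} {p : U} (hΨ : IsLocalDiffeoNear Ψ (Φ p))
    (hΦ : IsLocalDiffeoNear Φ p) : IsLocalDiffeoNear (Ψ ∘ Φ) p := by
  refine ⟨hΨ.1.comp hΦ.1, ?_⟩
  rw [fderiv_comp _ hΨ.1.differentiableAt hΦ.1.differentiableAt]
  exact hΨ.2.comp hΦ.2

lemma IsLocalDiffeoNear.eventually_bijective [CompleteSpace V] [CompleteSpace W] {Φ : V → W}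
    {p : V} (h : IsLocalDiffeoNear Φ p) :
    ∀ᶠ x in 𝓝 p, Function.Bijective (fderiv ℝ Φ x) := by
  let f' : V ≃L[ℝ] W := ContinuousLinearEquiv.ofBijective (fderiv ℝ Φ p)
    (LinearMap.ker_eq_bot.2 h.2.1) (LinearMap.range_eq_top.2 h.2.2)
  have hf' : (f' : V →L[ℝ] W) = fderiv ℝ Φ p := rfl
  filter_upwards [h.1.fderiv.continuousAt.eventually_mem (hf' ▸ f'.nhds)] with x ⟨e, he⟩
  exact he ▸ e.bijective

lemma isLocalDiffeoNear_continuousLinearEquiv (f : V ≃L[ℝ] W) (p : V) :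
    IsLocalDiffeoNear f p := by
  refine ⟨.of_contDiff f.contDiff p, ?_⟩
  rw [f.hasFDerivAt.fderiv]
  exact f.bijective

end LocalDiffeo

/-! ### Complex contact structures in real coordinates -/

section ComplexContact

variable {D D' : E6 → Submodule ℝ E6} {Φ : E6 → E6} {p : E6}

/-- Near `p`, the field of subspaces `D` is the pullback of `D'` by `Φ`. -/
def IsPullbackNear (Φ : E6 → E6) (D D' : E6 → Submodule ℝ E6) (p : E6) : Prop :=
  ∀ᶠ x in 𝓝 p, ∀ v, v ∈ D x ↔ fderiv ℝ Φ x v ∈ D' (Φ x)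

lemma IsPullbackNear.of_map (hΦ : IsLocalDiffeoNear Φ p)
    (h : ∀ᶠ x in 𝓝 p, D' (Φ x) = (D x).map (fderiv ℝ Φ x : E6 →ₗ[ℝ] E6)) :
    IsPullbackNear Φ D D' p := by
  filter_upwards [h, hΦ.eventually_bijective] with x hx hb v
  rw [hx]
  exact (hb.1.mem_set_image (s := D x)).symm

lemma SupportsComplexContact.pullback (hD' : SupportsComplexContact D' (Φ p))
    (hΦ : IsLocalDiffeoNear Φ p) (h : IsPullbackNear Φ D D' p) : SupportsComplexContact D p := by
  obtain ⟨Ψ, hΨ, α, hα, hD⟩ := hD'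
  refine ⟨Ψ ∘ Φ, hΨ.comp hΦ, α, hα, ?_⟩
  filter_upwards [h, hΦ.1.continuousAt.eventually hD, hΨ.1.eventually_fderiv_comp hΦ.1]
    with x hx hDx hcomp v
  rw [hx, hDx, hcomp]
  rfl

lemma SupportsComplexContact.congr (hD : SupportsComplexContact D p)
    (h : ∀ᶠ x in 𝓝 p, D' x = D x) : SupportsComplexContact D' p := by
  obtain ⟨Ψ, hΨ, α, hα, hD⟩ := hD
  refine ⟨Ψ, hΨ, α, hα, ?_⟩
  filter_upwards [hD, h] with x hDx hx v
  rw [hx, hDx]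

/-- The complex coordinate `x_i + √-1 x_j` on `ℝ⁶`. -/
noncomputable def complexCoord (i j : Fin 6) : E6 →L[ℝ] ℂ :=
  Complex.ofRealCLM.comp (dcoord i) + Complex.I • Complex.ofRealCLM.comp (dcoord j)

lemma complexCoord_apply (i j : Fin 6) (v : E6) :
    complexCoord i j v = v i + Complex.I * v j := by
  simp [complexCoord, dcoord]

/-- The identification of `ℝ⁶` with `ℂ³` that pairs the coordinates `x`, `y` and `z`. -/
noncomputable def toTriple : E6 ≃L[ℝ] ℂ × ℂ × ℂ :=
  LinearEquiv.toContinuousLinearEquiv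
    { toFun := fun v => (complexCoord 0 1 v, complexCoord 2 3 v, complexCoord 4 5 v)
      map_add' := by intros; simp
      map_smul' := by intros; simp
      invFun := fun ζ => !₂[ζ.1.re, ζ.1.im, ζ.2.1.re, ζ.2.1.im, ζ.2.2.re, ζ.2.2.im]
      left_inv := by
        intro v
        ext i
        fin_cases i <;> simp [complexCoord_apply]
      right_inv := by
        intro ζ
        simp [complexCoord_apply, mul_comm Complex.I, Complex.re_add_im] }

lemma toTriple_apply (v : E6) :
    toTriple v = (complexCoord 0 1 v, complexCoord 2 3 v, complexCoord 4 5 v) := rfl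

/-- The standard complex contact form `dw - v du` on `ℝ⁶ = ℂ³`. -/
noncomputable def stdForm (y : E6) : E6 →L[ℝ] ℂ :=
  complexCoord 4 5 - complexCoord 2 3 y • complexCoord 0 1

lemma stdForm_apply (y v : E6) : stdForm y v =
    (toTriple v).2.2 - (toTriple y).2.1 * (toTriple v).1 := rfl

lemma SupportsComplexContact.exists_darboux (hD : SupportsComplexContact D p) :
    ∃ Ψ : E6 → E6, IsLocalDiffeoNear Ψ p ∧ Ψ p = 0 ∧
      ∀ᶠ x in 𝓝 p, ∀ v, v ∈ D x ↔ stdForm (Ψ x) (fderiv ℝ Ψ x v) = 0 := by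
  obtain ⟨Φ, hΦ, α, ⟨hα, hvol⟩, hD⟩ := hD
  obtain ⟨Θ, hΘ, hΘ₀, hΘb, hΘα⟩ := FatReeb.exists_darboux (by simp) hα hvol
  have hΘd {z : C3} (hz : AnalyticAt ℂ Θ z) :
      fderiv ℝ Θ z = (fderiv ℂ Θ z).restrictScalars ℝ :=
    (hz.differentiableAt.hasFDerivAt.restrictScalars ℝ).fderiv
  have hΘs : SmoothNear Θ (Φ p) := by
    filter_upwards [hΘ.eventually_analyticAt] with z hz
    exact (hz.contDiffAt (n := ∞)).restrict_scalars ℝ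
  have hΘΦ : IsLocalDiffeoNear (Θ ∘ Φ) p := IsLocalDiffeoNear.comp ⟨hΘs, by rwa [hΘd hΘ]⟩ hΦ
  have hT (z) : IsLocalDiffeoNear toTriple.symm z := isLocalDiffeoNear_continuousLinearEquiv _ z
  refine ⟨toTriple.symm ∘ (Θ ∘ Φ), (hT _).comp hΘΦ, by simp [hΘ₀], ?_⟩
  filter_upwards [hD, hΦ.1.continuousAt.eventually hΘα,
    (hT _).1.eventually_fderiv_comp hΘΦ.1, hΘs.eventually_fderiv_comp hΦ.1,
    hΦ.1.continuousAt.eventually hΘ.eventually_analyticAt] with x hDx hαx hTx hΘx hΘan v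
  rw [hDx, hαx, hTx, hΘx, toTriple.symm.hasFDerivAt.fderiv, hΘd hΘan, stdForm_apply]
  simp only [Function.comp_apply, ContinuousLinearMap.comp_apply,
    ContinuousLinearEquiv.coe_coe, ContinuousLinearEquiv.apply_symm_apply]
  rfl

end ComplexContact

/-- The Pfaffian of an antisymmetric `4 × 4` matrix. -/
def pfaffian (c : Fin 4 → Fin 4 → ℂ) : ℂ := c 0 1 * c 2 3 - c 0 2 * c 1 3 + c 0 3 * c 1 2

section ContactJet

variable {V : Type*} [NormedAddCommGroup V] [NormedSpace ℝ V]

/-- The value `θ` and the exterior derivative `δ` at a point of the pullback of `dw - v du` by a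
local diffeomorphism to `ℂ³`, with `a` and `b` standing for `du` and `dv`. -/
def IsContactJet (θ : V →L[ℝ] ℂ) (δ : V → V → ℂ) : Prop :=
  ∃ a b : V →L[ℝ] ℂ, (∀ s t, ∃ x, θ x = 0 ∧ a x = s ∧ b x = t) ∧
    ∀ x y, δ x y = a x * b y - b x * a y

variable {θ : V →L[ℝ] ℂ} {δ : V → V → ℂ}

lemma IsContactJet.conj (h : IsContactJet θ δ) :
    IsContactJet ((Complex.conjCLE : ℂ →L[ℝ] ℂ).comp θ) fun x y => (starRingEnd ℂ) (δ x y) := by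
  obtain ⟨a, b, hsurj, hδ⟩ := h
  refine ⟨(Complex.conjCLE : ℂ →L[ℝ] ℂ).comp a, (Complex.conjCLE : ℂ →L[ℝ] ℂ).comp b, ?_,
    fun x y => by simp [hδ]⟩
  intro s t
  obtain ⟨x, hθ, ha, hb⟩ := hsurj ((starRingEnd ℂ) s) ((starRingEnd ℂ) t)
  exact ⟨x, by simp [hθ], by simp [ha], by simp [hb]⟩

lemma IsContactJet.pfaffian_eq_zero (h : IsContactJet θ δ) (X : Fin 4 → V) :
    pfaffian (fun i j => δ (X i) (X j)) = 0 := by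
  obtain ⟨a, b, -, hδ⟩ := h
  simp only [pfaffian, hδ]
  ring

/-- A complex vector `∑ ξᵢ Xᵢ` that is `δ`-orthogonal to the kernel of `θ` is of type `(0, 1)`. -/
lemma IsContactJet.sum_mul_eq_zero (h : IsContactJet θ δ) {ι : Type*} [Fintype ι] {X : ι → V}
    (hX : ∀ x, θ x = 0 → ∃ t : ι → ℝ, x = ∑ i, t i • X i) {ξ : ι → ℂ}
    (hξ : ∀ j, ∑ i, ξ i * δ (X i) (X j) = 0) (y : V) : ∑ i, ξ i * δ y (X i) = 0 := by
  obtain ⟨a, b, hsurj, hδ⟩ := h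
  have hker (x : V) (hx : θ x = 0) :
      (∑ i, ξ i * a (X i)) * b x - (∑ i, ξ i * b (X i)) * a x = 0 := by
    obtain ⟨t, rfl⟩ := hX x hx
    simp only [map_sum, map_smul, Complex.real_smul, Finset.mul_sum (s := .univ) (f := fun j =>
      (t j : ℂ) * _), ← Finset.sum_sub_distrib]
    refine Finset.sum_eq_zero fun j _ => ?_
    trans t j * ∑ i, ξ i * δ (X i) (X j)
    · simp only [hδ, mul_sub, Finset.sum_sub_distrib, Finset.mul_sum, Finset.sum_mul]
      congr 1 <;> exact Finset.sum_congr rfl fun i _ => by ring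
    · rw [hξ, mul_zero]
  have ha : ∑ i, ξ i * a (X i) = 0 := by
    obtain ⟨x, hx, hax, hbx⟩ := hsurj 0 1
    simpa [hax, hbx] using hker x hx
  have hb : ∑ i, ξ i * b (X i) = 0 := by
    obtain ⟨x, hx, hax, hbx⟩ := hsurj 1 0
    simpa [hax, hbx] using hker x hx
  calc ∑ i, ξ i * δ y (X i) = a y * ∑ i, ξ i * b (X i) - b y * ∑ i, ξ i * a (X i) := by
        simp only [hδ, mul_sub, Finset.sum_sub_distrib, Finset.mul_sum]
        congr 1 <;> exact Finset.sum_congr rfl fun i _ => by ring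
    _ = 0 := by rw [ha, hb, mul_zero, mul_zero, sub_zero]

end ContactJet

lemma hasFDerivAt_stdForm (y : E6) :
    HasFDerivAt stdForm (-(complexCoord 2 3).smulRight (complexCoord 0 1)) y := by
  have := ((complexCoord 2 3).hasFDerivAt (x := y)).smul_const (complexCoord 0 1)
  exact this.const_sub (complexCoord 4 5)

lemma isContactJet_stdForm_pullback {Ψ : E6 → E6} {x : E6} (hΨ : ContDiffAt ℝ 2 Ψ x)
    (hb : Function.Surjective (fderiv ℝ Ψ x)) :
    IsContactJet ((stdForm (Ψ x)).comp (fderiv ℝ Ψ x)) fun a b =>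
      fderiv ℝ (fun y => (stdForm (Ψ y)).comp (fderiv ℝ Ψ y)) x a b
        - fderiv ℝ (fun y => (stdForm (Ψ y)).comp (fderiv ℝ Ψ y)) x b a := by
  refine ⟨(complexCoord 0 1).comp (fderiv ℝ Ψ x), (complexCoord 2 3).comp (fderiv ℝ Ψ x),
    fun s t => ?_, fun a b => ?_⟩
  · obtain ⟨v, hv⟩ := hb (toTriple.symm (s, t, complexCoord 2 3 (Ψ x) * s))
    have hcoord := toTriple.apply_symm_apply (s, t, complexCoord 2 3 (Ψ x) * s)
    simp only [toTriple_apply, Prod.mk.injEq] at hcoord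
    obtain ⟨h₀, h₁, h₂⟩ := hcoord
    exact ⟨v, by simp [hv, stdForm, h₀, h₂], by simp [hv, h₀], by simp [hv, h₁]⟩
  · beta_reduce
    rw [fderiv_pullback_sub hΨ (hasFDerivAt_stdForm _).differentiableAt,
      (hasFDerivAt_stdForm _).fderiv]
    simp only [_root_.neg_apply, ContinuousLinearMap.smulRight_apply, _root_.smul_apply,
      smul_eq_mul, ContinuousLinearMap.comp_apply]
    ring

lemma SupportsComplexContact.exists_isContactJet {D : E6 → Submodule ℝ E6} {p : E6}
    (hD : SupportsComplexContact D p) :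
    ∃ Θ : E6 → E6 →L[ℝ] ℂ, SmoothNear Θ p ∧ ∀ᶠ x in 𝓝 p,
      (∀ v, v ∈ D x ↔ Θ x v = 0) ∧
      IsContactJet (Θ x) fun u v => fderiv ℝ Θ x u v - fderiv ℝ Θ x v u := by
  obtain ⟨Ψ, hΨ, -, hΨD⟩ := hD.exists_darboux
  have hstd : ContDiff ℝ ∞ stdForm := contDiff_const.sub
    ((complexCoord 2 3).contDiff.smul contDiff_const)
  refine ⟨fun x => (stdForm (Ψ x)).comp (fderiv ℝ Ψ x), ?_, ?_⟩
  · filter_upwards [hΨ.1, hΨ.1.fderiv] with x hx hx'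
    exact (hstd.contDiffAt.comp x hx).clm_comp hx'
  · filter_upwards [hΨD, hΨ.eventually_bijective, hΨ.1] with x hxD hb hx
    exact ⟨hxD, isContactJet_stdForm_pullback (hx.of_le (by norm_cast)) hb.2⟩

/-! ### Distributions given as graphs -/

/-- The index in `ℝ⁶` of the `i`-th base coordinate. -/
abbrev baseIndex (i : Fin 4) : Fin 6 := i.castLE (by norm_num)

/-- The `k`-th vector of the standard basis of `ℝ⁶`. -/
noncomputable def stdBasis (k : Fin 6) : E6 := EuclideanSpace.single k 1

@[simp] lemma stdBasis_apply (k l : Fin 6) : stdBasis k l = if l = k then (1 : ℝ) else 0 := by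
  simp [stdBasis]

/-- The form `dz - ∑ f_i dx_i`, with `z` the complex coordinate built from the last two coordinates
of `ℝ⁶` and `x_i` the first four coordinates. -/
noncomputable def graphForm (f : Fin 4 → ℂ) : E6 →L[ℝ] ℂ :=
  complexCoord 4 5 - ∑ i, f i • Complex.ofRealCLM.comp (dcoord (baseIndex i))

lemma graphForm_apply (f : Fin 4 → ℂ) (v : E6) :
    graphForm f v = v 4 + Complex.I * v 5 - ∑ i, f i * v (baseIndex i) := by
  simp [graphForm, complexCoord_apply, dcoord]

/-- The tangent vector of the fibre `ℂ = ℝ²` of the last two coordinates given by a complex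
number. -/
noncomputable def vertical : ℂ →L[ℝ] E6 :=
  Complex.reCLM.smulRight (stdBasis 4) + Complex.imCLM.smulRight (stdBasis 5)

lemma vertical_apply (a : ℂ) : vertical a = a.re • stdBasis 4 + a.im • stdBasis 5 := rfl

/-- The lift of the `i`-th base coordinate field to the kernel of `graphForm f`. -/
noncomputable def horizontalLift (f : Fin 4 → ℂ) (i : Fin 4) : E6 :=
  stdBasis (baseIndex i) + vertical (f i)

lemma graphForm_horizontalLift (f : Fin 4 → ℂ) (i : Fin 4) :
    graphForm f (horizontalLift f i) = 0 := by
  rw [graphForm_apply]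
  have hf := Complex.re_add_im (f i)
  fin_cases i <;>
    simp [horizontalLift, vertical_apply, Fin.sum_univ_four, baseIndex, mul_comm Complex.I] at hf ⊢

lemma eq_sum_horizontalLift {f : Fin 4 → ℂ} {v : E6} (hv : graphForm f v = 0) :
    v = ∑ i, v (baseIndex i) • horizontalLift f i := by
  rw [graphForm_apply, sub_eq_zero] at hv
  have hre := congrArg Complex.re hv
  have him := congrArg Complex.im hv
  simp [Fin.sum_univ_four, baseIndex] at hre him
  ext k
  fin_cases k <;>
    simp [horizontalLift, vertical_apply, Fin.sum_univ_four, baseIndex, hre, him] <;> ring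

/-- The curvature of the graph distribution `ker θ`, `θ = graphForm ∘ F`: the values
`θ([X_i, X_j])` on the horizontal lifts `X_i`. -/
noncomputable def curvature (F : E6 → Fin 4 → ℂ) (x : E6) (i j : Fin 4) : ℂ :=
  fderiv ℝ F x (horizontalLift (F x) i) j - fderiv ℝ F x (horizontalLift (F x) j) i

/-- The curvature `(θ + m θ̄)([X_i, X_j])` of the graph distribution with coefficients `F`. -/
noncomputable def twistedCurvature (F : E6 → Fin 4 → ℂ) (m : ℂ) (x : E6) (i j : Fin 4) : ℂ :=
  curvature F x i j + m * (starRingEnd ℂ) (curvature F x i j)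

lemma twistedCurvature_swap (F : E6 → Fin 4 → ℂ) (m : ℂ) (x : E6) (i j : Fin 4) :
    twistedCurvature F m x i j = -twistedCurvature F m x j i := by
  simp only [twistedCurvature, curvature, map_sub]
  ring

/-- A vector in the kernel of an antisymmetric `4 × 4` matrix with vanishing Pfaffian. -/
noncomputable def kernelVector (c : Fin 4 → Fin 4 → ℂ) : Fin 4 → ℂ := ![c 1 2, -c 0 2, c 0 1, 0]

lemma kernelVector_mul_eq_zero {c : Fin 4 → Fin 4 → ℂ} (hc : ∀ i j, c i j = -c j i)
    (hpf : pfaffian c = 0) (j : Fin 4) : ∑ i, kernelVector c i * c i j = 0 := by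
  have hdiag (i) : c i i = 0 := self_eq_neg.1 (hc i i)
  rw [pfaffian] at hpf
  fin_cases j
  on_goal 4 => simp [kernelVector, Fin.sum_univ_four]; linear_combination hpf
  all_goals simp [kernelVector, Fin.sum_univ_four, hdiag, hc 1 0, hc 2 0, hc 2 1]; ring

/-- The obstruction to integrability of the almost complex structure defined by the graph
distribution with coefficients `F` and the Beltrami coefficient `μ`. For `θ = graphForm ∘ F` and
`θ' = θ + μ θ̄`, it is the value of `dθ'` on the kernel vector of the twisted curvature and the
vertical vector `(1 - μ) ∂_{z₁} + √-1 (1 + μ) ∂_{z₂}` in the kernel of `θ'`. -/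
noncomputable def obstruction (F : E6 → Fin 4 → ℂ) (μ : E6 → ℂ) (x : E6) : ℂ :=
  ∑ i, kernelVector (twistedCurvature F (μ x) x) i *
    (2 * fderiv ℝ μ x (horizontalLift (F x) i)
      + (1 - μ x) * (fderiv ℝ F x (stdBasis 4) i
        + μ x * (starRingEnd ℂ) (fderiv ℝ F x (stdBasis 4) i))
      + Complex.I * (1 + μ x) * (fderiv ℝ F x (stdBasis 5) i
        + μ x * (starRingEnd ℂ) (fderiv ℝ F x (stdBasis 5) i)))

/-- The coefficient of `dz` in a real-linear form. -/
noncomputable def dzCoeff (θ : E6 →L[ℝ] ℂ) : ℂ :=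
  (θ (stdBasis 4) - Complex.I * θ (stdBasis 5)) / 2

/-- The coefficient of `dz̄` in a real-linear form. -/
noncomputable def dzbarCoeff (θ : E6 →L[ℝ] ℂ) : ℂ :=
  (θ (stdBasis 4) + Complex.I * θ (stdBasis 5)) / 2

lemma apply_vertical (θ : E6 →L[ℝ] ℂ) (a : ℂ) :
    θ (vertical a) = dzCoeff θ * a + dzbarCoeff θ * (starRingEnd ℂ) a := by
  have hconj : (starRingEnd ℂ) a = a.re - a.im * Complex.I := by
    apply Complex.ext <;> simp
  conv_rhs => rw [hconj]; enter [1]; rw [← Complex.re_add_im a]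
  simp only [vertical_apply, map_add, map_smul, Complex.real_smul, dzCoeff, dzbarCoeff]
  linear_combination ((a.im : ℂ) * θ (stdBasis 5)) * Complex.I_mul_I

section Integrability

variable {F : E6 → Fin 4 → ℂ} {Θ : E6 → E6 →L[ℝ] ℂ} {μ : E6 → ℂ} {x : E6}

lemma hasFDerivAt_horizontalLift (hF : DifferentiableAt ℝ F x) (i : Fin 4) :
    HasFDerivAt (fun y => horizontalLift (F y) i)
      (vertical.comp ((ContinuousLinearMap.proj i).comp (fderiv ℝ F x))) x :=
  (vertical.hasFDerivAt.comp x (hasFDerivAt_pi'.1 hF.hasFDerivAt i)).const_add _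

lemma fderiv_apply_horizontalLift (hF : DifferentiableAt ℝ F x) (hΘ : DifferentiableAt ℝ Θ x)
    (hker : ∀ᶠ y in 𝓝 x, ∀ i, Θ y (horizontalLift (F y) i) = 0) (i : Fin 4) (u : E6) :
    fderiv ℝ Θ x u (horizontalLift (F x) i) = -(dzCoeff (Θ x) * fderiv ℝ F x u i
      + dzbarCoeff (Θ x) * (starRingEnd ℂ) (fderiv ℝ F x u i)) := by
  have hderiv := (hΘ.hasFDerivAt.clm_apply (hasFDerivAt_horizontalLift hF i)).fderiv
  have hzero : (fun y => Θ y (horizontalLift (F y) i)) =ᶠ[𝓝 x] fun _ => 0 :=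
    hker.mono fun y hy => hy i
  rw [hzero.fderiv_eq, fderiv_const_apply] at hderiv
  have hu := DFunLike.congr_fun hderiv u
  rw [← apply_vertical]
  simp at hu
  linear_combination -hu

lemma sub_eq_dzCoeff_mul_twistedCurvature (hF : DifferentiableAt ℝ F x)
    (hΘ : DifferentiableAt ℝ Θ x)
    (hker : ∀ᶠ y in 𝓝 x, ∀ i, Θ y (horizontalLift (F y) i) = 0)
    (hμ : dzbarCoeff (Θ x) = dzCoeff (Θ x) * μ x) (i j : Fin 4) :
    fderiv ℝ Θ x (horizontalLift (F x) i) (horizontalLift (F x) j)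
      - fderiv ℝ Θ x (horizontalLift (F x) j) (horizontalLift (F x) i)
      = -dzCoeff (Θ x) * twistedCurvature F (μ x) x i j := by
  simp only [fderiv_apply_horizontalLift hF hΘ hker, hμ, twistedCurvature, curvature, map_sub]
  ring

lemma fderiv_dzbarCoeff_relation (hΘ : DifferentiableAt ℝ Θ x) (hμ : DifferentiableAt ℝ μ x)
    (hΘμ : ∀ᶠ y in 𝓝 x, dzbarCoeff (Θ y) = dzCoeff (Θ y) * μ y) (u : E6) :
    dzbarCoeff (fderiv ℝ Θ x u) =
      dzCoeff (fderiv ℝ Θ x u) * μ x + dzCoeff (Θ x) * fderiv ℝ μ x u := by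
  have happly (e : E6) : HasFDerivAt (fun y => Θ y e) ((fderiv ℝ Θ x).flip e) x := by
    simpa using hΘ.hasFDerivAt.clm_apply (hasFDerivAt_const e x)
  have hz : HasFDerivAt (fun y => dzCoeff (Θ y)) _ x :=
    ((happly _).sub ((happly _).const_mul _)).mul_const (2 : ℂ)⁻¹
  have hzbar : HasFDerivAt (fun y => dzbarCoeff (Θ y)) _ x :=
    ((happly _).add ((happly _).const_mul _)).mul_const (2 : ℂ)⁻¹
  have hderiv := hzbar.unique ((hz.mul hμ.hasFDerivAt).congr_of_eventuallyEq hΘμ)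
  have hu := DFunLike.congr_fun hderiv u
  simp at hu
  simp only [dzCoeff, dzbarCoeff] at hu ⊢
  linear_combination hu

/-- A form `Θ` of complex contact type is a multiple of `θ + μ θ̄`. Contact type makes the kernel
vector of the curvature a `(0, 1)`-vector, and contracting it with `dΘ` gives the obstruction. -/
lemma IsContactJet.obstruction_eq_zero
    (hjet : IsContactJet (Θ x) fun u v => fderiv ℝ Θ x u v - fderiv ℝ Θ x v u)
    (hF : DifferentiableAt ℝ F x) (hΘ : DifferentiableAt ℝ Θ x) (hμ : DifferentiableAt ℝ μ x)
    (hker : ∀ᶠ y in 𝓝 x, ∀ v, Θ y v = 0 ↔ graphForm (F y) v = 0)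
    (hz : dzCoeff (Θ x) ≠ 0) (hΘμ : ∀ᶠ y in 𝓝 x, dzbarCoeff (Θ y) = dzCoeff (Θ y) * μ y) :
    pfaffian (twistedCurvature F (μ x) x) = 0 ∧ obstruction F μ x = 0 := by
  have hlift : ∀ᶠ y in 𝓝 x, ∀ i, Θ y (horizontalLift (F y) i) = 0 :=
    hker.mono fun y hy i => (hy _).2 (graphForm_horizontalLift _ _)
  have hμx := hΘμ.self_of_nhds
  have hcurv := sub_eq_dzCoeff_mul_twistedCurvature hF hΘ hlift hμx
  have hpf : pfaffian (twistedCurvature F (μ x) x) = 0 := by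
    have hpfΘ := hjet.pfaffian_eq_zero (horizontalLift (F x))
    simp only [hcurv] at hpfΘ
    refine (mul_eq_zero.1 ?_).resolve_left (pow_ne_zero 2 hz)
    simp only [pfaffian] at hpfΘ ⊢
    linear_combination hpfΘ
  refine ⟨hpf, (mul_eq_zero.1 ?_).resolve_left hz⟩
  set ξ := kernelVector (twistedCurvature F (μ x) x) with hξ
  have hcontract := hjet.sum_mul_eq_zero (ξ := ξ)
    (fun v hv => ⟨_, eq_sum_horizontalLift ((hker.self_of_nhds v).1 hv)⟩) fun j => by
      simp only [hcurv, mul_left_comm (ξ _), ← Finset.mul_sum]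
      rw [hξ, kernelVector_mul_eq_zero (twistedCurvature_swap F _ x) hpf, mul_zero]
  have h₄ := hcontract (stdBasis 4)
  have h₅ := hcontract (stdBasis 5)
  have hrel (i) := fderiv_dzbarCoeff_relation hΘ hμ hΘμ (horizontalLift (F x) i)
  simp only [fderiv_apply_horizontalLift hF hΘ hlift, hμx, Fin.sum_univ_four] at h₄ h₅
  simp only [dzCoeff, dzbarCoeff] at hrel h₄ h₅ ⊢
  rw [obstruction, ← hξ, Fin.sum_univ_four]
  linear_combination (μ x - 1) * h₄ - Complex.I * (1 + μ x) * h₅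
    - 2 * (ξ 0 * hrel 0 + ξ 1 * hrel 1 + ξ 2 * hrel 2 + ξ 3 * hrel 3)

end Integrability

/-! ### The Beltrami coefficient -/

/-- The mixed Pfaffian of an antisymmetric matrix and its conjugate. -/
noncomputable def mixedPfaffian (c : Fin 4 → Fin 4 → ℂ) : ℝ :=
  2 * (c 0 1 * (starRingEnd ℂ) (c 2 3) - c 0 2 * (starRingEnd ℂ) (c 1 3)
    + c 0 3 * (starRingEnd ℂ) (c 1 2)).re

/-- The antisymmetric matrix `c` spans together with its conjugate an elliptic pencil, positively
oriented: the wedge squares of its real combinations are positive. -/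
def IsElliptic (c : Fin 4 → Fin 4 → ℂ) : Prop :=
  0 < mixedPfaffian c ∧ 4 * Complex.normSq (pfaffian c) < mixedPfaffian c ^ 2

/-- The square root of the discriminant of `m ↦ pfaffian (c + m c̄)`. -/
noncomputable def discrRoot (c : Fin 4 → Fin 4 → ℂ) : ℝ :=
  √(mixedPfaffian c ^ 2 - 4 * Complex.normSq (pfaffian c))

/-- The solution `m` of modulus less than one of `pfaffian (c + m c̄) = 0`. -/
noncomputable def beltrami (c : Fin 4 → Fin 4 → ℂ) : ℂ :=
  -2 * pfaffian c / ((mixedPfaffian c + discrRoot c : ℝ) : ℂ)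

section Beltrami

variable {c : Fin 4 → Fin 4 → ℂ}

lemma pfaffian_add_mul_conj (c : Fin 4 → Fin 4 → ℂ) (m : ℂ) :
    pfaffian (fun i j => c i j + m * (starRingEnd ℂ) (c i j))
      = pfaffian c + mixedPfaffian c * m + (starRingEnd ℂ) (pfaffian c) * m ^ 2 := by
  rw [mixedPfaffian, ← Complex.add_conj]
  simp only [pfaffian, map_add, map_sub, map_mul, Complex.conj_conj]
  ring

lemma IsElliptic.two_mul_norm_pfaffian_lt (h : IsElliptic c) :
    2 * ‖pfaffian c‖ < mixedPfaffian c := by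
  refine lt_of_pow_lt_pow_left₀ 2 h.1.le ?_
  rw [mul_pow, ← Complex.normSq_eq_norm_sq]
  linarith [h.2]

lemma IsElliptic.mixedPfaffian_add_discrRoot_pos (h : IsElliptic c) :
    0 < mixedPfaffian c + discrRoot c :=
  add_pos_of_pos_of_nonneg h.1 (Real.sqrt_nonneg _)

lemma IsElliptic.discrRoot_sq (h : IsElliptic c) :
    (discrRoot c : ℂ) ^ 2 =
      mixedPfaffian c ^ 2 - 4 * (pfaffian c * (starRingEnd ℂ) (pfaffian c)) := by
  rw [Complex.mul_conj]
  exact_mod_cast Real.sq_sqrt (sub_pos.2 h.2).le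

lemma IsElliptic.two_mul_norm_pfaffian_lt_add (h : IsElliptic c) :
    2 * ‖pfaffian c‖ < mixedPfaffian c + discrRoot c :=
  h.two_mul_norm_pfaffian_lt.trans_le (le_add_of_nonneg_right (Real.sqrt_nonneg _))

lemma IsElliptic.norm_beltrami_lt (h : IsElliptic c) : ‖beltrami c‖ < 1 := by
  have hpos := h.mixedPfaffian_add_discrRoot_pos
  rw [beltrami, norm_div, norm_mul, norm_neg, Complex.norm_two, Complex.norm_real,
    Real.norm_of_nonneg hpos.le, div_lt_one hpos]
  exact h.two_mul_norm_pfaffian_lt_add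

lemma IsElliptic.two_mul_conj_pfaffian_mul_add_ne_zero (h : IsElliptic c) {m : ℂ} (hm : ‖m‖ ≤ 1) :
    2 * (starRingEnd ℂ) (pfaffian c) * m + (mixedPfaffian c + discrRoot c : ℝ) ≠ 0 := by
  intro hzero
  have hnorm := congrArg norm (eq_neg_of_add_eq_zero_left hzero)
  rw [norm_mul, norm_mul, Complex.norm_two, RCLike.norm_conj, norm_neg, Complex.norm_real,
    Real.norm_of_nonneg h.mixedPfaffian_add_discrRoot_pos.le] at hnorm
  have hle : 2 * ‖pfaffian c‖ * ‖m‖ ≤ 2 * ‖pfaffian c‖ :=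
    mul_le_of_le_one_right (by positivity) hm
  linarith [h.two_mul_norm_pfaffian_lt_add]

lemma IsElliptic.eq_beltrami (h : IsElliptic c) {m : ℂ} (hm : ‖m‖ ≤ 1)
    (hpf : pfaffian (fun i j => c i j + m * (starRingEnd ℂ) (c i j)) = 0) : m = beltrami c := by
  have hsum := h.mixedPfaffian_add_discrRoot_pos.ne'
  rw [← Complex.ofReal_ne_zero] at hsum
  have hlarge := h.two_mul_conj_pfaffian_mul_add_ne_zero hm
  have hS := h.discrRoot_sq
  rw [pfaffian_add_mul_conj] at hpf
  rw [beltrami, eq_div_iff hsum]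
  push_cast at hlarge ⊢
  set A := pfaffian c
  set P : ℂ := ((mixedPfaffian c : ℝ) : ℂ)
  set S : ℂ := ((discrRoot c : ℝ) : ℂ)
  have hsmall : 2 * (starRingEnd ℂ) A * m + P - S = 0 :=
    (mul_eq_zero.1 (by linear_combination 4 * (starRingEnd ℂ) A * hpf - hS)).resolve_right hlarge
  linear_combination 2 * hpf - m * hsmall

end Beltrami

lemma contDiff_conj : ContDiff ℝ ∞ fun a : ℂ => (starRingEnd ℂ) a :=
  (Complex.conjCLE : ℂ →L[ℝ] ℂ).contDiff

lemma contDiffAt_div {𝕜 𝔸 E : Type*} [NontriviallyNormedField 𝕜] [NormedField 𝔸]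
    [NormedAlgebra 𝕜 𝔸] [NormedAddCommGroup E] [NormedSpace 𝕜 E] {f g : E → 𝔸} {x : E} {n : ℕ∞ω}
    (hf : ContDiffAt 𝕜 n f x) (hg : ContDiffAt 𝕜 n g x) (hx : g x ≠ 0) :
    ContDiffAt 𝕜 n (fun y => f y / g y) x := by
  simp only [div_eq_mul_inv]
  exact hf.mul (hg.inv hx)

lemma contDiff_dzCoeff : ContDiff ℝ ∞ dzCoeff := by
  unfold dzCoeff
  fun_prop

lemma contDiff_dzbarCoeff : ContDiff ℝ ∞ dzbarCoeff := by
  unfold dzbarCoeff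
  fun_prop

lemma dzCoeff_conj (θ : E6 →L[ℝ] ℂ) :
    dzCoeff ((Complex.conjCLE : ℂ →L[ℝ] ℂ).comp θ) = (starRingEnd ℂ) (dzbarCoeff θ) := by
  simp [dzCoeff, dzbarCoeff, map_ofNat (starRingEnd ℂ), sub_eq_add_neg]

lemma dzbarCoeff_conj (θ : E6 →L[ℝ] ℂ) :
    dzbarCoeff ((Complex.conjCLE : ℂ →L[ℝ] ℂ).comp θ) = (starRingEnd ℂ) (dzCoeff θ) := by
  simp [dzCoeff, dzbarCoeff, map_ofNat (starRingEnd ℂ), sub_eq_add_neg]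

lemma graphForm_vertical (f : Fin 4 → ℂ) (a : ℂ) : graphForm f (vertical a) = a := by
  rw [graphForm_apply]
  simp [vertical_apply, Fin.sum_univ_four, baseIndex, mul_comm Complex.I]

lemma eq_zero_of_dzCoeff_mul_add {θ : E6 →L[ℝ] ℂ} {f : Fin 4 → ℂ}
    (h : ∀ v, θ v = 0 ↔ graphForm f v = 0) {a : ℂ}
    (ha : dzCoeff θ * a + dzbarCoeff θ * (starRingEnd ℂ) a = 0) : a = 0 := by
  rwa [← apply_vertical, h, graphForm_vertical] at ha

section ExistsBeltrami

variable {F : E6 → Fin 4 → ℂ} {p : E6}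

lemma exists_beltrami_of_norm_le {Θ : E6 → E6 →L[ℝ] ℂ} (hF : SmoothNear F p)
    (hΘ : SmoothNear Θ p) (hker : ∀ᶠ y in 𝓝 p, ∀ v, Θ y v = 0 ↔ graphForm (F y) v = 0)
    (hjet : ∀ᶠ x in 𝓝 p, IsContactJet (Θ x) fun u v => fderiv ℝ Θ x u v - fderiv ℝ Θ x v u)
    (hle : ‖dzbarCoeff (Θ p)‖ ≤ ‖dzCoeff (Θ p)‖) :
    ∃ μ : E6 → ℂ, SmoothNear μ p ∧ ‖μ p‖ ≤ 1 ∧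
      ∀ᶠ x in 𝓝 p, pfaffian (twistedCurvature F (μ x) x) = 0 ∧ obstruction F μ x = 0 := by
  have hzp : dzCoeff (Θ p) ≠ 0 := fun hz => by
    rw [hz, norm_zero, norm_le_zero_iff] at hle
    exact one_ne_zero (eq_zero_of_dzCoeff_mul_add hker.self_of_nhds (a := 1) (by simp [hz, hle]))
  have hz : ∀ᶠ x in 𝓝 p, dzCoeff (Θ x) ≠ 0 :=
    (contDiff_dzCoeff.continuous.continuousAt.comp hΘ.continuousAt).eventually_ne hzp
  set μ : E6 → ℂ := fun x => dzbarCoeff (Θ x) / dzCoeff (Θ x)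
  have hμ : SmoothNear μ p := by
    filter_upwards [hΘ, hz] with x hΘx hzx
    exact contDiffAt_div (contDiff_dzbarCoeff.contDiffAt.comp x hΘx)
      (contDiff_dzCoeff.contDiffAt.comp x hΘx) hzx
  have hΘμ : ∀ᶠ x in 𝓝 p, dzbarCoeff (Θ x) = dzCoeff (Θ x) * μ x :=
    hz.mono fun x hzx => (mul_div_cancel₀ _ hzx).symm
  refine ⟨μ, hμ, (norm_div _ _).trans_le (div_le_one_of_le₀ hle (norm_nonneg _)), ?_⟩
  filter_upwards [hF.eventually_smoothNear, hΘ.eventually_smoothNear, hμ.eventually_smoothNear,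
    hker.eventually_nhds, hjet, hz, hΘμ.eventually_nhds] with x hFx hΘx hμx hkerx hjetx hzx hΘμx
  exact hjetx.obstruction_eq_zero hFx.differentiableAt hΘx.differentiableAt hμx.differentiableAt
    hkerx hzx hΘμx

/-- Conjugating the defining form exchanges its `dz` and `dz̄` coefficients, so the second may be
assumed not to dominate. -/
lemma SupportsComplexContact.exists_beltrami {D : E6 → Submodule ℝ E6}
    (hD : SupportsComplexContact D p) (hF : SmoothNear F p)
    (hgraph : ∀ᶠ x in 𝓝 p, ∀ v, v ∈ D x ↔ graphForm (F x) v = 0) :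
    ∃ μ : E6 → ℂ, SmoothNear μ p ∧ ‖μ p‖ ≤ 1 ∧
      ∀ᶠ x in 𝓝 p, pfaffian (twistedCurvature F (μ x) x) = 0 ∧ obstruction F μ x = 0 := by
  obtain ⟨Θ, hΘ, hΘD⟩ := hD.exists_isContactJet
  have hker : ∀ᶠ y in 𝓝 p, ∀ v, Θ y v = 0 ↔ graphForm (F y) v = 0 := by
    filter_upwards [hΘD, hgraph] with y hΘy hFy v
    rw [← hΘy.1, hFy]
  rcases le_total ‖dzbarCoeff (Θ p)‖ ‖dzCoeff (Θ p)‖ with hle | hle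
  · exact exists_beltrami_of_norm_le hF hΘ hker (hΘD.mono fun _ h => h.2) hle
  let conj : (E6 →L[ℝ] ℂ) →L[ℝ] E6 →L[ℝ] ℂ :=
    ContinuousLinearMap.compL ℝ E6 ℂ ℂ (Complex.conjCLE : ℂ →L[ℝ] ℂ)
  have hconj_fderiv {x : E6} (hΘx : DifferentiableAt ℝ Θ x) (u v : E6) :
      fderiv ℝ (fun y => conj (Θ y)) x u v = (starRingEnd ℂ) (fderiv ℝ Θ x u v) := by
    have hconj : HasFDerivAt (fun y => conj (Θ y)) (conj.comp (fderiv ℝ Θ x)) x :=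
      conj.hasFDerivAt.comp x hΘx.hasFDerivAt
    rw [hconj.fderiv]
    rfl
  refine exists_beltrami_of_norm_le (Θ := fun x => conj (Θ x)) hF
    (hΘ.mono fun x hx => conj.contDiff.contDiffAt.comp x hx) ?_ ?_ ?_
  · filter_upwards [hker] with y hy v
    rw [← hy]
    exact map_eq_zero (starRingEnd ℂ)
  · filter_upwards [hΘ.eventually_smoothNear, hΘD] with x hΘx hjet
    simp only [hconj_fderiv hΘx.differentiableAt, ← map_sub]
    exact hjet.2.conj
  · change ‖dzbarCoeff ((Complex.conjCLE : ℂ →L[ℝ] ℂ).comp (Θ p))‖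
      ≤ ‖dzCoeff ((Complex.conjCLE : ℂ →L[ℝ] ℂ).comp (Θ p))‖
    rwa [dzCoeff_conj, dzbarCoeff_conj, RCLike.norm_conj, RCLike.norm_conj]

end ExistsBeltrami

/-! ### Kernels of smooth forms as graphs -/

/-- The determinant of the restriction of a form to the fibre of the last two coordinates. -/
noncomputable def fibreDet (θ : E6 →L[ℝ] ℂ) : ℂ :=
  dzCoeff θ * (starRingEnd ℂ) (dzCoeff θ) - dzbarCoeff θ * (starRingEnd ℂ) (dzbarCoeff θ)

/-- The coefficients of the graph form with the same kernel as `θ`, provided `fibreDet θ ≠ 0`. -/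
noncomputable def kernelSlope (θ : E6 →L[ℝ] ℂ) (i : Fin 4) : ℂ :=
  (dzbarCoeff θ * (starRingEnd ℂ) (θ (stdBasis (baseIndex i)))
    - (starRingEnd ℂ) (dzCoeff θ) * θ (stdBasis (baseIndex i))) / fibreDet θ

section KernelSlope

variable {θ : E6 →L[ℝ] ℂ}

lemma fibreDet_ne_zero {f : Fin 4 → ℂ} (h : ∀ v, θ v = 0 ↔ graphForm f v = 0) :
    fibreDet θ ≠ 0 := by
  intro hdet
  rw [fibreDet] at hdet
  have hsub := eq_zero_of_dzCoeff_mul_add h (a := (starRingEnd ℂ) (dzCoeff θ) - dzbarCoeff θ) (by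
    simp only [map_sub, Complex.conj_conj]
    linear_combination hdet)
  have hadd := eq_zero_of_dzCoeff_mul_add h
    (a := Complex.I * ((starRingEnd ℂ) (dzCoeff θ) + dzbarCoeff θ)) (by
      simp only [map_add, map_mul, Complex.conj_conj, Complex.conj_I]
      linear_combination Complex.I * hdet)
  have hadd' := (mul_eq_zero.1 hadd).resolve_left Complex.I_ne_zero
  have hzbar : dzbarCoeff θ = 0 := by linear_combination (hadd' - hsub) / 2
  have hz : (starRingEnd ℂ) (dzCoeff θ) = 0 := by linear_combination (hadd' + hsub) / 2
  exact one_ne_zero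
    (eq_zero_of_dzCoeff_mul_add h (a := 1) (by simp [hzbar, (map_eq_zero _).1 hz]))

lemma apply_eq_of_apply_horizontalLift {f : Fin 4 → ℂ} (hf : ∀ i, θ (horizontalLift f i) = 0)
    (v : E6) :
    θ v = dzCoeff θ * graphForm f v + dzbarCoeff θ * (starRingEnd ℂ) (graphForm f v) := by
  have hhor : graphForm f (v - vertical (graphForm f v)) = 0 := by
    rw [map_sub, graphForm_vertical, sub_self]
  have hθ := congrArg θ (eq_sum_horizontalLift hhor)
  simp only [map_sum, map_smul, hf, smul_zero, Finset.sum_const_zero] at hθ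
  rw [map_sub, sub_eq_zero] at hθ
  rw [hθ, apply_vertical]

lemma apply_horizontalLift_kernelSlope (h : fibreDet θ ≠ 0) (i : Fin 4) :
    θ (horizontalLift (kernelSlope θ) i) = 0 := by
  have hreal : (starRingEnd ℂ) (fibreDet θ) = fibreDet θ := by
    simp only [fibreDet, map_sub, map_mul, Complex.conj_conj]
    ring
  rw [horizontalLift, map_add, apply_vertical]
  simp only [kernelSlope, map_div₀, hreal, map_sub, map_mul, Complex.conj_conj]
  field_simp
  rw [fibreDet]
  ring

lemma apply_eq_zero_iff_kernelSlope (h : fibreDet θ ≠ 0) (v : E6) :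
    θ v = 0 ↔ graphForm (kernelSlope θ) v = 0 := by
  rw [apply_eq_of_apply_horizontalLift (apply_horizontalLift_kernelSlope h)]
  refine ⟨fun hθ => (mul_eq_zero.1 ?_).resolve_left h, fun hv => by simp [hv]⟩
  have hconj := congrArg (starRingEnd ℂ) hθ
  simp only [map_add, map_mul, Complex.conj_conj, map_zero] at hconj
  rw [fibreDet]
  linear_combination (starRingEnd ℂ) (dzCoeff θ) * hθ - dzbarCoeff θ * hconj

lemma contDiff_fibreDet : ContDiff ℝ ∞ fibreDet :=
  (contDiff_dzCoeff.mul (contDiff_conj.comp contDiff_dzCoeff)).sub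
    (contDiff_dzbarCoeff.mul (contDiff_conj.comp contDiff_dzbarCoeff))

lemma contDiffAt_kernelSlope (h : fibreDet θ ≠ 0) : ContDiffAt ℝ ∞ kernelSlope θ := by
  refine contDiffAt_pi.2 fun i => contDiffAt_div ?_ contDiff_fibreDet.contDiffAt h
  have heval : ContDiff ℝ ∞ fun θ : E6 →L[ℝ] ℂ => θ (stdBasis (baseIndex i)) := by fun_prop
  exact ((contDiff_dzbarCoeff.mul (contDiff_conj.comp heval)).sub
    ((contDiff_conj.comp contDiff_dzCoeff).mul heval)).contDiffAt

end KernelSlope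

lemma exists_smooth_graph {P : Type*} [NormedAddCommGroup P] [NormedSpace ℝ P]
    {θ : P → E6 →L[ℝ] ℂ} {z : P} (hθ : SmoothNear θ z)
    (hz : ∃ f, ∀ v, θ z v = 0 ↔ graphForm f v = 0) :
    ∃ F : P → Fin 4 → ℂ, SmoothNear F z ∧
      ∀ᶠ y in 𝓝 z, ∀ v, θ y v = 0 ↔ graphForm (F y) v = 0 := by
  obtain ⟨f, hf⟩ := hz
  have hdet : ∀ᶠ y in 𝓝 z, fibreDet (θ y) ≠ 0 :=
    (contDiff_fibreDet.continuous.continuousAt.comp hθ.continuousAt).eventually_ne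
      (fibreDet_ne_zero hf)
  refine ⟨fun y => kernelSlope (θ y), ?_, hdet.mono fun y hy => apply_eq_zero_iff_kernelSlope hy⟩
  filter_upwards [hθ, hdet] with y hy hdety
  exact (contDiffAt_kernelSlope hdety).comp y hy

/-! ### The torsion of a graph and its smooth dependence on parameters -/

section Pencil

variable {c : Fin 4 → Fin 4 → ℂ}

lemma contDiff_pfaffian : ContDiff ℝ ∞ pfaffian := by
  unfold pfaffian
  fun_prop

lemma contDiff_mixedPfaffian : ContDiff ℝ ∞ mixedPfaffian := by
  have hc (i j : Fin 4) : ContDiff ℝ ∞ fun c : Fin 4 → Fin 4 → ℂ => c i j := by fun_prop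
  have hconj (i j : Fin 4) := contDiff_conj.comp (hc i j)
  exact contDiff_const.mul (Complex.reCLM.contDiff.comp ((((hc 0 1).mul (hconj 2 3)).sub
    ((hc 0 2).mul (hconj 1 3))).add ((hc 0 3).mul (hconj 1 2))))

lemma contDiff_normSq_pfaffian :
    ContDiff ℝ ∞ fun c : Fin 4 → Fin 4 → ℂ => Complex.normSq (pfaffian c) := by
  have hre : ContDiff ℝ ∞ fun c => (pfaffian c).re :=
    Complex.reCLM.contDiff.comp contDiff_pfaffian
  have him : ContDiff ℝ ∞ fun c => (pfaffian c).im :=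
    Complex.imCLM.contDiff.comp contDiff_pfaffian
  simp only [Complex.normSq_apply]
  exact (hre.mul hre).add (him.mul him)

lemma isOpen_setOf_isElliptic : IsOpen {c | IsElliptic c} :=
  (isOpen_lt continuous_const contDiff_mixedPfaffian.continuous).inter
    (isOpen_lt (continuous_const.mul contDiff_normSq_pfaffian.continuous)
      (contDiff_mixedPfaffian.continuous.pow 2))

lemma IsElliptic.contDiffAt_beltrami (h : IsElliptic c) : ContDiffAt ℝ ∞ beltrami c := by
  have hroot : ContDiffAt ℝ ∞ discrRoot c :=
    ((contDiff_mixedPfaffian.pow 2).sub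
      (contDiff_const.mul contDiff_normSq_pfaffian)).contDiffAt.sqrt (sub_pos.2 h.2).ne'
  exact contDiffAt_div (contDiffAt_const.mul contDiff_pfaffian.contDiffAt)
    (Complex.ofRealCLM.contDiff.contDiffAt.comp c (contDiff_mixedPfaffian.contDiffAt.add hroot))
    (Complex.ofReal_ne_zero.2 h.mixedPfaffian_add_discrRoot_pos.ne')

lemma contDiff_kernelVector : ContDiff ℝ ∞ kernelVector := by
  refine contDiff_pi.2 fun i => ?_
  fin_cases i <;> simp only [kernelVector] <;> dsimp <;> fun_prop

end Pencil

/-- The Beltrami coefficient of the graph distribution with coefficients `F`. -/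
noncomputable def beltramiOf (F : E6 → Fin 4 → ℂ) (x : E6) : ℂ := beltrami (curvature F x)

/-- The curvature `(θ + μ θ̄)([X_i, X_j])` for the Beltrami coefficient `μ` of the graph
distribution with coefficients `F`. -/
noncomputable def beltramiCurvature (F : E6 → Fin 4 → ℂ) (x : E6) : Fin 4 → Fin 4 → ℂ :=
  twistedCurvature F (beltramiOf F x) x

/-- The integrability obstruction of a graph distribution for its Beltrami coefficient. The
normalization makes it linear in the parameter of the model family of `modelCoef`. -/
noncomputable def torsion (F : E6 → Fin 4 → ℂ) (x : E6) : ℂ :=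
  obstruction F (beltramiOf F) x / (-4 * beltramiCurvature F x 1 2)

/-- The condition on the one-jet under which the torsion is a smooth function of the two-jet. -/
def IsRegular (F : E6 → Fin 4 → ℂ) (x : E6) : Prop :=
  IsElliptic (curvature F x) ∧ beltramiCurvature F x 1 2 ≠ 0

section Parameters

variable {S : Type*} [NormedAddCommGroup S] [NormedSpace ℝ S]

section Derivatives

variable {V W : Type*} [NormedAddCommGroup V] [NormedSpace ℝ V] [NormedAddCommGroup W]
  [NormedSpace ℝ W]

lemma contDiffAt_partial_fderiv {f : S × V → W} {z : S × V} (hf : ContDiffAt ℝ ∞ f z) :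
    ContDiffAt ℝ ∞ (fun z : S × V => fderiv ℝ (fun y => f (z.1, y)) z.2) z := by
  have huncurry :
      ContDiffAt ℝ ∞ (Function.uncurry fun (z : S × V) (y : V) => f (z.1, y)) (z, z.2) :=
    ContDiffAt.comp (g := f) (f := fun w : (S × V) × V => (w.1.1, w.2)) (z, z.2) hf (by fun_prop)
  exact huncurry.fderiv contDiffAt_snd (by simp)

lemma contDiffAt_iteratedDeriv_param {g : S × ℝ → W} {z : S × ℝ} (hg : ContDiffAt ℝ ∞ g z)
    (k : ℕ) :
    ContDiffAt ℝ ∞ (fun z : S × ℝ => iteratedDeriv k (fun t => g (z.1, t)) z.2) z := by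
  induction k with
  | zero => simpa using hg
  | succ k ih =>
    simp only [iteratedDeriv_succ]
    exact (contDiffAt_partial_fderiv ih).clm_apply contDiffAt_const

end Derivatives

lemma contDiff_horizontalLift (i : Fin 4) :
    ContDiff ℝ ∞ fun f : Fin 4 → ℂ => horizontalLift f i :=
  contDiff_const.add (vertical.contDiff.comp (contDiff_apply ℝ ℂ i))

variable {F : S × E6 → Fin 4 → ℂ} {z : S × E6}

lemma contDiffAt_curvature (hF : ContDiffAt ℝ ∞ F z) :
    ContDiffAt ℝ ∞ (fun z : S × E6 => curvature (fun y => F (z.1, y)) z.2) z := by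
  have hlift (k l : Fin 4) : ContDiffAt ℝ ∞
      (fun z : S × E6 => fderiv ℝ (fun y => F (z.1, y)) z.2 (horizontalLift (F z) k) l) z :=
    contDiffAt_pi.1 ((contDiffAt_partial_fderiv hF).clm_apply
      ((contDiff_horizontalLift k).contDiffAt.comp z hF)) l
  exact contDiffAt_pi.2 fun i => contDiffAt_pi.2 fun j => (hlift i j).sub (hlift j i)

lemma contDiffAt_beltramiOf (hF : ContDiffAt ℝ ∞ F z)
    (h : IsElliptic (curvature (fun y => F (z.1, y)) z.2)) :
    ContDiffAt ℝ ∞ (fun z : S × E6 => beltramiOf (fun y => F (z.1, y)) z.2) z :=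
  h.contDiffAt_beltrami.comp z (contDiffAt_curvature hF)

lemma contDiffAt_beltramiCurvature (hF : ContDiffAt ℝ ∞ F z)
    (h : IsElliptic (curvature (fun y => F (z.1, y)) z.2)) :
    ContDiffAt ℝ ∞ (fun z : S × E6 => beltramiCurvature (fun y => F (z.1, y)) z.2) z := by
  refine contDiffAt_pi.2 fun i => contDiffAt_pi.2 fun j => ?_
  have hij := contDiffAt_pi.1 (contDiffAt_pi.1 (contDiffAt_curvature hF) i) j
  exact hij.add ((contDiffAt_beltramiOf hF h).mul (contDiff_conj.contDiffAt.comp z hij))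

lemma contDiffAt_obstruction (hF : ContDiffAt ℝ ∞ F z)
    (h : IsElliptic (curvature (fun y => F (z.1, y)) z.2)) :
    ContDiffAt ℝ ∞ (fun z : S × E6 =>
      obstruction (fun y => F (z.1, y)) (beltramiOf fun y => F (z.1, y)) z.2) z := by
  have hμ := contDiffAt_beltramiOf hF h
  have hdF (e : E6) (i : Fin 4) : ContDiffAt ℝ ∞
      (fun z : S × E6 => fderiv ℝ (fun y => F (z.1, y)) z.2 e i) z :=
    contDiffAt_pi.1 ((contDiffAt_partial_fderiv hF).clm_apply contDiffAt_const) i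
  have hdF_conj (e : E6) (i : Fin 4) := contDiff_conj.contDiffAt.comp z (hdF e i)
  have hdμ (i : Fin 4) : ContDiffAt ℝ ∞ (fun z : S × E6 =>
      fderiv ℝ (fun x => beltramiOf (fun y => F (z.1, y)) x) z.2 (horizontalLift (F z) i)) z :=
    (contDiffAt_partial_fderiv hμ).clm_apply ((contDiff_horizontalLift i).contDiffAt.comp z hF)
  have hker := contDiffAt_pi.1
    (contDiff_kernelVector.contDiffAt.comp z (contDiffAt_beltramiCurvature hF h))
  refine ContDiffAt.sum fun i _ => (hker i).mul ?_
  exact ((contDiffAt_const.mul (hdμ i)).add ((contDiffAt_const.sub hμ).mul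
    ((hdF _ i).add (hμ.mul (hdF_conj _ i))))).add
    ((contDiffAt_const.mul (contDiffAt_const.add hμ)).mul ((hdF _ i).add (hμ.mul (hdF_conj _ i))))

lemma contDiffAt_torsion (hF : ContDiffAt ℝ ∞ F z) (h : IsRegular (fun y => F (z.1, y)) z.2) :
    ContDiffAt ℝ ∞ (fun z : S × E6 => torsion (fun y => F (z.1, y)) z.2) z :=
  contDiffAt_div (contDiffAt_obstruction hF h.1)
    (contDiffAt_const.mul
      (contDiffAt_pi.1 (contDiffAt_pi.1 (contDiffAt_beltramiCurvature hF h.1) 1) 2))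
    (mul_ne_zero (by norm_num) h.2)

lemma eventually_isRegular (hF : ContDiffAt ℝ ∞ F z) (h : IsRegular (fun y => F (z.1, y)) z.2) :
    ∀ᶠ z in 𝓝 z, IsRegular (fun y => F (z.1, y)) z.2 :=
  ((contDiffAt_curvature hF).continuousAt.eventually (isOpen_setOf_isElliptic.mem_nhds h.1)).and
    ((contDiffAt_pi.1 (contDiffAt_pi.1
      (contDiffAt_beltramiCurvature hF h.1) 1) 2).continuousAt.eventually_ne h.2)

end Parameters

lemma eventually_isElliptic_curvature {F : E6 → Fin 4 → ℂ} {x : E6} (hF : ContDiffAt ℝ ∞ F x)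
    (h : IsElliptic (curvature F x)) : ∀ᶠ y in 𝓝 x, IsElliptic (curvature F y) := by
  have hcurv : ContDiffAt ℝ ∞ (fun z : ℝ × E6 => curvature F z.2) (0, x) :=
    contDiffAt_curvature (F := fun z : ℝ × E6 => F z.2) (hF.comp (0, x) contDiffAt_snd)
  exact ((Continuous.prodMk_right (0 : ℝ)).tendsto x).eventually
    (hcurv.continuousAt.eventually (isOpen_setOf_isElliptic.mem_nhds h))

/-! ### An invariant of germs vanishing on complex-contact germs -/

section Congr

variable {F F' : E6 → Fin 4 → ℂ} {x : E6}

lemma curvature_congr (h : F =ᶠ[𝓝 x] F') : curvature F x = curvature F' x := by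
  ext i j
  simp only [curvature, h.fderiv_eq, h.self_of_nhds]

lemma beltramiOf_congr (h : F =ᶠ[𝓝 x] F') : beltramiOf F =ᶠ[𝓝 x] beltramiOf F' :=
  h.eventuallyEq_nhds.mono fun y hy => by simp only [beltramiOf, curvature_congr hy]

lemma beltramiCurvature_congr (h : F =ᶠ[𝓝 x] F') :
    beltramiCurvature F x = beltramiCurvature F' x := by
  ext i j
  simp only [beltramiCurvature, twistedCurvature, beltramiOf, curvature_congr h]

lemma obstruction_congr {μ μ' : E6 → ℂ} (h : F =ᶠ[𝓝 x] F') (hμ : μ =ᶠ[𝓝 x] μ') :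
    obstruction F μ x = obstruction F' μ' x := by
  have htwisted : twistedCurvature F (μ x) x = twistedCurvature F' (μ' x) x := by
    ext i j
    simp only [twistedCurvature, curvature_congr h, hμ.self_of_nhds]
  rw [obstruction, obstruction, htwisted]
  simp only [h.fderiv_eq, hμ.fderiv_eq, h.self_of_nhds, hμ.self_of_nhds]

lemma torsion_congr (h : F =ᶠ[𝓝 x] F') : torsion F x = torsion F' x := by
  rw [torsion, torsion, obstruction_congr h (beltramiOf_congr h), beltramiCurvature_congr h]

lemma isRegular_congr (h : F =ᶠ[𝓝 x] F') : IsRegular F x ↔ IsRegular F' x := by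
  simp only [IsRegular, curvature_congr h, beltramiCurvature_congr h]

end Congr

/-- The real parts of the first `n` derivatives at the origin of the torsion along the first
coordinate axis. -/
noncomputable def torsionJet (n : ℕ) (F : E6 → Fin 4 → ℂ) : EuclideanSpace ℝ (Fin n) :=
  WithLp.toLp 2 fun k => (iteratedDeriv k (fun t : ℝ => torsion F (t • stdBasis 0)) 0).re

lemma tendsto_smul_stdBasis (k : Fin 6) : Tendsto (fun t : ℝ => t • stdBasis k) (𝓝 0) (𝓝 0) :=
  Continuous.tendsto' (by fun_prop) _ _ (zero_smul ℝ _)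

lemma torsionJet_congr {n : ℕ} {F F' : E6 → Fin 4 → ℂ} (h : F =ᶠ[𝓝 0] F') :
    torsionJet n F = torsionJet n F' := by
  have htorsion : (fun t : ℝ => torsion F (t • stdBasis 0)) =ᶠ[𝓝 0]
      fun t : ℝ => torsion F' (t • stdBasis 0) :=
    (tendsto_smul_stdBasis 0).eventually (h.eventuallyEq_nhds.mono fun y hy => torsion_congr hy)
  simp only [torsionJet, htorsion.iteratedDeriv_eq]

lemma torsionJet_eq_zero {n : ℕ} {F : E6 → Fin 4 → ℂ} (h : ∀ᶠ x in 𝓝 0, torsion F x = 0) :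
    torsionJet n F = 0 := by
  have hzero : (fun t : ℝ => torsion F (t • stdBasis 0)) =ᶠ[𝓝 0] fun _ => 0 :=
    (tendsto_smul_stdBasis 0).eventually h
  ext k
  simp [torsionJet, hzero.iteratedDeriv_eq]

lemma graphForm_ker_injective {f g : Fin 4 → ℂ}
    (h : ∀ v, graphForm f v = 0 ↔ graphForm g v = 0) : f = g := by
  ext i
  have hlift : horizontalLift f i = horizontalLift g i + vertical (f i - g i) := by
    rw [horizontalLift, horizontalLift, map_sub]
    abel
  have hg := (h _).1 (graphForm_horizontalLift f i)
  rwa [hlift, map_add, graphForm_horizontalLift, graphForm_vertical, zero_add, sub_eq_zero] at hg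

open Classical in
/-- The coefficients of a field of subspaces as a graph, with value `0` at the points where it is
not a graph. -/
noncomputable def graphCoef (D : E6 → Submodule ℝ E6) (x : E6) : Fin 4 → ℂ :=
  if h : ∃ f, ∀ v, v ∈ D x ↔ graphForm f v = 0 then h.choose else 0

/-- The condition on a germ of distributions at the origin to be a graph with regular
coefficients. -/
def IsRegularGerm (D : E6 → Submodule ℝ E6) : Prop :=
  (∃ f, ∀ v, v ∈ D 0 ↔ graphForm f v = 0) ∧ IsRegular (graphCoef D) 0

open Classical in
/-- The invariant of germs of distributions at the origin that detects the failure to be a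
complex-contact germ: the jet of the torsion, extended by zero to the germs that are not regular. -/
noncomputable def germInvariant (n : ℕ) (D : E6 → Submodule ℝ E6) : EuclideanSpace ℝ (Fin n) :=
  if IsRegularGerm D then torsionJet n (graphCoef D) else 0

section GraphCoef

variable {D D' : E6 → Submodule ℝ E6}

lemma graphCoef_eq {x : E6} {f : Fin 4 → ℂ} (h : ∀ v, v ∈ D x ↔ graphForm f v = 0) :
    graphCoef D x = f := by
  have hex : ∃ f, ∀ v, v ∈ D x ↔ graphForm f v = 0 := ⟨f, h⟩
  rw [graphCoef, dif_pos hex]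
  exact graphForm_ker_injective fun v => by rw [← hex.choose_spec v, h]

lemma graphCoef_congr (h : D =ᶠ[𝓝 0] D') : graphCoef D =ᶠ[𝓝 0] graphCoef D' :=
  h.mono fun x hx => by rw [graphCoef, graphCoef, hx]

lemma isRegularGerm_congr (h : D =ᶠ[𝓝 0] D') : IsRegularGerm D ↔ IsRegularGerm D' := by
  simp only [IsRegularGerm, h.self_of_nhds, isRegular_congr (graphCoef_congr h)]

lemma germInvariant_congr {n : ℕ} (h : D =ᶠ[𝓝 0] D') : germInvariant n D = germInvariant n D' := by
  by_cases hD : IsRegularGerm D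
  · rw [germInvariant, germInvariant, if_pos hD, if_pos ((isRegularGerm_congr h).1 hD),
      torsionJet_congr (graphCoef_congr h)]
  · rw [germInvariant, germInvariant, if_neg hD, if_neg (mt (isRegularGerm_congr h).2 hD)]

lemma germInvariant_eq_torsionJet {n : ℕ} {F : E6 → Fin 4 → ℂ}
    (h : ∀ᶠ x in 𝓝 0, ∀ v, v ∈ D x ↔ graphForm (F x) v = 0) (hF : IsRegular F 0) :
    germInvariant n D = torsionJet n F := by
  have hcoef : graphCoef D =ᶠ[𝓝 0] F := h.mono fun x hx => graphCoef_eq hx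
  rw [germInvariant, if_pos ⟨⟨_, h.self_of_nhds⟩, (isRegular_congr hcoef).2 hF⟩,
    torsionJet_congr hcoef]

end GraphCoef

lemma SupportsComplexContact.eventually_torsion_eq_zero {D : E6 → Submodule ℝ E6} {p : E6}
    {F : E6 → Fin 4 → ℂ} (hD : SupportsComplexContact D p) (hF : SmoothNear F p)
    (hgraph : ∀ᶠ x in 𝓝 p, ∀ v, v ∈ D x ↔ graphForm (F x) v = 0)
    (hell : IsElliptic (curvature F p)) : ∀ᶠ x in 𝓝 p, torsion F x = 0 := by
  obtain ⟨μ, hμ, hμp, hμF⟩ := hD.exists_beltrami hF hgraph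
  have hlt : ‖μ p‖ < 1 := by
    rw [hell.eq_beltrami hμp hμF.self_of_nhds.1]
    exact hell.norm_beltrami_lt
  have hμ_eq : μ =ᶠ[𝓝 p] beltramiOf F := by
    filter_upwards [eventually_isElliptic_curvature hF.contDiffAt hell,
      hμ.continuousAt.norm.eventually_lt_const hlt, hμF] with x hellx hltx hμx
    exact hellx.eq_beltrami hltx.le hμx.1
  filter_upwards [hμF, hμ_eq.eventuallyEq_nhds] with x hμx hμ_eqx
  rw [torsion, ← obstruction_congr .rfl hμ_eqx, hμx.2, zero_div]

lemma SupportsComplexContact.germInvariant_eq_zero {D : E6 → Submodule ℝ E6}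
    (hD : SupportsComplexContact D 0) (n : ℕ) : germInvariant n D = 0 := by
  by_cases hreg : IsRegularGerm D
  swap
  · simp [germInvariant, hreg]
  obtain ⟨Θ, hΘ, hΘD⟩ := hD.exists_isContactJet
  obtain ⟨f, hf⟩ := hreg.1
  obtain ⟨F, hF, hFΘ⟩ := exists_smooth_graph hΘ ⟨f, fun v => by rw [← hΘD.self_of_nhds.1, hf]⟩
  have hgraph : ∀ᶠ x in 𝓝 0, ∀ v, v ∈ D x ↔ graphForm (F x) v = 0 := by
    filter_upwards [hΘD, hFΘ] with x hΘx hFx v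
    rw [hΘx.1, hFx]
  have hregF : IsRegular F 0 :=
    (isRegular_congr (hgraph.mono fun x hx => graphCoef_eq hx)).1 hreg.2
  rw [germInvariant_eq_torsionJet hgraph hregF,
    torsionJet_eq_zero (hD.eventually_torsion_eq_zero hF hgraph hregF.1)]

section Families

variable {S : Type*} [NormedAddCommGroup S] [NormedSpace ℝ S]

lemma contDiffAt_torsionJet {F : S × E6 → Fin 4 → ℂ} {s : S} (hF : ContDiffAt ℝ ∞ F (s, 0))
    (h : IsRegular (fun x => F (s, x)) 0) (n : ℕ) :
    ContDiffAt ℝ ∞ (fun s => torsionJet n fun x => F (s, x)) s := by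
  have hline : ContDiffAt ℝ ∞
      (fun z : S × ℝ => torsion (fun y => F (z.1, y)) (z.2 • stdBasis 0)) (s, 0) := by
    refine ContDiffAt.comp (g := fun z : S × E6 => torsion (fun y => F (z.1, y)) z.2)
      (f := fun z : S × ℝ => (z.1, z.2 • stdBasis 0)) (s, 0) ?_ (by fun_prop)
    rw [zero_smul]
    exact contDiffAt_torsion hF h
  refine contDiffAt_euclidean.2 fun k => Complex.reCLM.contDiff.contDiffAt.comp s ?_
  exact ContDiffAt.comp (f := fun s : S => (s, (0 : ℝ))) s (contDiffAt_iteratedDeriv_param hline k)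
    (by fun_prop)

lemma smoothNear_germInvariant {D : S → E6 → Submodule ℝ E6} {θ : S × E6 → E6 →L[ℝ] ℂ}
    (hθ : SmoothNear θ (0, 0))
    (hD : ∀ᶠ z in 𝓝 ((0 : S), (0 : E6)), ∀ v, v ∈ D z.1 z.2 ↔ θ z v = 0)
    (hreg : IsRegularGerm (D 0)) (n : ℕ) : SmoothNear (fun s => germInvariant n (D s)) 0 := by
  obtain ⟨f, hf⟩ := hreg.1
  obtain ⟨F, hF, hFθ⟩ := exists_smooth_graph hθ ⟨f, fun v => by rw [← hf, ← hD.self_of_nhds v]⟩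
  have hgraph : ∀ᶠ s in 𝓝 (0 : S), ∀ᶠ x in 𝓝 (0 : E6),
      ∀ v, v ∈ D s x ↔ graphForm (F (s, x)) v = 0 := by
    have hprod : ∀ᶠ z in 𝓝 ((0 : S), (0 : E6)), ∀ v, v ∈ D z.1 z.2 ↔ graphForm (F z) v = 0 := by
      filter_upwards [hD, hFθ] with z hDz hFz v
      rw [hDz, hFz]
    rw [nhds_prod_eq] at hprod
    exact hprod.curry
  have hreg0 : IsRegular (fun x => F ((0 : S), x)) 0 :=
    (isRegular_congr (hgraph.self_of_nhds.mono fun x hx => graphCoef_eq hx)).1 hreg.2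
  have hslice : Tendsto (fun s : S => (s, (0 : E6))) (𝓝 0) (𝓝 (0, 0)) :=
    Continuous.tendsto' (by fun_prop) _ _ rfl
  have hregs : ∀ᶠ s in 𝓝 (0 : S), IsRegular (fun x => F (s, x)) 0 :=
    hslice.eventually (eventually_isRegular (z := ((0 : S), (0 : E6))) hF.contDiffAt hreg0)
  refine SmoothNear.congr (f := fun s => torsionJet n fun x => F (s, x)) ?_ ?_
  · filter_upwards [hslice.eventually hF, hregs] with s hFs hregs
    exact contDiffAt_torsionJet hFs hregs n
  · filter_upwards [hgraph, hregs] with s hgraphs hregs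
    exact germInvariant_eq_torsionJet hgraphs hregs

end Families

/-! ### Fatness and Reeb directions of graphs -/

section Elliptic

variable {c : Fin 4 → Fin 4 → ℂ}

lemma IsElliptic.const_mul (h : IsElliptic c) {w : ℂ} (hw : w ≠ 0) :
    IsElliptic fun i j => w * c i j := by
  have hpf : pfaffian (fun i j => w * c i j) = w ^ 2 * pfaffian c := by
    simp only [pfaffian]
    ring
  have hmixed : mixedPfaffian (fun i j => w * c i j) = Complex.normSq w * mixedPfaffian c := by
    rw [mixedPfaffian, mixedPfaffian, mul_left_comm, ← Complex.re_ofReal_mul (Complex.normSq w),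
      ← Complex.mul_conj]
    simp only [map_mul]
    ring_nf
  have hnormSq := Complex.normSq_pos.2 hw
  refine ⟨by rw [hmixed]; exact mul_pos hnormSq h.1, ?_⟩
  rw [hpf, hmixed, map_mul, map_pow, mul_pow, mul_left_comm]
  exact mul_lt_mul_of_pos_left h.2 (pow_pos hnormSq 2)

lemma wedgeSq_eq_re_pfaffian_add {V : Type*} {η : V → V → ℝ} {v : Fin 4 → V}
    (h : ∀ i j, η (v i) (v j) = (c i j).re) :
    wedgeSq η v = (pfaffian c).re + mixedPfaffian c / 2 := by
  simp only [wedgeSq, h, pfaffian, mixedPfaffian, Complex.add_re, Complex.sub_re, Complex.mul_re,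
    Complex.conj_re, Complex.conj_im]
  ring

lemma IsElliptic.wedgeSq_pos (hc : IsElliptic c) {V : Type*} {η : V → V → ℝ} {v : Fin 4 → V}
    (h : ∀ i j, η (v i) (v j) = (c i j).re) : 0 < wedgeSq η v := by
  rw [wedgeSq_eq_re_pfaffian_add h]
  linarith [hc.two_mul_norm_pfaffian_lt, neg_le_of_abs_le (Complex.abs_re_le_norm (pfaffian c))]

end Elliptic

lemma contDiff_graphForm : ContDiff ℝ ∞ graphForm :=
  contDiff_const.sub <| ContDiff.sum fun i _ => (contDiff_apply ℝ ℂ i).smul contDiff_const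

/-- The real and imaginary parts of the form that defines a graph distribution. -/
noncomputable def graphForms (F : E6 → Fin 4 → ℂ) : Fin 2 → E6 → E6 →L[ℝ] ℝ :=
  ![fun x => Complex.reCLM.comp (graphForm (F x)), fun x => Complex.imCLM.comp (graphForm (F x))]

lemma graphForms_zero_apply (F : E6 → Fin 4 → ℂ) (x v : E6) :
    graphForms F 0 x v = (graphForm (F x) v).re := rfl

lemma graphForms_one_apply (F : E6 → Fin 4 → ℂ) (x v : E6) :
    graphForms F 1 x v = (graphForm (F x) v).im := rfl

lemma isDefinedBy_graphForms {D : E6 → Submodule ℝ E6} {F : E6 → Fin 4 → ℂ} {p : E6}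
    (hF : SmoothNear F p) (hD : ∀ᶠ x in 𝓝 p, ∀ v, v ∈ D x ↔ graphForm (F x) v = 0) :
    IsDefinedBy D (graphForms F) p := by
  have hsmooth (g : ℂ →L[ℝ] ℝ) : SmoothNear (fun x => g.comp (graphForm (F x))) p :=
    hF.mono fun x hx => (ContinuousLinearMap.compL ℝ E6 ℂ ℝ g).contDiff.contDiffAt.comp x
      (contDiff_graphForm.contDiffAt.comp x hx)
  refine ⟨Fin.forall_fin_two.2 ⟨hsmooth _, hsmooth _⟩, ?_, ?_⟩
  · have hpair : (fun i => graphForms F i p) = ![graphForms F 0 p, graphForms F 1 p] :=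
      List.ofFn_inj.mp rfl
    rw [hpair, LinearIndependent.pair_iff]
    intro s t hst
    have hvertical (a : ℂ) : s * a.re + t * a.im = 0 := by
      simpa [graphForms_zero_apply, graphForms_one_apply, graphForm_vertical]
        using DFunLike.congr_fun hst (vertical a)
    simpa using And.intro (hvertical 1) (hvertical Complex.I)
  · filter_upwards [hD] with x hx v
    rw [hx, Complex.ext_iff, Fin.forall_fin_two]
    rfl

section ExteriorDerivative

variable {F : E6 → Fin 4 → ℂ} {x : E6}

lemma extD_comp_graphForm (g : ℂ →L[ℝ] ℝ) (hF : DifferentiableAt ℝ F x) (u v : E6) :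
    extD (fun x => g.comp (graphForm (F x))) x u v =
      g (-∑ i, (fderiv ℝ F x u i * v (baseIndex i) - fderiv ℝ F x v i * u (baseIndex i))) := by
  have hsum := HasFDerivAt.fun_sum (u := Finset.univ) fun i _ =>
    (hasFDerivAt_pi'.1 hF.hasFDerivAt i).smul_const
      (Complex.ofRealCLM.comp (dcoord (baseIndex i)))
  have hcomp : HasFDerivAt (fun x => g.comp (graphForm (F x))) _ x :=
    (ContinuousLinearMap.compL ℝ E6 ℂ ℝ g).hasFDerivAt.comp x (hsum.const_sub (complexCoord 4 5))
  rw [extD, hcomp.fderiv, Finset.sum_sub_distrib, neg_sub', sub_neg_eq_add, map_add, map_neg]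
  simp [dcoord, sub_eq_add_neg, mul_comm]

lemma horizontalLift_baseIndex (f : Fin 4 → ℂ) (i j : Fin 4) :
    horizontalLift f i (baseIndex j) = if i = j then 1 else 0 := by
  fin_cases i <;> fin_cases j <;> simp [horizontalLift, vertical_apply, baseIndex]

lemma extD_comp_graphForm_horizontalLift (g : ℂ →L[ℝ] ℝ) (hF : DifferentiableAt ℝ F x)
    (i j : Fin 4) :
    extD (fun x => g.comp (graphForm (F x))) x (horizontalLift (F x) i) (horizontalLift (F x) j)
      = g (-curvature F x i j) := by
  rw [extD_comp_graphForm g hF]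
  simp [horizontalLift_baseIndex, curvature, Finset.sum_sub_distrib, apply_ite Complex.ofReal,
    -map_sub, -map_neg]

lemma extD_comp_graphForm_vertical (g : ℂ →L[ℝ] ℝ) (hF : DifferentiableAt ℝ F x) {a : ℂ}
    (ha : fderiv ℝ F x (vertical a) = 0) (v : E6) :
    extD (fun x => g.comp (graphForm (F x))) x (vertical a) v = 0 := by
  have hbase (i : Fin 4) : vertical a (baseIndex i) = 0 := by
    fin_cases i <;> simp [vertical_apply, baseIndex]
  simp [extD_comp_graphForm g hF, ha, hbase]

end ExteriorDerivative

section Graph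

variable {D : E6 → Submodule ℝ E6} {F : E6 → Fin 4 → ℂ} {p : E6}

lemma isFat_of_isElliptic (hF : SmoothNear F p)
    (hD : ∀ᶠ x in 𝓝 p, ∀ v, v ∈ D x ↔ graphForm (F x) v = 0)
    (hell : ∀ᶠ x in 𝓝 p, IsElliptic (curvature F x)) : IsFat D p := by
  refine ⟨graphForms F, isDefinedBy_graphForms hF hD, ?_⟩
  filter_upwards [hF, hD, hell] with x hFx hDx hellx
  refine ⟨horizontalLift (F x), fun i => (hDx _).2 (graphForm_horizontalLift _ _),
    fun a b hab => ?_⟩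
  have hdiff : DifferentiableAt ℝ F x := hFx.differentiableAt (by simp)
  have hw : (⟨-a, b⟩ : ℂ) ≠ 0 := fun h => hab <|
    Prod.ext (neg_eq_zero.1 (congrArg Complex.re h)) (congrArg Complex.im h)
  -- `a Re θ + b Im θ` is the real part of `(a - √-1 b) θ`.
  refine (hellx.const_mul hw).wedgeSq_pos fun i j => ?_
  have hre := extD_comp_graphForm_horizontalLift Complex.reCLM hdiff i j
  have him := extD_comp_graphForm_horizontalLift Complex.imCLM hdiff i j
  change a * extD (fun x => Complex.reCLM.comp (graphForm (F x))) x _ _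
    + b * extD (fun x => Complex.imCLM.comp (graphForm (F x))) x _ _ = _
  rw [hre, him, Complex.mul_re]
  simp only [Complex.reCLM_apply, Complex.imCLM_apply, Complex.neg_re, Complex.neg_im]
  ring

lemma isCompl_span_vertical {K : Submodule ℝ E6} {f : Fin 4 → ℂ}
    (hK : ∀ v, v ∈ K ↔ graphForm f v = 0) :
    IsCompl K (LinearMap.range (vertical : ℂ →ₗ[ℝ] E6)) := by
  refine ⟨Submodule.disjoint_def.2 ?_, codisjoint_iff.2 (Submodule.eq_top_iff'.2 fun v => ?_)⟩
  · rintro _ hv ⟨a, rfl⟩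
    have ha : a = 0 := by rw [← graphForm_vertical f a]; exact (hK _).1 hv
    rw [ha, map_zero]
  · refine Submodule.mem_sup.2 ⟨v - vertical (graphForm f v), ?_, _, ⟨graphForm f v, rfl⟩,
      sub_add_cancel _ _⟩
    rw [hK, map_sub, graphForm_vertical, sub_self]

lemma dz_zero : dz 0 = fun _ => vertical 1 := by
  simp [vertical_apply, dz, stdBasis]

lemma dz_one : dz 1 = fun _ => vertical Complex.I := by
  simp [vertical_apply, dz, stdBasis]

lemma span_range_dz (x : E6) :
    Submodule.span ℝ (range fun i => dz i x) = LinearMap.range (vertical : ℂ →ₗ[ℝ] E6) := by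
  refine le_antisymm (Submodule.span_le.2 <| range_subset_iff.2 <| Fin.forall_fin_two.2
    ⟨⟨1, (congrFun dz_zero x).symm⟩, Complex.I, (congrFun dz_one x).symm⟩) ?_
  rintro _ ⟨a, rfl⟩
  have ha : vertical a = a.re • dz 0 x + a.im • dz 1 x := rfl
  exact ha ▸ add_mem (Submodule.smul_mem _ _ (Submodule.subset_span ⟨0, rfl⟩))
    (Submodule.smul_mem _ _ (Submodule.subset_span ⟨1, rfl⟩))

lemma areReebDirections_dz (hF : SmoothNear F p)
    (hD : ∀ᶠ x in 𝓝 p, ∀ v, v ∈ D x ↔ graphForm (F x) v = 0)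
    (hinv : ∀ᶠ x in 𝓝 p, ∀ a, fderiv ℝ F x (vertical a) = 0) : AreReebDirections D dz p := by
  have hsmooth (v : E6) : SmoothNear (fun _ : E6 => v) p := .of_contDiff contDiff_const p
  refine ⟨Fin.forall_fin_two.2 ⟨hsmooth _, hsmooth _⟩, graphForms F,
    isDefinedBy_graphForms hF hD, ?_⟩
  filter_upwards [hF, hD, hinv] with x hFx hDx hinvx
  have hdiff : DifferentiableAt ℝ F x := hFx.differentiableAt (by simp)
  refine ⟨?_, ?_, ?_, ?_⟩
  · rw [span_range_dz]
    exact isCompl_span_vertical hDx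
  · simp [Fin.forall_fin_two, graphForms_zero_apply, graphForms_one_apply, dz_zero, dz_one,
      graphForm_vertical]
  · have hvanish (g : ℂ →L[ℝ] ℝ) (a : ℂ) (v : E6) :
        extD (fun x => g.comp (graphForm (F x))) x (vertical a) v = 0 :=
      extD_comp_graphForm_vertical g hdiff (hinvx a) v
    simp only [Fin.forall_fin_two, dz_zero, dz_one]
    exact ⟨⟨fun v _ => hvanish _ _ v, fun v _ => hvanish _ _ v⟩,
      fun v _ => hvanish _ _ v, fun v _ => hvanish _ _ v⟩
  · simp [VectorField.lieBracket_eq, dz_zero, dz_one]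

end Graph

/-! ### The family `H κ` -/

/-- The coefficients of `H κ` as a graph. -/
noncomputable def coefH (κ : ℝ → ℝ) (x : E6) : Fin 4 → ℂ :=
  ![x 2 + Complex.I * x 3, x 3 + Complex.I * x 2,
    (((x 1) ^ 3 / 3 + x 1 + 2 * x 0 + κ (x 2) : ℝ) : ℂ), 0]

lemma mem_H_iff (κ : ℝ → ℝ) (x v : E6) : v ∈ H κ x ↔ graphForm (coefH κ x) v = 0 := by
  have hmem : v ∈ H κ x ↔ alpha1 κ x v = 0 ∧ alpha2 x v = 0 := Iff.rfl
  have hre : alpha1 κ x v = (graphForm (coefH κ x) v).re := by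
    simp [graphForm_apply, alpha1, dcoord, Fin.sum_univ_four, baseIndex, coefH,
      -Complex.ofReal_pow]
    ring
  have him : alpha2 x v = (graphForm (coefH κ x) v).im := by
    simp [graphForm_apply, alpha2, dcoord, Fin.sum_univ_four, baseIndex, coefH,
      -Complex.ofReal_pow]
    ring
  rw [hmem, hre, him, Complex.ext_iff, Complex.zero_re, Complex.zero_im]

/-- The projection to a coordinate, as a complex-valued form. -/
noncomputable def complexDcoord (k : Fin 6) : E6 →L[ℝ] ℂ := Complex.ofRealCLM.comp (dcoord k)

lemma complexDcoord_apply (k : Fin 6) (x : E6) : complexDcoord k x = x k := rfl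

lemma horizontalLift_apply_zero (f : Fin 4 → ℂ) (i : Fin 4) :
    horizontalLift f i 0 = if i = 0 then 1 else 0 :=
  horizontalLift_baseIndex f i 0

lemma horizontalLift_apply_one (f : Fin 4 → ℂ) (i : Fin 4) :
    horizontalLift f i 1 = if i = 1 then 1 else 0 :=
  horizontalLift_baseIndex f i 1

lemma horizontalLift_apply_two (f : Fin 4 → ℂ) (i : Fin 4) :
    horizontalLift f i 2 = if i = 2 then 1 else 0 :=
  horizontalLift_baseIndex f i 2

lemma horizontalLift_apply_three (f : Fin 4 → ℂ) (i : Fin 4) :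
    horizontalLift f i 3 = if i = 3 then 1 else 0 :=
  horizontalLift_baseIndex f i 3

lemma obstruction_eq_of_fderiv_vertical {F : E6 → Fin 4 → ℂ} {μ : E6 → ℂ} {x : E6}
    (hF : ∀ a, fderiv ℝ F x (vertical a) = 0) :
    obstruction F μ x = 2 * ∑ i, kernelVector (twistedCurvature F (μ x) x) i *
      fderiv ℝ μ x (horizontalLift (F x) i) := by
  have h4 : fderiv ℝ F x (stdBasis 4) = 0 := by simpa [vertical_apply] using hF 1
  have h5 : fderiv ℝ F x (stdBasis 5) = 0 := by simpa [vertical_apply] using hF Complex.I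
  simp [obstruction, h4, h5, Finset.mul_sum, mul_left_comm]

lemma fderiv_mul_eq_of_quadratic {μ : E6 → ℂ} {x : E6} (hμ : DifferentiableAt ℝ μ x)
    (hquad : ∀ᶠ y in 𝓝 x, 4 * μ y - Complex.I * ((y 1 : ℂ) ^ 2 + 1) * (1 - μ y ^ 2) = 0)
    (u : E6) : fderiv ℝ μ x u * (4 + 2 * Complex.I * ((x 1 : ℂ) ^ 2 + 1) * μ x) =
      2 * Complex.I * x 1 * u 1 * (1 - μ x ^ 2) := by
  have hcoord : HasFDerivAt (fun y : E6 => ((y 1 : ℝ) : ℂ)) (complexDcoord 1) x :=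
    (complexDcoord 1).hasFDerivAt
  have hderiv := (hμ.hasFDerivAt.const_mul 4).sub
    ((((hcoord.pow 2).add_const 1).const_mul Complex.I).mul ((hμ.hasFDerivAt.pow 2).const_sub 1))
  have hconst : HasFDerivAt (fun y => 4 * μ y - Complex.I * ((y 1 : ℂ) ^ 2 + 1) * (1 - μ y ^ 2))
      (0 : E6 →L[ℝ] ℂ) x := (hasFDerivAt_const 0 x).congr_of_eventuallyEq hquad
  have hu := DFunLike.congr_fun (hderiv.unique hconst) u
  simp [complexDcoord_apply] at hu
  linear_combination hu

section CoefH

variable {κ : ℝ → ℝ}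

lemma contDiff_coefH (hκ : ContDiff ℝ ∞ κ) : ContDiff ℝ ∞ (coefH κ) := by
  have hcoord (k : Fin 6) : ContDiff ℝ ∞ (fun y : E6 => y k) := (dcoord k).contDiff
  have hcoordC (k : Fin 6) : ContDiff ℝ ∞ (fun y : E6 => ((y k : ℝ) : ℂ)) :=
    (complexDcoord k).contDiff
  rw [contDiff_pi]
  intro i
  fin_cases i
  · exact (hcoordC 2).add (contDiff_const.mul (hcoordC 3))
  · exact (hcoordC 3).add (contDiff_const.mul (hcoordC 2))
  · exact Complex.ofRealCLM.contDiff.comp ((((((hcoord 1).pow 3).div_const 3).add (hcoord 1)).add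
      (contDiff_const.mul (hcoord 0))).add (hκ.comp (hcoord 2)))
  · exact contDiff_const

lemma fderiv_coefH (hκ : ContDiff ℝ ∞ κ) (x u : E6) :
    fderiv ℝ (coefH κ) x u = ![u 2 + Complex.I * u 3, u 3 + Complex.I * u 2,
      ((x 1 : ℂ) ^ 2 + 1) * u 1 + 2 * u 0 + deriv κ (x 2) * u 2, 0] := by
  have hcoord (k : Fin 6) : HasFDerivAt (fun y : E6 => y k) (dcoord k) x := (dcoord k).hasFDerivAt
  have hcoordC (k : Fin 6) : HasFDerivAt (fun y : E6 => ((y k : ℝ) : ℂ)) (complexDcoord k) x :=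
    (complexDcoord k).hasFDerivAt
  have hκx : HasFDerivAt (fun y : E6 => κ (y 2)) (deriv κ (x 2) • dcoord 2) x :=
    (hκ.differentiable (by simp)).differentiableAt.hasDerivAt.comp_hasFDerivAt x (hcoord 2)
  have hreal := (((((hcoord 1).pow 3).mul_const 3⁻¹).add (hcoord 1)).add
    ((hcoord 0).const_mul 2)).add hκx
  have hcomponent (i : Fin 4) : fderiv ℝ (coefH κ) x u i = fderiv ℝ (fun y => coefH κ y i) x u :=
    ((hasFDerivAt_pi'.1 ((contDiff_coefH hκ).differentiable (by simp) x).hasFDerivAt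
      i).fderiv ▸ rfl)
  ext i
  rw [hcomponent]
  fin_cases i
  · exact DFunLike.congr_fun ((hcoordC 2).add ((hcoordC 3).const_mul Complex.I)).fderiv u
  · exact DFunLike.congr_fun ((hcoordC 3).add ((hcoordC 2).const_mul Complex.I)).fderiv u
  · refine (DFunLike.congr_fun (Complex.ofRealCLM.hasFDerivAt.comp x hreal).fderiv u).trans ?_
    simp [dcoord]
    ring
  · exact DFunLike.congr_fun (hasFDerivAt_const (0 : ℂ) x).fderiv u

lemma fderiv_coefH_vertical (hκ : ContDiff ℝ ∞ κ) (x : E6) (a : ℂ) :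
    fderiv ℝ (coefH κ) x (vertical a) = 0 := by
  rw [fderiv_coefH hκ]
  ext i
  fin_cases i <;> simp [vertical_apply]

lemma curvature_coefH (hκ : ContDiff ℝ ∞ κ) (x : E6) :
    curvature (coefH κ) x = ![![0, 0, 1, -Complex.I],
      ![0, 0, (x 1 : ℂ) ^ 2 + 1 - Complex.I, -1],
      ![-1, Complex.I - ((x 1 : ℂ) ^ 2 + 1), 0, 0], ![Complex.I, 1, 0, 0]] := by
  ext i j
  fin_cases i <;> fin_cases j <;>
    simp [curvature, fderiv_coefH hκ, horizontalLift_apply_zero, horizontalLift_apply_one,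
      horizontalLift_apply_two, horizontalLift_apply_three] <;>
    norm_num

lemma pfaffian_twistedCurvature_coefH (hκ : ContDiff ℝ ∞ κ) (x : E6) (m : ℂ) :
    pfaffian (twistedCurvature (coefH κ) m x) =
      4 * m - Complex.I * ((x 1 : ℂ) ^ 2 + 1) * (1 - m ^ 2) := by
  simp [pfaffian, twistedCurvature, curvature_coefH hκ]
  linear_combination (1 - m) ^ 2 * Complex.I_sq

lemma isElliptic_curvature_coefH (hκ : ContDiff ℝ ∞ κ) : IsElliptic (curvature (coefH κ) 0) := by
  simp [IsElliptic, mixedPfaffian, pfaffian, curvature_coefH hκ, Complex.normSq_apply]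
  norm_num

lemma isFat_H (hκ : ContDiff ℝ ∞ κ) : IsFat (H κ) 0 :=
  isFat_of_isElliptic (.of_contDiff (contDiff_coefH hκ) 0) (.of_forall fun x v => mem_H_iff κ x v)
    (eventually_isElliptic_curvature (contDiff_coefH hκ).contDiffAt (isElliptic_curvature_coefH hκ))

lemma areReebDirections_H (hκ : ContDiff ℝ ∞ κ) : AreReebDirections (H κ) dz 0 :=
  areReebDirections_dz (.of_contDiff (contDiff_coefH hκ) 0)
    (.of_forall fun x v => mem_H_iff κ x v) (.of_forall fun x a => fderiv_coefH_vertical hκ x a)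

lemma obstruction_coefH (hκ : ContDiff ℝ ∞ κ) (μ : E6 → ℂ) (x : E6) :
    obstruction (coefH κ) μ x =
      2 * (((x 1 : ℂ) ^ 2 + 1 - Complex.I + μ x * ((x 1 : ℂ) ^ 2 + 1 + Complex.I))
          * fderiv ℝ μ x (horizontalLift (coefH κ x) 0)
        - (1 + μ x) * fderiv ℝ μ x (horizontalLift (coefH κ x) 1)) := by
  rw [obstruction_eq_of_fderiv_vertical (fderiv_coefH_vertical hκ x)]
  simp [Fin.sum_univ_four, kernelVector, twistedCurvature, curvature_coefH hκ]
  ring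

lemma eq_zero_of_obstruction_coefH_eq_zero (hκ : ContDiff ℝ ∞ κ) {μ : E6 → ℂ} {x : E6}
    (hμ : DifferentiableAt ℝ μ x)
    (hpf : ∀ᶠ y in 𝓝 x, pfaffian (twistedCurvature (coefH κ) (μ y) y) = 0)
    (hobstruction : obstruction (coefH κ) μ x = 0) : x 1 = 0 := by
  simp only [pfaffian_twistedCurvature_coefH hκ] at hpf
  have hderiv := fderiv_mul_eq_of_quadratic hμ hpf
  set Q : ℂ := 4 + 2 * Complex.I * ((x 1 : ℂ) ^ 2 + 1) * μ x
  have hderiv0 : fderiv ℝ μ x (horizontalLift (coefH κ x) 0) * Q = 0 := by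
    simpa [horizontalLift_apply_one, -mul_eq_zero] using hderiv (horizontalLift (coefH κ x) 0)
  have hderiv1 : fderiv ℝ μ x (horizontalLift (coefH κ x) 1) * Q =
      2 * Complex.I * x 1 * (1 - μ x ^ 2) := by
    simpa [horizontalLift_apply_one] using hderiv (horizontalLift (coefH κ x) 1)
  rw [obstruction_coefH hκ] at hobstruction
  have hproduct : Complex.I * ((x 1 : ℂ) * ((1 + μ x) * (1 - μ x ^ 2))) = 0 := by
    linear_combination
      (((x 1 : ℂ) ^ 2 + 1 - Complex.I + μ x * ((x 1 : ℂ) ^ 2 + 1 + Complex.I)) * hderiv0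
        - (1 + μ x) * hderiv1
        - Q / 2 * hobstruction) / 2
  have hquad := hpf.self_of_nhds
  have hsq : 1 - μ x ^ 2 ≠ 0 := fun h => by
    rw [h, mul_zero, sub_zero, mul_eq_zero_iff_left (by norm_num)] at hquad
    simp [hquad] at h
  have hadd : 1 + μ x ≠ 0 := fun h => hsq (by linear_combination (1 - μ x) * h)
  simpa [Complex.I_ne_zero, hsq, hadd] using hproduct

lemma not_supportsComplexContact_H (hκ : ContDiff ℝ ∞ κ) : ¬ SupportsComplexContact (H κ) 0 := by
  intro hH
  obtain ⟨μ, hμ, -, hμH⟩ := hH.exists_beltrami (.of_contDiff (contDiff_coefH hκ) 0)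
    (.of_forall fun x v => mem_H_iff κ x v)
  have hzero : ∀ᶠ x : E6 in 𝓝 0, x 1 = 0 := by
    filter_upwards [hμ, hμH.eventually_nhds] with x hμx hμHx
    exact eq_zero_of_obstruction_coefH_eq_zero hκ (hμx.differentiableAt (by simp))
      (hμHx.mono fun y hy => hy.1) hμHx.self_of_nhds.2
  have haxis : ∀ᶠ t : ℝ in 𝓝[≠] 0, (t • stdBasis 1) 1 = 0 :=
    ((tendsto_smul_stdBasis 1).eventually hzero).filter_mono nhdsWithin_le_nhds
  obtain ⟨t, ht, ht0⟩ := (haxis.and self_mem_nhdsWithin).exists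
  exact ht0 (by simpa using ht)

end CoefH

lemma eventually_eq_of_H_eq {κ κ' : ℝ → ℝ} (h : ∀ᶠ x in 𝓝 (0 : E6), H κ x = H κ' x) :
    ∀ᶠ t in 𝓝 (0 : ℝ), κ t = κ' t := by
  filter_upwards [(tendsto_smul_stdBasis 2).eventually h] with t ht
  have hcoef : coefH κ (t • stdBasis 2) = coefH κ' (t • stdBasis 2) :=
    graphForm_ker_injective fun v => by rw [← mem_H_iff, ht, mem_H_iff]
  simpa [coefH] using congrFun hcoef 2

/-! ### Deformations of the standard complex contact structure -/

section Model

variable {n : ℕ} {s : EuclideanSpace ℝ (Fin n)} {x : E6}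

/-- The polynomial `∑ s_k ζ^(k + j) / (k + j)!`, whose derivative lowers `j` by one. -/
noncomputable def divPow (j : ℕ) (s : EuclideanSpace ℝ (Fin n)) (ζ : ℂ) : ℂ :=
  ∑ k, (s k : ℂ) * (ζ ^ ((k : ℕ) + j) / ((k : ℕ) + j).factorial)

lemma hasDerivAt_divPow (j : ℕ) (s : EuclideanSpace ℝ (Fin n)) (ζ : ℂ) :
    HasDerivAt (divPow (j + 1) s) (divPow j s ζ) ζ := by
  refine HasDerivAt.fun_sum fun k _ => ?_
  convert! ((hasDerivAt_pow ((k : ℕ) + (j + 1)) ζ).div_const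
    (((k : ℕ) + (j + 1)).factorial : ℂ)).const_mul (s k : ℂ) using 2
  rw [← Nat.add_assoc, Nat.factorial_succ, Nat.add_sub_cancel]
  push_cast
  rw [mul_div_mul_left _ _ (by exact_mod_cast Nat.succ_ne_zero ((k : ℕ) + j))]

lemma iteratedDeriv_divPow (s : EuclideanSpace ℝ (Fin n)) (k : Fin n) :
    iteratedDeriv k (fun t : ℝ => divPow 0 s (t : ℂ)) 0 = s k := by
  have hsum : (fun t : ℝ => divPow 0 s (t : ℂ))
      = fun t : ℝ => ∑ l : Fin n, (t ^ (l : ℕ)) • ((s l : ℂ) / (l : ℕ).factorial) := by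
    ext t
    refine Finset.sum_congr rfl fun l _ => ?_
    simp only [Complex.real_smul, Complex.ofReal_pow, add_zero]
    ring
  have hterm (l : Fin n) : iteratedDeriv k (fun t : ℝ => (t ^ (l : ℕ)) •
      ((s l : ℂ) / (l : ℕ).factorial)) 0 = if l = k then (s k : ℂ) else 0 := by
    rw [iteratedDeriv_smul_const (by fun_prop), iteratedDeriv_fun_pow_zero]
    rcases eq_or_ne l k with rfl | hl
    · have hfactorial : ((l : ℕ).factorial : ℂ) ≠ 0 := by
        exact_mod_cast (l : ℕ).factorial_ne_zero
      simp [mul_div_cancel₀ _ hfactorial]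
    · have hne : (k : ℕ) ≠ l := fun h => hl (Fin.ext h.symm)
      simp [hl, hne]
  rw [hsum, iteratedDeriv_fun_sum fun l _ => by fun_prop]
  simp only [hterm, Finset.sum_ite_eq', Finset.mem_univ, if_true]

/-- The complex coordinate `ū = x₀ - √-1 x₁`. -/
noncomputable def uBar : E6 →L[ℝ] ℂ := (Complex.conjCLE : ℂ →L[ℝ] ℂ).comp (complexCoord 0 1)

lemma uBar_apply (x : E6) : uBar x = x 0 - Complex.I * x 1 := by
  simp [uBar, complexCoord_apply, sub_eq_add_neg]

/-- The coefficients of the graph `dw = v du - Φ_s(ū) dv̄`, with `u = x₀ + √-1 x₁`,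
`v = x₂ + √-1 x₃`, `w = x₄ + √-1 x₅` and `Φ_s = divPow 2 s`: a deformation of the standard complex
contact structure `dw = v du`, with torsion `Φ_s''(ū)`. -/
noncomputable def modelCoef (s : EuclideanSpace ℝ (Fin n)) (x : E6) : Fin 4 → ℂ :=
  ![complexCoord 2 3 x, Complex.I * complexCoord 2 3 x, -divPow 2 s (uBar x),
    Complex.I * divPow 2 s (uBar x)]

lemma contDiff_modelCoef :
    ContDiff ℝ ∞ fun z : EuclideanSpace ℝ (Fin n) × E6 => modelCoef z.1 z.2 := by
  have hcoord : ContDiff ℝ ∞ fun z : EuclideanSpace ℝ (Fin n) × E6 => complexCoord 2 3 z.2 :=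
    (complexCoord 2 3).contDiff.comp contDiff_snd
  have huBar : ContDiff ℝ ∞ fun z : EuclideanSpace ℝ (Fin n) × E6 => uBar z.2 :=
    uBar.contDiff.comp contDiff_snd
  have hparam (k : Fin n) : ContDiff ℝ ∞ fun z : EuclideanSpace ℝ (Fin n) × E6 => (z.1 k : ℂ) :=
    (Complex.ofRealCLM.comp (EuclideanSpace.proj k)).contDiff.comp contDiff_fst
  have hdivPow : ContDiff ℝ ∞ fun z : EuclideanSpace ℝ (Fin n) × E6 => divPow 2 z.1 (uBar z.2) :=
    ContDiff.sum fun k _ => (hparam k).mul ((huBar.pow _).div_const _)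
  rw [contDiff_pi]
  intro i
  fin_cases i
  · exact hcoord
  · exact contDiff_const.mul hcoord
  · exact hdivPow.neg
  · exact contDiff_const.mul hdivPow

lemma contDiff_modelCoef_right (s : EuclideanSpace ℝ (Fin n)) : ContDiff ℝ ∞ (modelCoef s) :=
  contDiff_modelCoef.comp (contDiff_const.prodMk contDiff_id)

lemma hasFDerivAt_divPow_uBar (j : ℕ) (s : EuclideanSpace ℝ (Fin n)) (x : E6) :
    HasFDerivAt (fun y => divPow (j + 1) s (uBar y)) (divPow j s (uBar x) • uBar) x :=
  (hasDerivAt_divPow j s (uBar x)).comp_hasFDerivAt x uBar.hasFDerivAt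

lemma fderiv_modelCoef (s : EuclideanSpace ℝ (Fin n)) (x u : E6) :
    fderiv ℝ (modelCoef s) x u = ![complexCoord 2 3 u, Complex.I * complexCoord 2 3 u,
      -(divPow 1 s (uBar x) * uBar u), Complex.I * (divPow 1 s (uBar x) * uBar u)] := by
  have hderiv : HasFDerivAt (modelCoef s) (ContinuousLinearMap.pi
      ![complexCoord 2 3, Complex.I • complexCoord 2 3, -(divPow 1 s (uBar x) • uBar),
        Complex.I • (divPow 1 s (uBar x) • uBar)]) x := by
    rw [hasFDerivAt_pi']
    intro i
    rw [ContinuousLinearMap.proj_pi]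
    fin_cases i
    · exact (complexCoord 2 3).hasFDerivAt
    · exact (complexCoord 2 3).hasFDerivAt.const_mul Complex.I
    · exact (hasFDerivAt_divPow_uBar 1 s x).neg
    · exact (hasFDerivAt_divPow_uBar 1 s x).const_mul Complex.I
  rw [hderiv.fderiv]
  ext i
  fin_cases i <;> simp

lemma fderiv_modelCoef_vertical (s : EuclideanSpace ℝ (Fin n)) (x : E6) (a : ℂ) :
    fderiv ℝ (modelCoef s) x (vertical a) = 0 := by
  rw [fderiv_modelCoef]
  ext i
  fin_cases i <;> simp [complexCoord_apply, uBar_apply, vertical_apply]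

/-- The curvature of the model with first derivative `a = Φ_s'(ū)`. -/
noncomputable def modelCurvature (a : ℂ) : Fin 4 → Fin 4 → ℂ :=
  ![![0, 0, -a - 1, Complex.I * (a - 1)], ![0, 0, Complex.I * (a - 1), a + 1],
    ![a + 1, -(Complex.I * (a - 1)), 0, 0], ![-(Complex.I * (a - 1)), -a - 1, 0, 0]]

lemma curvature_modelCoef (s : EuclideanSpace ℝ (Fin n)) (x : E6) :
    curvature (modelCoef s) x = modelCurvature (divPow 1 s (uBar x)) := by
  ext i j
  fin_cases i <;> fin_cases j <;>
    simp [modelCurvature, curvature, fderiv_modelCoef, complexCoord_apply,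
      uBar_apply (horizontalLift _ _), horizontalLift_apply_zero, horizontalLift_apply_one,
      horizontalLift_apply_two, horizontalLift_apply_three]
  · ring
  · ring
  · linear_combination (-divPow 1 s (uBar x)) * Complex.I_mul_I
  · ring
  · ring
  · ring
  · linear_combination divPow 1 s (uBar x) * Complex.I_mul_I

section

variable {a : ℂ}

lemma isElliptic_modelCurvature (ha : ‖a‖ < 1) : IsElliptic (modelCurvature a) := by
  have hmixed : mixedPfaffian (modelCurvature a) = 4 * (1 + ‖a‖ ^ 2) := by
    simp [mixedPfaffian, modelCurvature, ← Complex.normSq_eq_norm_sq, Complex.normSq_apply]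
    ring
  have hpf : pfaffian (modelCurvature a) = 4 * a := by
    simp [pfaffian, modelCurvature]
    linear_combination (a - 1) ^ 2 * Complex.I_mul_I
  have hpos : 0 < 1 - ‖a‖ ^ 2 := by nlinarith [norm_nonneg a]
  rw [IsElliptic, hmixed, hpf, Complex.normSq_eq_norm_sq, norm_mul, RCLike.norm_ofNat]
  exact ⟨by positivity, by nlinarith [sq_pos_of_pos hpos]⟩

lemma beltrami_modelCurvature (ha : ‖a‖ < 1) : beltrami (modelCurvature a) = -a := by
  refine ((isElliptic_modelCurvature ha).eq_beltrami (by rw [norm_neg]; exact ha.le) ?_).symm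
  simp [pfaffian, modelCurvature]
  linear_combination ((a - 1) ^ 2 - 2 * a * (a - 1) * (1 - (starRingEnd ℂ) a)
    + a ^ 2 * (1 - (starRingEnd ℂ) a) ^ 2) * Complex.I_sq

lemma one_sub_mul_conj_ne_zero (ha : ‖a‖ < 1) : 1 - a * (starRingEnd ℂ) a ≠ 0 := by
  have hne : 1 - ‖a‖ ^ 2 ≠ 0 := by nlinarith [norm_nonneg a]
  rw [Complex.mul_conj, Complex.normSq_eq_norm_sq]
  exact_mod_cast hne

end

lemma beltramiOf_modelCoef (h : ‖divPow 1 s (uBar x)‖ < 1) :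
    beltramiOf (modelCoef s) x = -divPow 1 s (uBar x) := by
  rw [beltramiOf, curvature_modelCoef, beltrami_modelCurvature h]

lemma beltramiCurvature_modelCoef (h : ‖divPow 1 s (uBar x)‖ < 1) :
    beltramiCurvature (modelCoef s) x 0 1 = 0 ∧
    beltramiCurvature (modelCoef s) x 0 2
      = -(1 - divPow 1 s (uBar x) * (starRingEnd ℂ) (divPow 1 s (uBar x))) ∧
    beltramiCurvature (modelCoef s) x 1 2
      = -Complex.I * (1 - divPow 1 s (uBar x) * (starRingEnd ℂ) (divPow 1 s (uBar x))) := by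
  simp only [beltramiCurvature, twistedCurvature, beltramiOf_modelCoef h, curvature_modelCoef,
    modelCurvature]
  refine ⟨?_, ?_, ?_⟩ <;> simp <;> ring

lemma isRegular_modelCoef (h : ‖divPow 1 s (uBar x)‖ < 1) : IsRegular (modelCoef s) x := by
  refine ⟨by rw [curvature_modelCoef]; exact isElliptic_modelCurvature h, ?_⟩
  rw [(beltramiCurvature_modelCoef h).2.2]
  exact mul_ne_zero (neg_ne_zero.2 Complex.I_ne_zero) (one_sub_mul_conj_ne_zero h)

lemma eventually_norm_divPow_lt (s : EuclideanSpace ℝ (Fin n)) :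
    ∀ᶠ x in 𝓝 (0 : E6), ‖divPow 1 s (uBar x)‖ < 1 :=
  (hasFDerivAt_divPow_uBar 0 s 0).continuousAt.norm.eventually_lt_const (by simp [divPow])

lemma torsion_modelCoef (h : ∀ᶠ y in 𝓝 x, ‖divPow 1 s (uBar y)‖ < 1) :
    torsion (modelCoef s) x = divPow 0 s (uBar x) := by
  obtain ⟨h01, h02, h12⟩ := beltramiCurvature_modelCoef h.self_of_nhds
  have hbeltrami : beltramiOf (modelCoef s) =ᶠ[𝓝 x] fun y => -divPow 1 s (uBar y) :=
    h.mono fun y hy => beltramiOf_modelCoef hy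
  have hderiv : fderiv ℝ (beltramiOf (modelCoef s)) x = -(divPow 0 s (uBar x) • uBar) :=
    hbeltrami.fderiv_eq.trans (hasFDerivAt_divPow_uBar 0 s x).neg.fderiv
  have hne := one_sub_mul_conj_ne_zero h.self_of_nhds
  rw [torsion, obstruction_eq_of_fderiv_vertical (fderiv_modelCoef_vertical s x), hderiv,
    ← beltramiCurvature]
  simp only [Fin.sum_univ_four, kernelVector, h01, h02, h12]
  simp [uBar_apply (horizontalLift _ _), horizontalLift_apply_zero, horizontalLift_apply_one]
  field_simp
  ring

/-- The deformation of the standard complex contact structure with coefficients `modelCoef s`. -/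
noncomputable def model (s : EuclideanSpace ℝ (Fin n)) (x : E6) : Submodule ℝ E6 :=
  (graphForm (modelCoef s x) : E6 →ₗ[ℝ] ℂ).ker

lemma mem_model {v : E6} : v ∈ model s x ↔ graphForm (modelCoef s x) v = 0 := Iff.rfl

lemma mem_model_zero_iff {v : E6} :
    v ∈ model (0 : EuclideanSpace ℝ (Fin n)) x ↔ stdForm x v = 0 := by
  have hzero : graphForm (modelCoef (0 : EuclideanSpace ℝ (Fin n)) x) v = stdForm x v := by
    simp [graphForm_apply, modelCoef, divPow, Fin.sum_univ_four, baseIndex, stdForm_apply,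
      toTriple_apply, complexCoord_apply]
    ring
  rw [mem_model, hzero]

lemma isRegularGerm_model (s : EuclideanSpace ℝ (Fin n)) : IsRegularGerm (model s) := by
  have hcoef : graphCoef (model s) = modelCoef s := funext fun _ => graphCoef_eq fun _ => mem_model
  refine ⟨⟨_, fun _ => mem_model⟩, ?_⟩
  rw [hcoef]
  exact isRegular_modelCoef (eventually_norm_divPow_lt s).self_of_nhds

lemma germInvariant_model (s : EuclideanSpace ℝ (Fin n)) : germInvariant n (model s) = s := by
  rw [germInvariant_eq_torsionJet (.of_forall fun _ _ => mem_model)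
    (isRegular_modelCoef (eventually_norm_divPow_lt s).self_of_nhds)]
  have htorsion : (fun t : ℝ => torsion (modelCoef s) (t • stdBasis 0)) =ᶠ[𝓝 0]
      fun t : ℝ => divPow 0 s (t : ℂ) := by
    filter_upwards [(tendsto_smul_stdBasis 0).eventually
      (eventually_norm_divPow_lt s).eventually_nhds] with t ht
    rw [torsion_modelCoef ht]
    simp [uBar_apply]
  ext k
  simp [torsionJet, htorsion.iteratedDeriv_eq, iteratedDeriv_divPow]

lemma isFat_model (s : EuclideanSpace ℝ (Fin n)) : IsFat (model s) 0 :=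
  isFat_of_isElliptic (.of_contDiff (contDiff_modelCoef_right s) 0)
    (.of_forall fun _ _ => mem_model)
    ((eventually_norm_divPow_lt s).mono fun _ hx => (isRegular_modelCoef hx).1)

lemma areReebDirections_model (s : EuclideanSpace ℝ (Fin n)) :
    AreReebDirections (model s) dz 0 :=
  areReebDirections_dz (.of_contDiff (contDiff_modelCoef_right s) 0)
    (.of_forall fun _ _ => mem_model) (.of_forall fun x a => fderiv_modelCoef_vertical s x a)

end Model

/-! ### Charts of six-manifolds -/

lemma IsLocalDiffeoNear.exists_openPartialHomeomorph {Ψ : E6 → E6} {p : E6}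
    (hΨ : IsLocalDiffeoNear Ψ p) :
    ∃ g : OpenPartialHomeomorph E6 E6, ⇑g = Ψ ∧ p ∈ g.source ∧
      (∀ y ∈ g.source, ContDiffAt ℝ ∞ g y) ∧ ∀ z ∈ g.target, ContDiffAt ℝ ∞ g.symm z := by
  obtain ⟨g, rfl, hpg, -⟩ :=
    exists_openPartialHomeomorph_of_bijective_fderiv (by simp) hΨ.1.contDiffAt hΨ.2
  obtain ⟨S, hS, hSo, hpS⟩ := eventually_nhds_iff.1 (hΨ.1.and hΨ.eventually_bijective)
  refine ⟨g.restrOpen S hSo, rfl, ⟨hpg, hpS⟩, fun y hy => (hS y hy.2).1, fun z hz => ?_⟩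
  obtain ⟨hzg, hzS⟩ : z ∈ g.target ∧ g.symm z ∈ S := by simpa using hz
  obtain ⟨hsmooth, hbij⟩ := hS _ hzS
  let g' : E6 ≃L[ℝ] E6 := ContinuousLinearEquiv.ofBijective (fderiv ℝ g (g.symm z))
    (LinearMap.ker_eq_bot.2 hbij.1) (LinearMap.range_eq_top.2 hbij.2)
  have hg' : (g' : E6 →L[ℝ] E6) = fderiv ℝ g (g.symm z) := by ext; rfl
  refine g.contDiffAt_symm (f₀' := g') hzg ?_ hsmooth
  rw [hg']
  exact (hsmooth.differentiableAt (by simp)).hasFDerivAt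

section Charts

variable {M : Type*} [TopologicalSpace M] [ChartedSpace E6 M]
  {e e' : OpenPartialHomeomorph M E6} {p x : M} {y : E6}

lemma mfderiv_chart_bijective (he : IsChartAt e p) (hx : x ∈ e.source) :
    Function.Bijective (mfderiv 𝓘(ℝ, E6) 𝓘(ℝ, E6) e x) :=
  OpenPartialHomeomorph.MDifferentiable.mfderiv_bijective
    ⟨(contMDiffOn_of_mem_maximalAtlas he.1).mdifferentiableOn (by simp),
      (contMDiffOn_symm_of_mem_maximalAtlas he.1).mdifferentiableOn (by simp)⟩ hx

/-- The coordinate change from the chart `e` to the chart `e'`. -/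
noncomputable def transition (e e' : OpenPartialHomeomorph M E6) : E6 → E6 := e' ∘ e.symm

lemma transition_apply (he : IsChartAt e p) : transition e e' (e p) = e' p := by
  rw [transition, Function.comp_apply, e.left_inv he.2]

lemma tendsto_chart_symm (he : IsChartAt e p) : Tendsto e.symm (𝓝 (e p)) (𝓝 p) := by
  simpa only [ContinuousAt, e.left_inv he.2] using e.continuousAt_symm (e.map_source he.2)

lemma eventually_mem_target (he : IsChartAt e p) : ∀ᶠ y in 𝓝 (e p), y ∈ e.target :=
  e.open_target.mem_nhds (e.map_source he.2)

lemma eventually_symm_mem_source (he : IsChartAt e p) (he' : IsChartAt e' p) :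
    ∀ᶠ y in 𝓝 (e p), e.symm y ∈ e'.source :=
  (tendsto_chart_symm he).eventually_mem (e'.open_source.mem_nhds he'.2)

lemma contDiffAt_transition (he : IsChartAt e p) (he' : IsChartAt e' p) (hy : y ∈ e.target)
    (hy' : e.symm y ∈ e'.source) : ContDiffAt ℝ ∞ (transition e e') y :=
  ((contMDiffAt_of_mem_maximalAtlas he'.1 hy').comp y
    (contMDiffAt_symm_of_mem_maximalAtlas he.1 hy)).contDiffAt

lemma mfderiv_eq_transition (he : IsChartAt e p) (he' : IsChartAt e' p) (hy : y ∈ e.target)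
    (hy' : e.symm y ∈ e'.source) (v : TangentSpace 𝓘(ℝ, E6) (e.symm y)) :
    mfderiv 𝓘(ℝ, E6) 𝓘(ℝ, E6) e' (e.symm y) v
      = fderiv ℝ (transition e e') y (mfderiv 𝓘(ℝ, E6) 𝓘(ℝ, E6) e (e.symm y) v) := by
  have hx := e.map_target hy
  have hcomp : e' =ᶠ[𝓝 (e.symm y)] transition e e' ∘ e := by
    filter_upwards [e.open_source.mem_nhds hx] with x hx
    simp only [transition, Function.comp_apply, e.left_inv hx]
  have he_diff : MDifferentiableAt 𝓘(ℝ, E6) 𝓘(ℝ, E6) e (e.symm y) :=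
    (contMDiffAt_of_mem_maximalAtlas he.1 hx).mdifferentiableAt (by simp)
  have htrans_diff : MDifferentiableAt 𝓘(ℝ, E6) 𝓘(ℝ, E6) (transition e e') (e (e.symm y)) := by
    rw [e.right_inv hy]
    exact ((contDiffAt_transition he he' hy hy').differentiableAt (by simp)).mdifferentiableAt
  rw [hcomp.mfderiv_eq, mfderiv_comp _ htrans_diff he_diff, mfderiv_eq_fderiv, e.right_inv hy]
  rfl

lemma isLocalDiffeoNear_transition (he : IsChartAt e p) (he' : IsChartAt e' p) :
    IsLocalDiffeoNear (transition e e') (e p) := by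
  have htarget := eventually_mem_target he
  have hsource := eventually_symm_mem_source he he'
  refine ⟨(htarget.and hsource).mono fun y hy => contDiffAt_transition he he' hy.1 hy.2, ?_⟩
  have hchain : (mfderiv 𝓘(ℝ, E6) 𝓘(ℝ, E6) e' (e.symm (e p)) : E6 → E6)
      = fderiv ℝ (transition e e') (e p) ∘ mfderiv 𝓘(ℝ, E6) 𝓘(ℝ, E6) e (e.symm (e p)) :=
    funext fun v => mfderiv_eq_transition he he' htarget.self_of_nhds hsource.self_of_nhds v
  have hbij' := mfderiv_chart_bijective he' hsource.self_of_nhds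
  rw [hchain] at hbij'
  exact (Function.Bijective.of_comp_iff _
    (mfderiv_chart_bijective he (e.map_target htarget.self_of_nhds))).1 hbij'

lemma tendsto_transition (he : IsChartAt e p) (he' : IsChartAt e' p) :
    Tendsto (transition e e') (𝓝 (e p)) (𝓝 (e' p)) := by
  simpa only [ContinuousAt, transition_apply he] using
    (isLocalDiffeoNear_transition he he').1.continuousAt

lemma eventually_of_eventually_transition (he : IsChartAt e p) (he' : IsChartAt e' p)
    {P : E6 → Prop} (h : ∀ᶠ y in 𝓝 (e p), P (transition e e' y)) : ∀ᶠ z in 𝓝 (e' p), P z := by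
  filter_upwards [(tendsto_transition he' he).eventually h, eventually_mem_target he',
    eventually_symm_mem_source he' he] with z hz htarget hsource
  have hinv : transition e e' (transition e' e z) = z := by
    rw [transition, transition, Function.comp_apply, Function.comp_apply, e.left_inv hsource,
      e'.right_inv htarget]
  rwa [hinv] at hz

lemma IsChartAt.exists_comp [IsManifold 𝓘(ℝ, E6) ∞ M] (he : IsChartAt e p) {Ψ : E6 → E6}
    (hΨ : IsLocalDiffeoNear Ψ (e p)) :
    ∃ e' : OpenPartialHomeomorph M E6, IsChartAt e' p ∧ ⇑e' = Ψ ∘ e := by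
  obtain ⟨g, rfl, hpg, hg, hgsymm⟩ := hΨ.exists_openPartialHomeomorph
  refine ⟨e.trans g, ⟨OpenPartialHomeomorph.mem_maximalAtlas_of_contMDiffOn _ ?_ ?_, ?_⟩, rfl⟩
  · intro x hx
    rw [e.trans_source] at hx
    exact ((hg _ hx.2).contMDiffAt.comp x
      (contMDiffAt_of_mem_maximalAtlas he.1 hx.1)).contMDiffWithinAt
  · intro z hz
    rw [e.trans_target] at hz
    exact ((contMDiffAt_symm_of_mem_maximalAtlas he.1 hz.2).comp z
      (hgsymm _ hz.1).contMDiffAt).contMDiffWithinAt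
  · rw [e.trans_source]
    exact ⟨he.2, hpg⟩

section InChart

variable {D D' : Distribution M}

lemma mem_inChart {v : E6} :
    v ∈ inChart e D y ↔ ∃ u ∈ D (e.symm y), mfderiv 𝓘(ℝ, E6) 𝓘(ℝ, E6) e (e.symm y) u = v :=
  Iff.rfl

lemma eventually_mem_inChart_iff (he : IsChartAt e p) (he' : IsChartAt e' p) :
    ∀ᶠ y in 𝓝 (e p), ∀ (D : Distribution M) (v : E6), v ∈ inChart e D y ↔
      fderiv ℝ (transition e e') y v ∈ inChart e' D (transition e e' y) := by
  filter_upwards [eventually_mem_target he, eventually_symm_mem_source he he'] with y hy hy' D v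
  obtain ⟨u, hu⟩ := (mfderiv_chart_bijective he (e.map_target hy)).2 v
  have hsymm : e'.symm (transition e e' y) = e.symm y := e'.left_inv hy'
  have hu' := mfderiv_eq_transition he he' hy hy' u
  rw [hu] at hu'
  rw [mem_inChart, mem_inChart, hsymm, ← hu', ← hu]
  have hinj := (mfderiv_chart_bijective he (e.map_target hy)).1
  have hinj' := (mfderiv_chart_bijective he' hy').1
  constructor
  · rintro ⟨w, hw, hwu⟩
    exact ⟨u, hinj hwu ▸ hw, rfl⟩
  · rintro ⟨w, hw, hwu⟩
    exact ⟨u, hinj' hwu ▸ hw, rfl⟩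

lemma supportsComplexContact_inChart (hD : D ∈ complexContactGerms p) (he : IsChartAt e p) :
    SupportsComplexContact (inChart e D) (e p) := by
  obtain ⟨e', he', hD⟩ := hD
  rw [← transition_apply he (e' := e')] at hD
  exact hD.pullback (isLocalDiffeoNear_transition he he')
    ((eventually_mem_inChart_iff he he').mono fun y hy => hy D)

lemma inChart_congr (he : IsChartAt e p) (h : ∀ᶠ x in 𝓝 p, D x = D' x) :
    inChart e D =ᶠ[𝓝 (e p)] inChart e D' := by
  filter_upwards [(tendsto_chart_symm he).eventually h] with y hy
  rw [inChart, inChart, hy]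

end InChart

section OfChart

variable {D : Distribution M} {K : E6 → Submodule ℝ E6}

/-- The distribution on `M` that corresponds to `K` under the chart `e`. -/
noncomputable def ofChart (e : OpenPartialHomeomorph M E6) (K : E6 → Submodule ℝ E6) :
    Distribution M := fun x =>
  (K (e x)).comap (mfderiv 𝓘(ℝ, E6) 𝓘(ℝ, E6) e x).toLinearMap

lemma mem_ofChart {u : TangentSpace 𝓘(ℝ, E6) x} :
    u ∈ ofChart e K x ↔ (mfderiv 𝓘(ℝ, E6) 𝓘(ℝ, E6) e x u : E6) ∈ K (e x) :=
  Iff.rfl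

lemma inChart_ofChart (he : IsChartAt e p) (hy : y ∈ e.target) :
    inChart e (ofChart e K) y = K y := by
  ext v
  simp only [mem_inChart, mem_ofChart, e.right_inv hy]
  constructor
  · rintro ⟨u, hu, rfl⟩
    exact hu
  · intro hv
    obtain ⟨u, rfl⟩ := (mfderiv_chart_bijective he (e.map_target hy)).2 v
    exact ⟨u, hv, rfl⟩

lemma eventually_inChart_ofChart (he : IsChartAt e p) (K : E6 → Submodule ℝ E6) :
    inChart e (ofChart e K) =ᶠ[𝓝 (e p)] K :=
  (eventually_mem_target he).mono fun _ hy => inChart_ofChart he hy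

lemma ofChart_eventuallyEq (he : IsChartAt e p) (h : inChart e D =ᶠ[𝓝 (e p)] K) :
    ∀ᶠ x in 𝓝 p, ofChart e K x = D x := by
  filter_upwards [(e.continuousAt he.2).eventually h, e.open_source.mem_nhds he.2] with x hx hxe
  ext u
  have hmem (v : E6) : v ∈ K (e x) ↔ ∃ w ∈ D x, mfderiv 𝓘(ℝ, E6) 𝓘(ℝ, E6) e x w = v := by
    rw [← hx, mem_inChart, e.left_inv hxe]
  refine (mem_ofChart.trans (hmem _)).trans ⟨?_, ?_⟩
  · rintro ⟨w, hw, hwu⟩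
    rwa [← (mfderiv_chart_bijective he hxe).1 hwu]
  · exact fun hu => ⟨u, hu, rfl⟩

end OfChart

lemma exists_darboux_chart [IsManifold 𝓘(ℝ, E6) ∞ M] {D : Distribution M}
    (hD : D ∈ complexContactGerms p) : ∃ e : OpenPartialHomeomorph M E6,
      IsChartAt e p ∧ e p = 0 ∧
      ∀ᶠ y in 𝓝 (0 : E6), ∀ v, v ∈ inChart e D y ↔ stdForm y v = 0 := by
  obtain ⟨e, he, hD⟩ := hD
  obtain ⟨Ψ, hΨ, hΨ0, hΨD⟩ := hD.exists_darboux
  obtain ⟨e', he', heΨ⟩ := he.exists_comp hΨ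
  have he'0 : e' p = 0 := by rw [heΨ, Function.comp_apply, hΨ0]
  have htrans : transition e e' =ᶠ[𝓝 (e p)] Ψ := by
    filter_upwards [eventually_mem_target he] with y hy
    rw [transition, Function.comp_apply, heΨ, Function.comp_apply, e.right_inv hy]
  refine ⟨e', he', he'0, ?_⟩
  rw [← he'0]
  refine eventually_of_eventually_transition he he' ?_
  filter_upwards [eventually_mem_inChart_iff he he', hΨD, htrans.eventuallyEq_nhds,
    hΨ.eventually_bijective] with y hcoord hstd htrans hbij w
  obtain ⟨v, rfl⟩ := hbij.2 w
  rw [htrans.self_of_nhds, ← hstd, hcoord, htrans.fderiv_eq, htrans.self_of_nhds]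

end Charts

section Germs

variable {D D' : E6 → Submodule ℝ E6} {p : E6}

lemma IsDefinedBy.congr {θ : Fin 2 → E6 → E6 →L[ℝ] ℝ} (h : IsDefinedBy D θ p)
    (hD : D' =ᶠ[𝓝 p] D) : IsDefinedBy D' θ p :=
  ⟨h.1, h.2.1, by filter_upwards [h.2.2, hD] with x hx hDx v; rw [hDx, hx]⟩

lemma IsFat.congr (h : IsFat D p) (hD : D' =ᶠ[𝓝 p] D) : IsFat D' p := by
  obtain ⟨θ, hθ, hfat⟩ := h
  refine ⟨θ, hθ.congr hD, ?_⟩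
  filter_upwards [hfat, hD] with x hx hDx
  rwa [hDx]

lemma AreReebDirections.congr {Z : Fin 2 → E6 → E6} (h : AreReebDirections D Z p)
    (hD : D' =ᶠ[𝓝 p] D) : AreReebDirections D' Z p := by
  obtain ⟨hZ, θ, hθ, hreeb⟩ := h
  refine ⟨hZ, θ, hθ.congr hD, ?_⟩
  filter_upwards [hreeb, hD] with x hx hDx
  rwa [hDx]

end Germs

/-! ### Complex-contact germs among fat germs with Reeb directions -/

/-- The complex coordinates `(u, v, w)` on `ℝ⁶`, with values in `C3`. -/
noncomputable def toC3 : E6 ≃L[ℝ] C3 :=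
  toTriple.trans <| LinearEquiv.toContinuousLinearEquiv
    { toFun := fun ζ => !₂[ζ.1, ζ.2.1, ζ.2.2]
      map_add' := fun ζ ξ => by ext i; fin_cases i <;> rfl
      map_smul' := fun c ζ => by ext i; fin_cases i <;> rfl
      invFun := fun z => (z 0, z 1, z 2)
      left_inv := fun ζ => rfl
      right_inv := fun z => by ext i; fin_cases i <;> rfl }

lemma toC3_apply (v : E6) : toC3 v = !₂[(toTriple v).1, (toTriple v).2.1, (toTriple v).2.2] := rfl

lemma supportsComplexContact_of_eventually_mem_iff_stdForm {D : E6 → Submodule ℝ E6} {p : E6}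
    (hD : ∀ᶠ x in 𝓝 p, ∀ v, v ∈ D x ↔ stdForm x v = 0) : SupportsComplexContact D p := by
  let π (i : Fin 3) : C3 →L[ℂ] ℂ := EuclideanSpace.proj i
  let α : C3 → C3 →L[ℂ] ℂ := fun z => π 2 - π 1 z • π 0
  have hα (z : C3) : HasFDerivAt α (-(π 1).smulRight (π 0)) z :=
    ((π 1).hasFDerivAt.smul_const (π 0)).const_sub (π 2)
  refine ⟨toC3, isLocalDiffeoNear_continuousLinearEquiv toC3 p, α, ⟨?_, ?_⟩, ?_⟩
  · exact analyticAt_const.sub (((π 1).analyticAt _).smul analyticAt_const)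
  · refine ⟨EuclideanSpace.single 0 1, EuclideanSpace.single 1 1, EuclideanSpace.single 2 1, ?_⟩
    simp only [extD, (hα _).fderiv]
    simp [α, π]
  · filter_upwards [hD] with x hx v
    rw [hx, toC3.fderiv, ContinuousLinearEquiv.coe_coe, toC3_apply, toC3_apply, stdForm_apply]
    rfl

section Codimension

variable {M : Type*} [TopologicalSpace M] [ChartedSpace E6 M]
  {p : M} {D : Distribution M} {e : OpenPartialHomeomorph M E6}

lemma mem_fatReebGerms_of_chart {K : E6 → Submodule ℝ E6} {Z : Fin 2 → E6 → E6}
    (he : IsChartAt e p) (h0 : e p = 0) (hDK : inChart e D =ᶠ[𝓝 0] K) (hfat : IsFat K 0)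
    (hreeb : AreReebDirections K Z 0) : D ∈ fatReebGerms p :=
  ⟨e, he, h0.symm ▸ hfat.congr hDK, Z, h0.symm ▸ hreeb.congr hDK⟩

lemma mem_fatReebGerms_of_model {n : ℕ} {s : EuclideanSpace ℝ (Fin n)} (he : IsChartAt e p)
    (h0 : e p = 0) (hD : inChart e D =ᶠ[𝓝 0] model s) : D ∈ fatReebGerms p :=
  mem_fatReebGerms_of_chart he h0 hD (isFat_model s) (areReebDirections_model s)

lemma exists_chart_eventuallyEq_model [IsManifold 𝓘(ℝ, E6) ∞ M] (hD : D ∈ complexContactGerms p)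
    (n : ℕ) : ∃ e : OpenPartialHomeomorph M E6, IsChartAt e p ∧ e p = 0 ∧
      inChart e D =ᶠ[𝓝 0] model (0 : EuclideanSpace ℝ (Fin n)) := by
  obtain ⟨e, he, h0, hstd⟩ := exists_darboux_chart hD
  refine ⟨e, he, h0, hstd.mono fun y hy => ?_⟩
  ext v
  rw [hy, mem_model_zero_iff]

lemma complexContactGerms_nonempty [IsManifold 𝓘(ℝ, E6) ∞ M] (p : M) :
    (complexContactGerms p).Nonempty := by
  have he : IsChartAt (chartAt E6 p) p :=
    ⟨IsManifold.chart_mem_maximalAtlas p, mem_chart_source E6 p⟩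
  refine ⟨ofChart (chartAt E6 p) (model (0 : EuclideanSpace ℝ (Fin 0))), _, he,
    supportsComplexContact_of_eventually_mem_iff_stdForm ?_⟩
  filter_upwards [eventually_inChart_ofChart he _] with y hy v
  rw [hy, mem_model_zero_iff]

lemma complexContactGerms_subset [IsManifold 𝓘(ℝ, E6) ∞ M] (p : M) :
    complexContactGerms p ⊆ fatReebGerms p := fun D hD => by
  obtain ⟨e, he, h0, hmodel⟩ := exists_chart_eventuallyEq_model hD 0
  exact mem_fatReebGerms_of_model he h0 hmodel

section Families

variable {m : ℕ} {D : EuclideanSpace ℝ (Fin m) → Distribution M}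

/-- The complex-valued forms `θ (s, ·)` define the family `D` in the chart `e`, near `p` and for
parameters `s` near `0`; their real and imaginary parts are the two real forms of
`IsSmoothFamily`. -/
def IsDefinedInChart (D : EuclideanSpace ℝ (Fin m) → Distribution M)
    (e : OpenPartialHomeomorph M E6) (p : M)
    (θ : EuclideanSpace ℝ (Fin m) × E6 → E6 →L[ℝ] ℂ) : Prop :=
  SmoothNear θ (0, e p) ∧ ∀ᶠ z in 𝓝 ((0 : EuclideanSpace ℝ (Fin m)), e p),
    ∀ v, v ∈ inChart e (D z.1) z.2 ↔ θ z v = 0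

lemma IsSmoothFamily.exists_isDefinedInChart (hD : IsSmoothFamily D p) :
    ∃ e : OpenPartialHomeomorph M E6, IsChartAt e p ∧ ∃ θ, IsDefinedInChart D e p θ := by
  obtain ⟨e, he, θ, hθ, -, hD⟩ := hD
  have hofReal : ContDiff ℝ ∞ (ContinuousLinearMap.compL ℝ E6 ℝ ℂ Complex.ofRealCLM) :=
    ContinuousLinearMap.contDiff _
  refine ⟨e, he, fun z => Complex.ofRealCLM.comp (θ 0 z)
    + Complex.I • Complex.ofRealCLM.comp (θ 1 z), ?_, ?_⟩
  · filter_upwards [hθ 0, hθ 1] with z h0 h1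
    exact (hofReal.contDiffAt.comp z h0).add ((hofReal.contDiffAt.comp z h1).const_smul _)
  · filter_upwards [hD] with z hz v
    rw [hz, Fin.forall_fin_two, Complex.ext_iff]
    simp

lemma IsDefinedInChart.change_chart {e e' : OpenPartialHomeomorph M E6}
    {θ : EuclideanSpace ℝ (Fin m) × E6 → E6 →L[ℝ] ℂ} (hD : IsDefinedInChart D e' p θ)
    (he : IsChartAt e p) (he' : IsChartAt e' p) :
    IsDefinedInChart D e p fun z =>
      (θ (z.1, transition e e' z.2)).comp (fderiv ℝ (transition e e') z.2) := by
  have htrans := (isLocalDiffeoNear_transition he he').1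
  have hsnd : Tendsto Prod.snd (𝓝 ((0 : EuclideanSpace ℝ (Fin m)), e p)) (𝓝 (e p)) :=
    continuousAt_snd
  have hmap : Tendsto (fun z : EuclideanSpace ℝ (Fin m) × E6 => (z.1, transition e e' z.2))
      (𝓝 (0, e p)) (𝓝 (0, e' p)) :=
    continuousAt_fst.tendsto.prodMk_nhds ((tendsto_transition he he').comp hsnd)
  refine ⟨?_, ?_⟩
  · filter_upwards [hmap.eventually hD.1, hsnd.eventually htrans,
      hsnd.eventually htrans.fderiv] with z hθz hz hdz
    exact (hθz.comp z (contDiffAt_fst.prodMk (hz.comp z contDiffAt_snd))).clm_comp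
      (hdz.comp z contDiffAt_snd)
  · filter_upwards [hmap.eventually hD.2,
      hsnd.eventually (eventually_mem_inChart_iff he he')] with z hz hcoord v
    rw [hcoord, hz, ContinuousLinearMap.comp_apply]

end Families

lemma isSmoothFamily_ofChart_model (he : IsChartAt e p) (n : ℕ) :
    IsSmoothFamily (fun s : EuclideanSpace ℝ (Fin n) => ofChart e (model s)) p := by
  have hsmooth (g : ℂ →L[ℝ] ℝ) : ContDiff ℝ ∞ fun z : EuclideanSpace ℝ (Fin n) × E6 =>
      g.comp (graphForm (modelCoef z.1 z.2)) :=
    (ContinuousLinearMap.compL ℝ E6 ℂ ℝ g).contDiff.comp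
      (contDiff_graphForm.comp contDiff_modelCoef)
  refine ⟨e, he, fun i z => graphForms (modelCoef z.1) i z.2, Fin.forall_fin_two.2
    ⟨.of_contDiff (hsmooth _) _, .of_contDiff (hsmooth _) _⟩, ?_, ?_⟩
  · exact (isDefinedBy_graphForms (.of_contDiff (contDiff_modelCoef_right _) _)
      (.of_forall fun _ _ => mem_model)).2.1
  · have hsnd : Tendsto Prod.snd (𝓝 ((0 : EuclideanSpace ℝ (Fin n)), e p)) (𝓝 (e p)) :=
      continuousAt_snd
    filter_upwards [hsnd.eventually (eventually_mem_target he)] with z hz v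
    rw [inChart_ofChart he hz, mem_model, Fin.forall_fin_two, Complex.ext_iff]
    rfl

theorem hasInfiniteCodim_complexContactGerms [IsManifold 𝓘(ℝ, E6) ∞ M] (p : M) :
    HasInfiniteCodim (complexContactGerms p) (fatReebGerms p) p := by
  rintro n a ⟨ha, -⟩
  obtain ⟨e, he, h0, hmodel⟩ := exists_chart_eventuallyEq_model ha n
  have hcongr {D D' : Distribution M} (h : ∀ᶠ x in 𝓝 p, D x = D' x) :
      inChart e D =ᶠ[𝓝 0] inChart e D' := h0 ▸ inChart_congr he h
  have hofChart (K : E6 → Submodule ℝ E6) : inChart e (ofChart e K) =ᶠ[𝓝 0] K :=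
    h0 ▸ eventually_inChart_ofChart he K
  refine ⟨fun D => germInvariant n (inChart e D), fun D D' h => germInvariant_congr (hcongr h),
    fun D hD => ?_, fun m D hD => ?_, fun s => ofChart e (model s),
    ⟨isSmoothFamily_ofChart_model he n, ofChart_eventuallyEq he (h0.symm ▸ hmodel),
      .of_forall fun s => mem_fatReebGerms_of_model he h0 (hofChart _)⟩, ?_⟩
  · have hcontact := supportsComplexContact_inChart hD.1 he
    rw [h0] at hcontact
    exact hcontact.germInvariant_eq_zero n
  · obtain ⟨e', he', θ, hθ⟩ := hD.1.exists_isDefinedInChart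
    obtain ⟨hsmooth, hdef⟩ := hθ.change_chart he he'
    rw [h0] at hsmooth hdef
    exact smoothNear_germInvariant (D := fun s => inChart e (D s)) hsmooth hdef
      ((isRegularGerm_congr ((hcongr hD.2.1).trans hmodel)).2 (isRegularGerm_model _)) n
  · have hid : (fun s : EuclideanSpace ℝ (Fin n) =>
        germInvariant n (inChart e (ofChart e (model s)))) = id :=
      funext fun s => (germInvariant_congr (hofChart _)).trans (germInvariant_model s)
    rw [hid, fderiv_id]
    exact Function.surjective_id

end Codimension

end FatReeb

theorem mainTheorem2 :
    -- the germ at `0` of `H_κ`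
    (∀ κ : ℝ → ℝ, ContDiff ℝ ∞ κ →
      FatReeb.IsFat (FatReeb.H κ) 0 ∧
      FatReeb.AreReebDirections (FatReeb.H κ) FatReeb.dz 0 ∧
      ∀ (D' : FatReeb.E6 → Submodule ℝ FatReeb.E6) (q : FatReeb.E6),
        FatReeb.DiffeomorphicGerms (FatReeb.H κ) 0 D' q →
          ¬ FatReeb.SupportsComplexContact D' q) ∧
    -- the family of germs is as large as the space of germs of smooth functions
    (∀ κ κ' : ℝ → ℝ, ContDiff ℝ ∞ κ → ContDiff ℝ ∞ κ' →
      (∀ᶠ x in 𝓝 (0 : FatReeb.E6), FatReeb.H κ x = FatReeb.H κ' x) →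
        ∀ᶠ t in 𝓝 (0 : ℝ), κ t = κ' t) ∧
    -- every point of a six-manifold
    (∀ (M : Type*) [TopologicalSpace M] [ChartedSpace FatReeb.E6 M]
      [IsManifold 𝓘(ℝ, FatReeb.E6) ∞ M] (p : M),
      -- the family transported by a chart
      (∀ e : OpenPartialHomeomorph M FatReeb.E6, FatReeb.IsChartAt e p → e p = 0 →
        ∀ κ : ℝ → ℝ, ContDiff ℝ ∞ κ → ∀ D : FatReeb.Distribution M,
          (∀ᶠ y in 𝓝 (0 : FatReeb.E6), FatReeb.inChart e D y = FatReeb.H κ y) →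
            D ∈ FatReeb.fatReebGerms p \ FatReeb.complexContactGerms p) ∧
      -- complex-contact germs among fat germs with Reeb directions
      (FatReeb.complexContactGerms p).Nonempty ∧
      FatReeb.complexContactGerms p ⊆ FatReeb.fatReebGerms p ∧
      FatReeb.HasInfiniteCodim (FatReeb.complexContactGerms p) (FatReeb.fatReebGerms p) p) := by
  refine ⟨fun κ hκ => ⟨FatReeb.isFat_H hκ, FatReeb.areReebDirections_H hκ, ?_⟩,
    fun κ κ' _ _ h => FatReeb.eventually_eq_of_H_eq h, fun M _ _ _ p => ⟨?_,
      FatReeb.complexContactGerms_nonempty p, FatReeb.complexContactGerms_subset p,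
      FatReeb.hasInfiniteCodim_complexContactGerms p⟩⟩
  · rintro D' _ ⟨Φ, hΦ, rfl, hD⟩ hD'
    exact FatReeb.not_supportsComplexContact_H hκ (hD'.pullback hΦ (.of_map hΦ hD))
  · refine fun e he h0 κ hκ D hD => ⟨FatReeb.mem_fatReebGerms_of_chart he h0 hD
      (FatReeb.isFat_H hκ) (FatReeb.areReebDirections_H hκ), fun hcontact => ?_⟩
    have hchart := FatReeb.supportsComplexContact_inChart hcontact he
    rw [h0] at hchart
    exact FatReeb.not_supportsComplexContact_H hκ (hchart.congr (hD.mono fun _ hx => hx.symm))
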